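/- \textbf{Setting.} Let $P\subset\mathbb R^5$ be the right-angled hyperbolic polytope (Klein model) given by the 16 inequalities $\langle a,x\rangle\le 1$, where $a=(\pm1,\pm1,\pm1,\pm1,\pm1)$ has an even number of minus signs. Its facets are named by these vectors; two facets are adjacent iff their vectors differ in exactly two signs. The ideal vertices of $P$ are $\pm e_1,\dots,\pm e_5$. For $0<\varepsilon<\frac12$ let $\bar P=P\cap\{|x_i|\le 1-\varepsilon,\ i=1,\dots,5\}$; it has 10 further facets, the small 4-cubes $\bar P\cap\{\pm x_i=1-\varepsilon\}$. Colour the 16 facets with $1,\dots,8$, giving the same colour to $(x_1,x_2,x_3,x_4,x_5)$ and $(-x_1,-x_2,-x_3,-x_4,x_5)$: colours $1,2,3,4$ are the pairs of $(+,+,+,+,+)$, $(+,-,+,-,+)$, $(+,-,-,+,+)$, $(+,+,-,-,+)$, and colours $5,6,7,8$ are the pairs of $(-,+,+,+,-)$, $(+,+,+,-,-)$, $(+,-,+,+,-)$, $(+,+,-,+,-)$. Let $\bar M$ be the compact 5-manifold with boundary obtained from copies $\bar P_v$, $v\in(\mathbb Z/2)^8$, of $\bar P$ by identifying, via the identity map,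 each facet of $\bar P_v$ of colour $i$ with the same facet of $\bar P_{v+e_i}$; the small 4-cubes are left unglued and tessellate $\partial\bar M$. The moves are the sets of colours $\{t,t+4\}$, $t=1,2,3,4$. The four facets with colour in one move form a quartet, which consists of two pairs of adjacent facets. Fix a balanced initial state $s$: each facet has a status I (in) or O (out), and in each quartet one adjacent pair has status I and the other O. Give $\bar P_v$ the state $s_v$ obtained from $s$ by exchanging I and O on the quartet of $\{t,t+4\}$ for every $t$ with $v_t+v_{t+4}=1$. The barycentric subdivision of $\bar P$ (with the point nearest to the origin taken as the barycentre of each face) induces a decomposition of $\bar M$ dual to its tessellation into the polytopes $\bar P_v$: the face of $\bar P_v$ cut out by $k$ coloured facets, with or without a small 4-cube, is dual to a $k$-cube centred at its barycentre. Orient the edge of the dual cubulation crossing a facet of $\bar P_v$ out of $\bar P_v$ if the status of that facet in $s_v$ is O and into $\bar P_v$ if it is I; orient edges from the barycentre of $\bar P_v$ to that of one of its small 4-cubes towards the latter, and edges in $\partial\bar M$ parallel to the interior ones. Let $f:\bar M\to\mathbb R/\mathbb Z$ be the resulting diagonal map: it is affine on each barycentric simplex, increases by $1$ along each oriented edge,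 is $0$ at the barycentres of all $\bar P_v$, and at the centre of each dual cube equals the mean of the heights of the corners of the cube. (So on a coherently oriented cube $[0,1]^k$ it is $x_1+\dots+x_k$, and a square with corner heights $0,1,0,1$ is cut into four triangles with common vertex its centre, which has height $\frac12$.) \textbf{Proposition.} Let $T$ be a connected component of $\partial\bar M$ lying above the ideal vertex $\pm e_i$ of $P$. Call a homeomorphism $\mathbb R^4/L\mathbb Z^4\to T$ a cubical identification if it maps each unit cube $z+[-\frac12,\frac12]^4$, $z\in\mathbb Z^4$, affinely onto one of the small 4-cubes tessellating $T$. (1) If $i\le4$ ($T$ is a large boundary torus), there is a cubical identification of $T$ with $\mathbb R^4/4\mathbb Z^4$; and for each such identification, after permuting some coordinate axes and/or reversing their orientations, the restriction of $f$ to $T$ is isotopic (that is, equal up to precomposition with the final homeomorphism of an ambient isotopy of $\mathbb R^4/4\mathbb Z^4$) to the fibration $(x_1,x_2,x_3,x_4)\mapsto x_1$ onto $\mathbb R/\mathbb Z$. (2) If $i=5$ ($T$ is a small boundary torus), there is a cubical identification of $T$ with $\mathbb R^4/2\mathbb Z^4$; and for each such identification, after permuting some coordinate axes and/or reversing their orientations,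 the restriction of $f$ to $T$ equals $(x_1,x_2,x_3,x_4)\mapsto x_1+x_2+x_3+x_4\in\mathbb R/\mathbb Z$. -/

import Mathlib

noncomputable section

namespace GluedPolytope

/-! ### The right-angled polytope, its colouring, and the moves -/

/-- The 16 facets of the polytope `P⁵ ⊂ ℝ⁵`, named by their normal vectors `(±1, ±1, ±1, ±1, ±1)`
with an even number of minus signs. -/
abbrev Facet : Type := {a : Fin 5 → ℤˣ // ∏ i, a i = 1}

/-- The 10 ideal vertices `± e_i` of `P⁵`; `(i, σ)` stands for `σ • e_i`. -/
abbrev IdealVertex : Type := Fin 5 × ℤˣ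

/-- The scalar product of the normal vector of a facet with a point of `ℝ⁵`. -/
def dot (a : Facet) (x : Fin 5 → ℝ) : ℝ := ∑ i, (((a.1 i : ℤˣ) : ℤ) : ℝ) * x i

/-- Two facets of `P⁵` are adjacent when their normal vectors differ in exactly two signs. -/
def Adjacent (a b : Facet) : Prop := (Finset.univ.filter fun i => a.1 i ≠ b.1 i).card = 2

/-- The colouring of the facets with 8 colours; the colours `1, …, 8` are written `0, …, 7`.
The two facets of a colour are `(x₁, x₂, x₃, x₄, x₅)` and `(-x₁, -x₂, -x₃, -x₄, x₅)`:
* colours 1, 2, 3, 4: `±(+ + + +)`, `±(+ - + -)`, `±(+ - - +)`, `±(+ + - -)` with `x₅ = +`;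
* colours 5, 6, 7, 8: `±(- + + +)`, `±(+ + + -)`, `±(+ - + +)`, `±(+ + - +)` with `x₅ = -`.
Thus adjacent facets with colours `t` and `t + 4` differ exactly at the positions `t` and `5`. -/
def colour (a : Facet) : Fin 8 :=
  if a.1 4 = 1 then
    if a.1 0 = a.1 1 then (if a.1 0 = a.1 2 then 0 else 3)
    else (if a.1 0 = a.1 2 then 1 else 2)
  else
    if a.1 0 = a.1 1 then (if a.1 0 = a.1 2 then 5 else 7)
    else (if a.1 0 = a.1 2 then 6 else 4)

/-- The index of the move `{1,5}`, `{2,6}`, `{3,7}` or `{4,8}` that contains a given colour. -/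
def moveOf (c : Fin 8) : ℕ := (c : ℕ) % 4

/-- A state of `P⁵`: every facet gets a status, where `1` means O (out) and `-1` means I (in). -/
abbrev State : Type := Facet → ℤˣ

/-- A state is balanced if on each quartet (the four facets whose colours lie in one move) it gives
one status to one of the two adjacent pairs, and the other status to the other adjacent pair. -/
def IsBalanced (s : State) : Prop :=
  ∀ a b : Facet, moveOf (colour a) = moveOf (colour b) → (s a = s b ↔ a = b ∨ Adjacent a b)

/-- The state of the copy of the polytope with index `v ∈ (ℤ/2)⁸`: a move acts on the initial state
`s` (swapping the stati of its quartet) when the sum of the entries of `v` over the move is odd. -/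
def stateAt (s : State) (v : Fin 8 → ZMod 2) (a : Facet) : ℤˣ :=
  if (∑ i with moveOf i = moveOf (colour a), v i) = 0 then s a else -s a

/-! ### The truncated polytope and the compact 5-manifold glued from its copies -/

/-- The truncated polytope: the 16 half-spaces of `P⁵` and the 10 half-spaces `± x_i ≤ 1 - ε`. -/
def truncatedPolytope (ε : ℝ) : Set (Fin 5 → ℝ) :=
  {x | (∀ a : Facet, dot a x ≤ 1) ∧ ∀ i, |x i| ≤ 1 - ε}

/-- The elementary gluing: the facet `a` of the copy `v` is identified, by the identity map, with
the facet `a` of the copy `v + e_c`, where `c` is the colour of `a`. -/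
def GlueRel (ε : ℝ) (p q : Σ _ : Fin 8 → ZMod 2, truncatedPolytope ε) : Prop :=
  p.2 = q.2 ∧ ∃ a : Facet, dot a p.2.1 = 1 ∧ q.1 = p.1 + Pi.single (colour a) 1

/-- The compact 5-manifold with boundary glued from the `2⁸` copies of the truncated polytope. -/
def Manifold (ε : ℝ) : Type := Quot (GlueRel ε)

instance (ε : ℝ) : TopologicalSpace (Manifold ε) :=
  inferInstanceAs (TopologicalSpace (Quot (GlueRel ε)))

/-- The point `x` of the copy `v` of the truncated polytope, as a point of the manifold. -/
def Manifold.mk {ε : ℝ} (v : Fin 8 → ZMod 2) (x : truncatedPolytope ε) : Manifold ε :=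
  Quot.mk (GlueRel ε) ⟨v, x⟩

/-- The (uncoloured, unglued) cubic facet of the truncated polytope at an ideal vertex. -/
def cubicFacet (ε : ℝ) (q : IdealVertex) : Set (Fin 5 → ℝ) :=
  {x ∈ truncatedPolytope ε | ((q.2 : ℤ) : ℝ) * x q.1 = 1 - ε}

/-- The boundary of the manifold: the union of all copies of all cubic facets. -/
def boundary (ε : ℝ) : Set (Manifold ε) :=
  {p | ∃ (q : IdealVertex) (v : Fin 8 → ZMod 2) (x : truncatedPolytope ε),
    x.1 ∈ cubicFacet ε q ∧ p = Manifold.mk v x}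

/-- `C` is a connected component of the boundary that lies above the ideal vertex `q`. -/
def IsBoundaryComponentOver (ε : ℝ) (q : IdealVertex) (C : Set (Manifold ε)) : Prop :=
  ∃ (v : Fin 8 → ZMod 2) (x : truncatedPolytope ε),
    x.1 ∈ cubicFacet ε q ∧ C = connectedComponentIn (boundary ε) (Manifold.mk v x)

/-! ### The barycentric subdivision and the circle-valued diagonal map -/

/-- A (possibly empty) intersection of facets of the truncated polytope: the facets in `facets`,
and the cubic facet at `cusp` if there is one. -/
structure Cell where
  /-- the coloured facets -/
  facets : Finset Facet
  /-- the cubic facet, if any -/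
  cusp : Option IdealVertex

/-- The face of the truncated polytope that a cell stands for. -/
def Cell.face (ε : ℝ) (c : Cell) : Set (Fin 5 → ℝ) :=
  {x ∈ truncatedPolytope ε | (∀ a ∈ c.facets, dot a x = 1) ∧ ∀ q ∈ c.cusp, x ∈ cubicFacet ε q}

/-- The barycentre of a nonempty face, taken to be its point nearest to the origin. For a cubic
facet and its faces this is the centre. -/
def Cell.barycentre (ε : ℝ) (c : Cell) : Fin 5 → ℝ :=
  match c.cusp with
  | none => fun j => (∑ a ∈ c.facets, (((a.1 j : ℤˣ) : ℤ) : ℝ)) / ((c.facets.card : ℝ) + 4)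
  | some q => fun j =>
      if j = q.1 then ((q.2 : ℤ) : ℝ) * (1 - ε)
      else ε / 4 * ∑ a ∈ c.facets, (((a.1 j : ℤˣ) : ℤ) : ℝ)

/-- The total height gained along the path of edges of the dual cubulation that starts at the
barycentre of the copy `v` and crosses successively the facets in the list. Crossing a facet adds `1`
if its current status is O (the edge is oriented forwards), and `-1` if it is I. -/
def pathHeight (s : State) : (Fin 8 → ZMod 2) → List Facet → ℤ
  | _, [] => 0
  | v, a :: l => ((stateAt s v a : ℤˣ) : ℤ) + pathHeight s (v + Pi.single (colour a) 1) l

/-- The height, relative to the barycentre of the copy `v`, of the barycentre of a face of this copy.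
The face is the centre of a dual `k`-cube, `k` being the number of coloured facets that contain it,
and the height of the centre of a `k`-cube is the mean of the heights of its `2ᵏ` corners: on a
coherently oriented cube `[0,1]ᵏ` this is the value `k / 2` of `x₁ + ⋯ + x_k` at the centre, and on a
bad square, whose corners have heights `0, 1, 0, 1`, it is `1 / 2`. If the face lies in the boundary,
the edge that joins the barycentre of the copy to that of the cubic facet adds `1`. -/
def Cell.height (s : State) (v : Fin 8 → ZMod 2) (c : Cell) : ℝ :=
  (∑ T ∈ c.facets.powerset, (pathHeight s v T.toList : ℝ)) / 2 ^ c.facets.card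
    + (if c.cusp.isSome then 1 else 0)

/-- `HasValue ε s p y` says that `y ∈ ℝ/ℤ` is the value at `p` of the map that is affine on every
simplex of the barycentric subdivision of every copy of the truncated polytope, with the prescribed
heights at the vertices. A simplex is spanned by the barycentres of a flag `t` of faces, and
`w` are the barycentric coordinates in it. -/
def HasValue (ε : ℝ) (s : State) (p : Manifold ε) (y : AddCircle (1 : ℝ)) : Prop :=
  ∃ (v : Fin 8 → ZMod 2) (x : truncatedPolytope ε) (t : Finset Cell) (w : Cell → ℝ),
    p = Manifold.mk v x ∧
    (∀ c ∈ t, (c.face ε).Nonempty) ∧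
    (∀ c ∈ t, ∀ d ∈ t, c.face ε ⊆ d.face ε ∨ d.face ε ⊆ c.face ε) ∧
    (∀ c ∈ t, 0 ≤ w c) ∧ ∑ c ∈ t, w c = 1 ∧
    x.1 = ∑ c ∈ t, w c • c.barycentre ε ∧
    y = ((∑ c ∈ t, w c * c.height s v : ℝ) : AddCircle (1 : ℝ))

/-- The circle-valued diagonal map determined by the initial state `s` and the set of moves. -/
def diagonalMap (ε : ℝ) (s : State) (p : Manifold ε) : AddCircle (1 : ℝ) :=
  Classical.epsilon (HasValue ε s p)

/-! ### Tessellated tori and isotopies -/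

/-- The torus `ℝ⁴ / Lℤ⁴`. -/
abbrev Torus (L : ℕ) : Type := Fin 4 → AddCircle (L : ℝ)

/-- The projection `ℝ / Lℤ → ℝ / ℤ`. -/
def modOne (L : ℕ) : AddCircle (L : ℝ) →+ AddCircle (1 : ℝ) :=
  QuotientAddGroup.map (AddSubgroup.zmultiples (L : ℝ)) (AddSubgroup.zmultiples (1 : ℝ))
    (AddMonoidHom.id ℝ) (by
      rw [AddSubgroup.zmultiples_le, AddSubgroup.mem_comap]
      exact AddSubgroup.mem_zmultiples_iff.mpr ⟨L, by simp⟩)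

/-- The unit cube `[-1/2, 1/2]⁴`. -/
def unitCube : Set (Fin 4 → ℝ) := {y | ∀ j, |y j| ≤ 1 / 2}

/-- `ψ` identifies `ℝ⁴ / Lℤ⁴`, tessellated by the `L⁴` unit cubes with integral centres, with the
boundary component `C` above `q`, tessellated by copies of the cubic facet at `q`: it is a
homeomorphism onto `C`, and restricted to each unit cube it is an affine isomorphism onto some copy
of the cubic facet. -/
structure IsCubicalIdentification (ε : ℝ) (q : IdealVertex) (C : Set (Manifold ε)) (L : ℕ)
    (ψ : Torus L → Manifold ε) : Prop where
  isEmbedding : Topology.IsEmbedding ψ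
  range_eq : Set.range ψ = C
  cubes : ∀ z : Fin 4 → ℤ, ∃ (v : Fin 8 → ZMod 2) (A : (Fin 4 → ℝ) →ᵃ[ℝ] (Fin 5 → ℝ)),
    A '' unitCube = cubicFacet ε q ∧
    ∀ y ∈ unitCube, ∀ x : truncatedPolytope ε, x.1 = A y →
      ψ (fun j => (((z j : ℝ) + y j : ℝ) : AddCircle (L : ℝ))) = Manifold.mk v x

/-- Permutation of the coordinate axes of a torus, and reversal of some of them. -/
def signedPerm {L : ℕ} (τ : Equiv.Perm (Fin 4)) (η : Fin 4 → ℤˣ) (x : Torus L) : Torus L :=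
  fun j => ((η j : ℤˣ) : ℤ) • x (τ j)

/-- Two maps on `X` are isotopic if an ambient isotopy of `X` carries one to the other. -/
def IsIsotopic {X Y : Type*} [TopologicalSpace X] (f g : X → Y) : Prop :=
  ∃ Φ : unitInterval → X ≃ₜ X,
    Continuous (fun p : unitInterval × X => Φ p.1 p.2) ∧
    (∀ x, Φ 0 x = x) ∧ ∀ x, f (Φ 1 x) = g x

end GluedPolytope

end

/-!
The restriction of the diagonal map to a boundary torus is computed in coordinates.

*The cubes.* At the ideal vertex `q` the truncated polytope has a cubic facet, whose eight 3-faces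
are cut out by the eight facets `a` that meet it. They form four opposite pairs `a`, `opp q.1 a`. A
`Frame` chooses one facet of each pair, and `Frame.chart` is the resulting affine parametrization by
the unit cube; its inverse is given by the affine functions `cubeCoord`.

*The torus.* Along one axis the facets at its two ends are crossed alternately, each crossing being
a reflection. If the two ends have different colours (`q.1 ≠ 4`), one returns to the first copy of
the polytope after four steps, and if they have the same colour (`q.1 = 4`), after two. This gives
the covering map `Frame.devMap` from `ℝ⁴` to the boundary component; the manifold is Hausdorff and its
points can be told apart by `Manifold.pos` and `Manifold.sheet`, so that the induced map of the torus
is an embedding, with the whole component as its range (`range_devMap`). Conversely, every cubical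
identification is of this form (`IsCubicalIdentification.exists_devMap_eq`): an affine automorphism
of a cube is a signed permutation of the axes, and the parametrization of one cube determines those
of its neighbours.

*The diagonal map.* On the copy `v` of a cubic facet it is congruent modulo 1 to `diagonalHeight`
(`diagonalMap_mk`). Every quartet consists of two pairs of adjacent facets with opposite statuses, and a
pair `{a, partner a}` with status `± 1` contributes `±` the maximum of `0` and of the coordinates in
the directions of `a` and `partner a`. Indeed, crossing two facets of a pair one after the other gives
the total height `0`, so that the pair contributes `± 1/2` to the height of the barycentre of a face
contained in one or both of its facets; and in a flag of faces, one of the conditions "contained in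
`a`" and "contained in `partner a`" implies the other.

*Conclusion.* If both ends of an axis belong to one quartet, each to a pair whose other facet does
not meet the cubic facet, they have opposite statuses, and their contributions add up to `±` the
coordinate. Moreover a crossing swaps the statuses at the same time as it reflects the cube, so that
the sign is the same in all cubes (`Frame.stateAt_copyAt`). For `q.1 = 4` this applies to all axes,
and the diagonal map is `± x₁ ± x₂ ± x₃ ± x₄`. For `q.1 ≠ 4` it applies to the axis whose ends belong
to the move of `q.1`. The other three quartets contribute a constant minus a function with real values
which does not depend on the coordinate of that axis (`sideHeight`, continuous on the whole
manifold), and such a function can be removed by shearing along the axis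
(`isIsotopic_of_eq_add`).
-/

noncomputable section

namespace GluedPolytope

/-! ### Combinatorics of the facets -/

instance : DecidableRel Adjacent := fun a b => by unfold Adjacent; infer_instance

/-- The facet obtained by changing all signs except that at the position `i`. On the cubic facet at
an ideal vertex `± e_i` that both facets meet, they cut out opposite faces. -/
def opp (i : Fin 5) (a : Facet) : Facet :=
  ⟨fun j => if j = i then a.1 j else -a.1 j, by
    have h := a.2
    rw [Fin.prod_univ_succAbove _ i] at h ⊢
    have h1 : ((-1 : ℤˣ)) ^ 4 = 1 := by decide
    simpa [Fin.succAbove_ne, Finset.prod_neg, h1] using h⟩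

/-- The facet adjacent to `a` in its quartet: it differs from `a` exactly at the fifth position and
at the position given by the move of `a`. -/
def partner (a : Facet) : Facet :=
  ⟨fun j => if (j : ℕ) = moveOf (colour a) ∨ j = 4 then -a.1 j else a.1 j, by
    revert a; decide +kernel⟩

lemma opp_apply_self (i : Fin 5) (a : Facet) : (opp i a).1 i = a.1 i := by simp [opp]

lemma opp_apply_ne {i j : Fin 5} (h : j ≠ i) (a : Facet) : (opp i a).1 j = -a.1 j := by
  simp [opp, h]

lemma opp_opp (i : Fin 5) (a : Facet) : opp i (opp i a) = a := by
  ext j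
  by_cases h : j = i <;> simp [opp, h]

lemma opp_ne_self (i : Fin 5) (a : Facet) : opp i a ≠ a := by
  obtain ⟨j, hj⟩ := exists_ne i
  intro h
  have := opp_apply_ne hj a
  rw [h] at this
  exact units_ne_neg_self _ this

lemma opp_injective (i : Fin 5) : Function.Injective (opp i) :=
  Function.LeftInverse.injective (opp_opp i)

lemma partner_apply_four (a : Facet) : (partner a).1 4 = -a.1 4 := by simp [partner]

lemma partner_apply_eq_iff {i : Fin 5} (hi : i ≠ 4) (a : Facet) :
    (partner a).1 i = a.1 i ↔ moveOf (colour a) ≠ i := by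
  by_cases h : (i : ℕ) = moveOf (colour a)
  · simp [partner, h, (units_ne_neg_self _).symm]
  · simp [partner, h, hi, Ne.symm h]

lemma move_partner : ∀ a, moveOf (colour (partner a)) = moveOf (colour a) := by decide +kernel

lemma partner_partner (a : Facet) : partner (partner a) = a := by
  refine Subtype.ext (funext fun j => ?_)
  have h1 : (partner (partner a)).1 j = if (j : ℕ) = moveOf (colour (partner a)) ∨ j = 4
    then -(partner a).1 j else (partner a).1 j := rfl
  rw [h1, move_partner]
  by_cases h : (j : ℕ) = moveOf (colour a) ∨ j = 4 <;> simp [partner, h]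

lemma adjacent_partner : ∀ a, Adjacent a (partner a) := by decide +kernel

lemma eq_partner_of_adjacent : ∀ a b, moveOf (colour a) = moveOf (colour b) → Adjacent a b →
    b = partner a := by decide +kernel

lemma colour_opp_four : ∀ a, colour (opp 4 a) = colour a := by decide +kernel

lemma move_opp : ∀ i : Fin 5, ∀ a, moveOf (colour a) = i → moveOf (colour (opp i a)) = i := by
  decide +kernel

lemma eq_or_eq_opp_of_move_eq_four : ∀ i : Fin 5, i = 4 → ∀ a b : Facet, a.1 i = b.1 i →
    moveOf (colour a) = moveOf (colour b) → b = a ∨ b = opp i a := by decide +kernel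

lemma eq_or_eq_opp_of_move_eq : ∀ (i : Fin 5) (a b : Facet), a.1 i = b.1 i →
    moveOf (colour a) = (i : ℕ) →
    moveOf (colour b) = (i : ℕ) → b = a ∨ b = opp i a := by decide +kernel

lemma eq_of_colour_eq : ∀ i : Fin 5, i ≠ 4 → ∀ a b : Facet, a.1 i = b.1 i →
    colour a = colour b → a = b := by
  decide +kernel

lemma exists_move_eq : ∀ i, i ≠ 4 → ∀ σ : ℤˣ, ∃ a : Facet,
    a.1 i = σ ∧ moveOf (colour a) = (i : ℕ) := by
  decide +kernel

lemma card_meeting : ∀ i, ∀ σ : ℤˣ, Fintype.card {a : Facet // a.1 i = σ} = 8 := by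
  decide +kernel

/-- The scalar product of the normal vectors of two facets, without the term at the position `i`. -/
def faceInner (i : Fin 5) (a b : Facet) : ℤ :=
  ∑ j, ((a.1 (i.succAbove j) : ℤˣ) : ℤ) * (b.1 (i.succAbove j) : ℤˣ)

/-- The facets that meet the cubic facet at an ideal vertex form four opposite pairs, and the normal
vectors of two of them that are neither equal nor opposite are orthogonal in the cubic facet. -/
lemma faceInner_trichotomy : ∀ i (a b : Facet), a.1 i = b.1 i →
    (b = a ∧ faceInner i a b = 4) ∨ (b = opp i a ∧ faceInner i a b = -4) ∨
    (b ≠ a ∧ b ≠ opp i a ∧ faceInner i a b = 0) := by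
  decide +kernel

lemma faceInner_of_ne : ∀ i (a b : Facet), a.1 i ≠ b.1 i →
    faceInner i a b = 2 ∨ faceInner i a b = -2 := by
  decide +kernel

/-- Two different nonadjacent facets have exactly one sign in common. -/
lemma exists_eq_opp : ∀ a b : Facet, a ≠ b → ¬ Adjacent a b → ∃ i, b = opp i a := by
  decide +kernel

lemma not_adjacent_opp : ∀ i a, ¬ Adjacent a (opp i a) := by decide +kernel

/-- The rows of a `4 × 4` Hadamard matrix, all with product `σ`. -/
def hadamard (σ : ℤˣ) : Fin 4 → Fin 4 → ℤˣ :=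
  ![![σ, 1, 1, 1], ![1, σ, -σ, -σ], ![1, -σ, σ, -σ], ![1, -σ, -σ, σ]]

lemma exists_four_facets (i : Fin 5) (σ : ℤˣ) : ∃ b : Fin 4 → Facet, (∀ k, (b k).1 i = σ) ∧
    ∀ k l, k ≠ l → b l ≠ b k ∧ b l ≠ opp i (b k) := by
  have hb : ∀ k, ∏ j, (i.insertNth σ (hadamard σ k) : Fin 5 → ℤˣ) j = 1 := by
    revert i σ; decide +kernel
  refine ⟨fun k => ⟨i.insertNth σ (hadamard σ k), hb k⟩, ?_, ?_⟩
  · simp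
  · revert i σ; decide +kernel

/-! ### Points of the glued manifold -/

/-- The real number `±1` given by the parity of an element of `ℤ/2`. -/
def paritySign (n : ZMod 2) : ℝ := if n = 0 then 1 else -1

lemma paritySign_ne_zero (n : ZMod 2) : paritySign n ≠ 0 := by
  unfold paritySign; split <;> norm_num

lemma paritySign_eq_iff {m n : ZMod 2} : paritySign m = paritySign n ↔ m = n := by
  have h2 : ∀ k : ZMod 2, k = 0 ∨ k = 1 := by decide
  rcases h2 m with rfl | rfl <;> rcases h2 n with rfl | rfl <;> norm_num [paritySign]

lemma paritySign_mul_pos_iff {m n : ZMod 2} : 0 < paritySign m * paritySign n ↔ m = n := by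
  have h2 : ∀ k : ZMod 2, k = 0 ∨ k = 1 := by decide
  rcases h2 m with rfl | rfl <;> rcases h2 n with rfl | rfl <;> norm_num [paritySign]

@[fun_prop]
lemma continuous_dot (a : Facet) : Continuous (dot a) := by
  unfold dot; fun_prop

lemma continuous_manifold_lift {ε : ℝ} {Y : Type*} [TopologicalSpace Y]
    {g : (Fin 8 → ZMod 2) → truncatedPolytope ε → Y} (hg : ∀ v, Continuous (g v))
    (h : ∀ p q, GlueRel ε p q → g p.1 p.2 = g q.1 q.2) :
    Continuous (Quot.lift (fun p : Σ _ : Fin 8 → ZMod 2, truncatedPolytope ε => g p.1 p.2) h :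
      Manifold ε → Y) :=
  continuous_quot_lift _ (continuous_sigma hg)

lemma Manifold.continuous_mk {ε : ℝ} (v : Fin 8 → ZMod 2) :
    Continuous (Manifold.mk v : truncatedPolytope ε → Manifold ε) :=
  continuous_quot_mk.comp continuous_sigmaMk

/-- The position in `ℝ⁵` of a point of the manifold. -/
def Manifold.pos {ε : ℝ} : Manifold ε → Fin 5 → ℝ :=
  Quot.lift (fun p => p.2.1) fun p q h => by rw [h.1]

lemma Manifold.continuous_pos {ε : ℝ} : Continuous (Manifold.pos : Manifold ε → Fin 5 → ℝ) :=
  continuous_manifold_lift (g := fun _ x => x.1) (fun _ => continuous_subtype_val) _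

@[simp]
lemma Manifold.pos_mk {ε : ℝ} (v : Fin 8 → ZMod 2) (x : truncatedPolytope ε) :
    (Manifold.mk v x).pos = x.1 := rfl

/-- A function on the manifold that vanishes exactly on the facets of colour `c`, and whose sign
changes from one side of them to the other. -/
def Manifold.sheet {ε : ℝ} (c : Fin 8) : Manifold ε → ℝ :=
  Quot.lift (fun p => paritySign (p.1 c) * ∏ a with colour a = c, (1 - dot a p.2.1)) fun p q h => by
    obtain ⟨h1, a, ha, h2⟩ := h
    rw [h1] at ha
    rw [h1, h2]
    by_cases hc : colour a = c
    · rw [Finset.prod_eq_zero (i := a) (by simpa using hc) (by rw [ha, sub_self]), mul_zero,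
        mul_zero]
    · simp [Ne.symm hc]

lemma Manifold.sheet_mk {ε : ℝ} (c : Fin 8) (v : Fin 8 → ZMod 2) (x : truncatedPolytope ε) :
    (Manifold.mk v x).sheet c = paritySign (v c) * ∏ a with colour a = c, (1 - dot a x.1) := rfl

lemma Manifold.continuous_sheet {ε : ℝ} (c : Fin 8) :
    Continuous (Manifold.sheet c : Manifold ε → ℝ) :=
  continuous_manifold_lift
    (g := fun v x => paritySign (v c) * ∏ a with colour a = c, (1 - dot a x.1))
    (fun _ => by fun_prop) _

lemma Manifold.mk_eq_mk_add {ε : ℝ} (v : Fin 8 → ZMod 2) (x : truncatedPolytope ε)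
    (S : Finset (Fin 8)) (hS : ∀ c ∈ S, ∃ a, dot a x.1 = 1 ∧ colour a = c) :
    Manifold.mk v x = Manifold.mk (v + ∑ c ∈ S, Pi.single c 1) x := by
  induction S using Finset.induction_on with
  | empty => simp
  | insert c S hc ih =>
    rw [ih fun d hd => hS d (Finset.mem_insert_of_mem hd), Finset.sum_insert hc]
    obtain ⟨a, ha, rfl⟩ := hS c (Finset.mem_insert_self _ _)
    exact Quot.sound ⟨rfl, a, ha, by simp only; abel⟩

lemma Manifold.exists_of_sheet_eq {ε : ℝ} {v v' : Fin 8 → ZMod 2} {x : truncatedPolytope ε}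
    {c : Fin 8} (h : (Manifold.mk v x).sheet c = (Manifold.mk v' x).sheet c) (hc : v c ≠ v' c) :
    ∃ a, dot a x.1 = 1 ∧ colour a = c := by
  by_contra! hcon
  rw [sheet_mk, sheet_mk] at h
  refine hc (paritySign_eq_iff.mp (mul_right_cancel₀ (Finset.prod_ne_zero_iff.mpr ?_) h))
  intro a ha h0
  exact hcon a (by linarith) (by simpa using ha)

/-- Two points are glued when they have the same position and every colour in which the indices of
their copies differ is the colour of a facet that contains this position. -/
lemma Manifold.mk_eq_mk_iff {ε : ℝ} {v v' : Fin 8 → ZMod 2} {x x' : truncatedPolytope ε} :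
    Manifold.mk v x = Manifold.mk v' x' ↔
      x = x' ∧ ∀ c, v c ≠ v' c → ∃ a, dot a x.1 = 1 ∧ colour a = c := by
  constructor
  · intro h
    obtain rfl : x = x' := Subtype.ext (congrArg Manifold.pos h)
    exact ⟨rfl, fun c hc => exists_of_sheet_eq (congrArg (Manifold.sheet c) h) hc⟩
  · rintro ⟨rfl, h⟩
    rw [mk_eq_mk_add v x (Finset.univ.filter fun c => v c ≠ v' c) (by simpa using h)]
    congr 1
    ext c
    have h2 : ∀ m n : ZMod 2, m + (if m ≠ n then 1 else 0) = n := by decide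
    rw [← h2 (v c) (v' c)]
    simp [Finset.sum_apply, Pi.single_apply]

/-- The position and the eight sheet functions embed the manifold into a Euclidean space. -/
instance (ε : ℝ) : T2Space (Manifold ε) := by
  refine T2Space.of_injective_continuous
    (f := fun p : Manifold ε => (p.pos, fun c => p.sheet c)) ?_
    (Manifold.continuous_pos.prodMk (continuous_pi Manifold.continuous_sheet))
  rintro ⟨v, x⟩ ⟨v', x'⟩ h
  obtain ⟨h1, h2⟩ := Prod.ext_iff.mp h
  obtain rfl : x = x' := Subtype.ext h1
  exact Manifold.mk_eq_mk_iff.mpr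
    ⟨rfl, fun c hc => Manifold.exists_of_sheet_eq (congrFun h2 c) hc⟩

lemma stateAt_add_single (s : State) (v : Fin 8 → ZMod 2) (c : Fin 8) (a : Facet) :
    stateAt s (v + Pi.single c 1) a =
      if moveOf c = moveOf (colour a) then -stateAt s v a else stateAt s v a := by
  have h0 : ∀ n : ZMod 2, (n + 1 = 0) ↔ ¬ n = 0 := by decide
  have h1 : ∑ i with moveOf i = moveOf (colour a), (v + Pi.single c 1 : Fin 8 → ZMod 2) i =
      (∑ i with moveOf i = moveOf (colour a), v i) +
        if moveOf c = moveOf (colour a) then 1 else 0 := by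
    simp [Finset.sum_add_distrib, Pi.single_apply, Finset.sum_ite_eq']
  unfold stateAt
  rw [h1]
  by_cases h : moveOf c = moveOf (colour a)
  · by_cases h2 : (∑ i with moveOf i = moveOf (colour a), v i) = 0 <;> simp [h, h2, h0]
  · simp [h]

/-- The state of every copy of the polytope is balanced. -/
lemma IsBalanced.stateAt_partner {s : State} (hs : IsBalanced s) (v : Fin 8 → ZMod 2) (a : Facet) :
    stateAt s v (partner a) = stateAt s v a := by
  have h := (hs a (partner a) (move_partner a).symm).mpr (Or.inr (adjacent_partner a))
  simp only [stateAt, move_partner, h]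

lemma IsBalanced.stateAt_opp {s : State} (hs : IsBalanced s) (v : Fin 8 → ZMod 2) {i : Fin 5}
    {a : Facet} (h : moveOf (colour (opp i a)) = moveOf (colour a)) :
    stateAt s v (opp i a) = -stateAt s v a := by
  have h1 : s (opp i a) = -s a := by
    have h2 : s a ≠ s (opp i a) := by
      rw [Ne, hs a (opp i a) h.symm]
      exact not_or_intro (opp_ne_self i a).symm (not_adjacent_opp i a)
    rcases Int.units_eq_one_or (s a) with h3 | h3 <;>
      rcases Int.units_eq_one_or (s (opp i a)) with h4 | h4 <;> simp_all
  simp only [stateAt, h, h1]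
  split <;> simp

/-! ### The geometry of the cubic facets -/

lemma coe_units_mul_self (u : ℤˣ) : ((u : ℤ) : ℝ) * ((u : ℤ) : ℝ) = 1 := by
  rcases Int.units_eq_one_or u with rfl | rfl <;> norm_num

lemma abs_coe_units (u : ℤˣ) : |((u : ℤ) : ℝ)| = 1 := by
  rcases Int.units_eq_one_or u with rfl | rfl <;> norm_num

lemma dot_eq_add_sum (i : Fin 5) (a : Facet) (x : Fin 5 → ℝ) :
    dot a x = ((a.1 i : ℤ) : ℝ) * x i +
      ∑ j, ((a.1 (i.succAbove j) : ℤ) : ℝ) * x (i.succAbove j) :=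
  Fin.sum_univ_succAbove _ i

lemma dot_add_dot_opp (i : Fin 5) (a : Facet) (x : Fin 5 → ℝ) :
    dot a x + dot (opp i a) x = 2 * (((a.1 i : ℤ) : ℝ) * x i) := by
  rw [dot_eq_add_sum i a, dot_eq_add_sum i (opp i a)]
  simp only [opp_apply_self, opp_apply_ne (Fin.succAbove_ne i _)]
  simp
  ring

/-- The affine function on `ℝ⁵` which, on the cubic facets that meet `a`, is the coordinate of the
cube in the direction of `a`, normalized to be `1/2` on `a` and `0` at the centre of the cube. -/
def cubeCoord (ε : ℝ) (a : Facet) (x : Fin 5 → ℝ) : ℝ := (dot a x - (1 - ε)) / (2 * ε)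

@[fun_prop]
lemma continuous_cubeCoord (ε : ℝ) (a : Facet) : Continuous (cubeCoord ε a) := by
  unfold cubeCoord; fun_prop

lemma cubeCoord_eq_half_iff {ε : ℝ} (hε : 0 < ε) {a : Facet} {x : Fin 5 → ℝ} :
    cubeCoord ε a x = 1 / 2 ↔ dot a x = 1 := by
  unfold cubeCoord
  rw [div_eq_iff (by positivity)]
  constructor <;> intro h <;> linarith

lemma cubeCoord_le_half_iff {ε : ℝ} (hε : 0 < ε) {a : Facet} {x : Fin 5 → ℝ} :
    cubeCoord ε a x ≤ 1 / 2 ↔ dot a x ≤ 1 := by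
  unfold cubeCoord
  rw [div_le_iff₀ (by positivity)]
  constructor <;> intro h <;> linarith

lemma dot_sum {ι : Type*} (t : Finset ι) (w : ι → ℝ) (z : ι → Fin 5 → ℝ) (a : Facet) :
    dot a (∑ c ∈ t, w c • z c) = ∑ c ∈ t, w c * dot a (z c) := by
  simp only [dot, Finset.sum_apply, Pi.smul_apply, smul_eq_mul, Finset.mul_sum]
  rw [Finset.sum_comm]
  refine Finset.sum_congr rfl fun c _ => Finset.sum_congr rfl fun j _ => ?_
  ring

lemma cubeCoord_sum {ι : Type*} {ε : ℝ} {t : Finset ι} {w : ι → ℝ} (hw : ∑ c ∈ t, w c = 1)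
    (z : ι → Fin 5 → ℝ) (a : Facet) :
    cubeCoord ε a (∑ c ∈ t, w c • z c) = ∑ c ∈ t, w c * cubeCoord ε a (z c) := by
  simp only [cubeCoord, dot_sum, mul_div_assoc', mul_sub _ _ (1 - ε)]
  rw [← Finset.sum_div, Finset.sum_sub_distrib, ← Finset.sum_mul, hw, one_mul]

/-- Nonadjacent facets are separated by the centres of the cubic facets. -/
lemma cubeCoord_add_nonpos {ε : ℝ} (hε : 0 < ε) {a b : Facet} (hab : a ≠ b) (h : ¬ Adjacent a b)
    {x : Fin 5 → ℝ} (hx : x ∈ truncatedPolytope ε) : cubeCoord ε a x + cubeCoord ε b x ≤ 0 := by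
  obtain ⟨i, rfl⟩ := exists_eq_opp a b hab h
  have h1 := dot_add_dot_opp i a x
  have h2 : ((a.1 i : ℤ) : ℝ) * x i ≤ 1 - ε :=
    (le_abs_self _).trans (by rw [abs_mul, abs_coe_units, one_mul]; exact hx.2 i)
  unfold cubeCoord
  rw [← add_div]
  exact div_nonpos_of_nonpos_of_nonneg (by linarith) (by positivity)

lemma cubeCoord_opp {ε : ℝ} (hε : 0 < ε) {i : Fin 5} {a : Facet} {x : Fin 5 → ℝ}
    (hx : ((a.1 i : ℤ) : ℝ) * x i = 1 - ε) : cubeCoord ε (opp i a) x = -cubeCoord ε a x := by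
  have h1 := dot_add_dot_opp i a x
  unfold cubeCoord
  field_simp
  linarith

/-- A coordinate system for the cubic facet at `q`: four facets that meet it in pairwise adjacent
faces, the positive ends of the coordinate axes. -/
@[ext]
structure Frame (q : IdealVertex) where
  /-- the positive ends of the axes -/
  vec : Fin 4 → Facet
  vec_apply : ∀ k, (vec k).1 q.1 = q.2
  independent : ∀ k l, k ≠ l → vec l ≠ vec k ∧ vec l ≠ opp q.1 (vec k)

namespace Frame

variable {q : IdealVertex} (b : Frame q)

lemma exists_frame (q : IdealVertex) : Nonempty (Frame q) := by
  obtain ⟨b, h1, h2⟩ := exists_four_facets q.1 q.2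
  exact ⟨⟨b, h1, h2⟩⟩

lemma opp_apply (k : Fin 4) : (opp q.1 (b.vec k)).1 q.1 = q.2 := by
  rw [opp_apply_self, b.vec_apply]

lemma faceInner_vec (k l : Fin 4) : faceInner q.1 (b.vec k) (b.vec l) = if k = l then 4 else 0 := by
  rcases faceInner_trichotomy q.1 (b.vec k) (b.vec l) (by rw [b.vec_apply, b.vec_apply]) with h | h | h
  · by_cases hkl : k = l
    · rw [if_pos hkl, h.2]
    · exact absurd h.1 (b.independent k l hkl).1
  · by_cases hkl : k = l
    · subst hkl
      exact absurd h.1.symm (opp_ne_self _ _)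
    · exact absurd h.1 (b.independent k l hkl).2
  · by_cases hkl : k = l
    · subst hkl
      exact absurd rfl h.1
    · rw [if_neg hkl, h.2.2]

lemma vec_injective : Function.Injective b.vec := by
  intro k l h
  by_contra hkl
  exact (b.independent k l hkl).1 h.symm

lemma vec_ne_opp (k l : Fin 4) : b.vec l ≠ opp q.1 (b.vec k) := by
  by_cases hkl : k = l
  · subst hkl
    exact (opp_ne_self _ _).symm
  · exact (b.independent k l hkl).2

/-- The eight facets that meet the cubic facet, as ends of the four axes. -/
lemma bijective_ends : Function.Bijective
    (fun p : Fin 4 × Bool => (if p.2 then ⟨b.vec p.1, b.vec_apply p.1⟩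
      else ⟨opp q.1 (b.vec p.1), b.opp_apply p.1⟩ : {a : Facet // a.1 q.1 = q.2})) := by
  rw [Fintype.bijective_iff_injective_and_card]
  refine ⟨?_, by rw [card_meeting]; rfl⟩
  rintro ⟨k, _ | _⟩ ⟨l, _ | _⟩ h
  · have := b.vec_injective (opp_injective _ (Subtype.ext_iff.mp h))
    simp_all
  · exact absurd (Subtype.ext_iff.mp h).symm (b.vec_ne_opp k l)
  · exact absurd (Subtype.ext_iff.mp h) (b.vec_ne_opp l k)
  · have := b.vec_injective (Subtype.ext_iff.mp h)
    simp_all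

lemma exists_eq_or_eq_opp {a : Facet} (ha : a.1 q.1 = q.2) :
    ∃ k, a = b.vec k ∨ a = opp q.1 (b.vec k) := by
  obtain ⟨⟨k, _ | _⟩, h⟩ := b.bijective_ends.2 ⟨a, ha⟩
  · exact ⟨k, Or.inr (Subtype.ext_iff.mp h).symm⟩
  · exact ⟨k, Or.inl (Subtype.ext_iff.mp h).symm⟩

lemma sum_meeting (g : Facet → ℝ) :
    ∑ a with a.1 q.1 = q.2, g a = ∑ k, (g (b.vec k) + g (opp q.1 (b.vec k))) := by
  have h1 : ∑ a with a.1 q.1 = q.2, g a = ∑ a : {a : Facet // a.1 q.1 = q.2}, g a.1 :=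
    Finset.sum_subtype _ (by simp) _
  rw [h1, ← b.bijective_ends.sum_comp, Fintype.sum_prod_type]
  simp

lemma sum_columns (m n : Fin 4) :
    ∑ k, (((b.vec k).1 (q.1.succAbove m) : ℤ) : ℝ) * (((b.vec k).1 (q.1.succAbove n) : ℤ) : ℝ) =
      if m = n then 4 else 0 := by
  set B : Matrix (Fin 4) (Fin 4) ℝ := fun k m => (((b.vec k).1 (q.1.succAbove m) : ℤ) : ℝ)
  have h1 : B * ((1 / 4 : ℝ) • B.transpose) = 1 := by
    ext k l
    have := b.faceInner_vec k l
    rw [faceInner] at this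
    have h2 : ∑ j, (((b.vec k).1 (q.1.succAbove j) : ℤ) : ℝ) *
        (((b.vec l).1 (q.1.succAbove j) : ℤ) : ℝ) = if k = l then 4 else 0 := by
      exact_mod_cast this
    change ∑ j, B k j * B l j = _ at h2
    rw [Matrix.mul_smul, Matrix.smul_apply, Matrix.mul_apply]
    simp only [Matrix.transpose_apply, h2, Matrix.one_apply]
    split <;> norm_num
  have h2 := mul_eq_one_comm.mp h1
  have h3 := congrFun (congrFun h2 m) n
  rw [Matrix.smul_mul, Matrix.smul_apply, Matrix.mul_apply, Matrix.one_apply] at h3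
  simp only [Matrix.transpose_apply, smul_eq_mul] at h3
  change ∑ k, B k m * B k n = _
  split_ifs at h3 ⊢ <;> linarith

/-- The affine parametrization of the hyperplane of the cubic facet in which the `k`-th coordinate
axis points towards the `k`-th facet of the frame; the cubic facet itself corresponds to the unit
cube. -/
def chart (ε : ℝ) (y : Fin 4 → ℝ) : Fin 5 → ℝ := fun j =>
  if j = q.1 then ((q.2 : ℤ) : ℝ) * (1 - ε) else ε / 2 * ∑ k, y k * (((b.vec k).1 j : ℤ) : ℝ)

lemma chart_apply_self (ε : ℝ) (y : Fin 4 → ℝ) :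
    b.chart ε y q.1 = ((q.2 : ℤ) : ℝ) * (1 - ε) := by simp [chart]

lemma chart_apply_ne (ε : ℝ) (y : Fin 4 → ℝ) {j : Fin 5} (hj : j ≠ q.1) :
    b.chart ε y j = ε / 2 * ∑ k, y k * (((b.vec k).1 j : ℤ) : ℝ) := by simp [chart, hj]

lemma mul_chart_apply_self (ε : ℝ) (y : Fin 4 → ℝ) :
    ((q.2 : ℤ) : ℝ) * b.chart ε y q.1 = 1 - ε := by
  rw [chart_apply_self, ← mul_assoc, coe_units_mul_self, one_mul]

lemma dot_chart (ε : ℝ) (y : Fin 4 → ℝ) (a : Facet) :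
    dot a (b.chart ε y) = ((a.1 q.1 : ℤ) : ℝ) * (((q.2 : ℤ) : ℝ) * (1 - ε)) +
      ε / 2 * ∑ k, y k * (faceInner q.1 a (b.vec k) : ℝ) := by
  rw [dot_eq_add_sum q.1, chart_apply_self]
  congr 1
  simp only [chart_apply_ne _ _ _ (Fin.succAbove_ne q.1 _), faceInner, Int.cast_sum, Int.cast_mul,
    Finset.mul_sum]
  rw [Finset.sum_comm]
  refine Finset.sum_congr rfl fun k _ => Finset.sum_congr rfl fun j _ => ?_
  ring

lemma cubeCoord_chart {ε : ℝ} (hε : 0 < ε) (y : Fin 4 → ℝ) (k : Fin 4) :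
    cubeCoord ε (b.vec k) (b.chart ε y) = y k := by
  rw [cubeCoord, dot_chart, b.vec_apply, ← mul_assoc, coe_units_mul_self]
  simp only [faceInner_vec]
  simp
  field_simp
  ring

lemma chart_cubeCoord {ε : ℝ} (hε : 0 < ε) {x : Fin 5 → ℝ}
    (hx : ((q.2 : ℤ) : ℝ) * x q.1 = 1 - ε) :
    b.chart ε (fun k => cubeCoord ε (b.vec k) x) = x := by
  ext j
  by_cases hj : j = q.1
  · subst hj
    rw [chart_apply_self, ← hx, ← mul_assoc, coe_units_mul_self, one_mul]
  · obtain ⟨m, rfl⟩ := Fin.exists_succAbove_eq hj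
    rw [chart_apply_ne _ _ _ hj]
    have h1 : ∀ k, cubeCoord ε (b.vec k) x = 1 / (2 * ε) *
        ∑ n, (((b.vec k).1 (q.1.succAbove n) : ℤ) : ℝ) * x (q.1.succAbove n) := by
      intro k
      rw [cubeCoord, dot_eq_add_sum q.1, b.vec_apply, hx]
      ring
    have h2 : ∑ k, cubeCoord ε (b.vec k) x * (((b.vec k).1 (q.1.succAbove m) : ℤ) : ℝ) =
        1 / (2 * ε) * ∑ n, x (q.1.succAbove n) *
          ∑ k, (((b.vec k).1 (q.1.succAbove n) : ℤ) : ℝ) *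
            (((b.vec k).1 (q.1.succAbove m) : ℤ) : ℝ) := by
      simp only [h1, Finset.mul_sum, Finset.sum_mul]
      rw [Finset.sum_comm]
      refine Finset.sum_congr rfl fun n _ => Finset.sum_congr rfl fun k _ => ?_
      ring
    rw [h2]
    simp only [sum_columns]
    simp
    field_simp
    ring

lemma chart_injective {ε : ℝ} (hε : 0 < ε) : Function.Injective (b.chart ε) := by
  intro y y' h
  ext k
  rw [← b.cubeCoord_chart hε y k, h, b.cubeCoord_chart hε]

lemma continuous_chart (ε : ℝ) : Continuous (b.chart ε) := by
  refine continuous_pi fun j => ?_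
  by_cases hj : j = q.1
  · subst hj
    simp only [chart_apply_self]
    fun_prop
  · simp only [chart_apply_ne _ _ _ hj]
    fun_prop

lemma sum_abs_le {y : Fin 4 → ℝ} (hy : y ∈ unitCube) (c : Fin 4 → ℝ) {M : ℝ}
    (hc : ∀ k, |c k| ≤ M) : |∑ k, y k * c k| ≤ 2 * M := by
  calc |∑ k, y k * c k| ≤ ∑ k, |y k * c k| := Finset.abs_sum_le_sum_abs _ _
    _ ≤ ∑ _k : Fin 4, 1 / 2 * M := Finset.sum_le_sum fun k _ => by
        rw [abs_mul]
        exact mul_le_mul (hy k) (hc k) (abs_nonneg _) (by norm_num)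
    _ = 2 * M := by simp; ring

lemma abs_chart_le {ε : ℝ} (hε : 0 < ε) {y : Fin 4 → ℝ} (hy : y ∈ unitCube) {j : Fin 5}
    (hj : j ≠ q.1) : |b.chart ε y j| ≤ ε := by
  rw [chart_apply_ne _ _ _ hj, abs_mul, abs_of_pos (by positivity)]
  have := sum_abs_le hy (fun k => (((b.vec k).1 j : ℤ) : ℝ)) (M := 1) fun k => (abs_coe_units _).le
  nlinarith

lemma dot_chart_le_of_ne {ε : ℝ} (hε : 0 < ε) {y : Fin 4 → ℝ} (hy : y ∈ unitCube) {a : Facet}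
    (ha : a.1 q.1 ≠ q.2) : dot a (b.chart ε y) ≤ 3 * ε - 1 := by
  have h1 : a.1 q.1 = -q.2 := Int.units_ne_iff_eq_neg.mp ha
  rw [dot_chart, h1]
  have h2 := coe_units_mul_self q.2
  have h3 := sum_abs_le hy (fun k => (faceInner q.1 a (b.vec k) : ℝ)) (M := 2) fun k => by
    rcases faceInner_of_ne q.1 a (b.vec k) (by rwa [b.vec_apply]) with h | h <;> rw [h] <;> norm_num
  have h4 := (abs_le.mp h3).2
  push_cast
  nlinarith

lemma cubeCoord_chart_le {ε : ℝ} (hε : 0 < ε) {y : Fin 4 → ℝ} (hy : y ∈ unitCube) {a : Facet}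
    (ha : a.1 q.1 = q.2) : cubeCoord ε a (b.chart ε y) ≤ 1 / 2 := by
  obtain ⟨k, rfl | rfl⟩ := b.exists_eq_or_eq_opp ha
  · rw [b.cubeCoord_chart hε]
    exact (abs_le.mp (hy k)).2
  · rw [cubeCoord_opp hε (by rw [b.vec_apply, mul_chart_apply_self]), b.cubeCoord_chart hε]
    linarith [(abs_le.mp (hy k)).1]

lemma chart_mem_cubicFacet {ε : ℝ} (hε : 0 < ε) (hε' : ε < 1 / 2) {y : Fin 4 → ℝ}
    (hy : y ∈ unitCube) : b.chart ε y ∈ cubicFacet ε q := by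
  refine ⟨⟨fun a => ?_, fun j => ?_⟩, b.mul_chart_apply_self ε y⟩
  · by_cases ha : a.1 q.1 = q.2
    · exact (cubeCoord_le_half_iff hε).mp (b.cubeCoord_chart_le hε hy ha)
    · linarith [b.dot_chart_le_of_ne hε hy ha]
  · by_cases hj : j = q.1
    · subst hj
      rw [chart_apply_self, abs_mul, abs_coe_units, one_mul, abs_of_pos (by linarith)]
    · linarith [b.abs_chart_le hε hy hj]

lemma cubeCoord_mem_unitCube {ε : ℝ} (hε : 0 < ε) {x : Fin 5 → ℝ}
    (hx : ((q.2 : ℤ) : ℝ) * x q.1 = 1 - ε) (h : ∀ a : Facet, a.1 q.1 = q.2 → cubeCoord ε a x ≤ 1 / 2) :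
    (fun k => cubeCoord ε (b.vec k) x) ∈ unitCube := by
  intro k
  have h1 := h _ (b.vec_apply k)
  have h2 := h _ (b.opp_apply k)
  rw [cubeCoord_opp hε (by rw [b.vec_apply, hx])] at h2
  exact abs_le.mpr ⟨by linarith, h1⟩

lemma exists_chart_eq {ε : ℝ} (hε : 0 < ε) {x : Fin 5 → ℝ} (hx : x ∈ cubicFacet ε q) :
    ∃ y ∈ unitCube, b.chart ε y = x :=
  ⟨_, b.cubeCoord_mem_unitCube hε hx.2 fun a _ => (cubeCoord_le_half_iff hε).mpr (hx.1.1 a),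
    b.chart_cubeCoord hε hx.2⟩

lemma chart_image_unitCube {ε : ℝ} (hε : 0 < ε) (hε' : ε < 1 / 2) :
    b.chart ε '' unitCube = cubicFacet ε q := by
  ext x
  constructor
  · rintro ⟨y, hy, rfl⟩
    exact b.chart_mem_cubicFacet hε hε' hy
  · exact b.exists_chart_eq hε

end Frame

section CubicFacet

variable {ε : ℝ} {q : IdealVertex} {x : Fin 5 → ℝ}

lemma mem_cubicFacet_iff (hε : 0 < ε) (hε' : ε < 1 / 2) : x ∈ cubicFacet ε q ↔
    ((q.2 : ℤ) : ℝ) * x q.1 = 1 - ε ∧ ∀ a : Facet, a.1 q.1 = q.2 → cubeCoord ε a x ≤ 1 / 2 := by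
  refine ⟨fun h => ⟨h.2, fun a _ => (cubeCoord_le_half_iff hε).mpr (h.1.1 a)⟩, fun h => ?_⟩
  obtain ⟨b⟩ := Frame.exists_frame q
  rw [← b.chart_cubeCoord hε h.1]
  exact b.chart_mem_cubicFacet hε hε' (b.cubeCoord_mem_unitCube hε h.1 h.2)

lemma dot_le_of_mem_cubicFacet (hε : 0 < ε) (hx : x ∈ cubicFacet ε q) {a : Facet}
    (ha : a.1 q.1 ≠ q.2) : dot a x ≤ 3 * ε - 1 := by
  obtain ⟨b⟩ := Frame.exists_frame q
  obtain ⟨y, hy, rfl⟩ := b.exists_chart_eq hε hx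
  exact b.dot_chart_le_of_ne hε hy ha

lemma abs_le_of_mem_cubicFacet (hε : 0 < ε) (hx : x ∈ cubicFacet ε q) {j : Fin 5}
    (hj : j ≠ q.1) : |x j| ≤ ε := by
  obtain ⟨b⟩ := Frame.exists_frame q
  obtain ⟨y, hy, rfl⟩ := b.exists_chart_eq hε hx
  exact b.abs_chart_le hε hy hj

lemma apply_eq_of_dot_eq_one (hε : 0 < ε) (hε' : ε < 1 / 2) (hx : x ∈ cubicFacet ε q) {a : Facet}
    (ha : dot a x = 1) : a.1 q.1 = q.2 := by
  by_contra h
  linarith [dot_le_of_mem_cubicFacet hε hx h]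

lemma cubeCoord_neg (hε : 0 < ε) (hε' : ε < 1 / 2) (hx : x ∈ cubicFacet ε q) {a : Facet}
    (ha : a.1 q.1 ≠ q.2) : cubeCoord ε a x < 0 :=
  div_neg_of_neg_of_pos (by linarith [dot_le_of_mem_cubicFacet hε hx ha]) (by positivity)

lemma eq_of_cubeCoord_eq (hε : 0 < ε) {x' : Fin 5 → ℝ} (hx : ((q.2 : ℤ) : ℝ) * x q.1 = 1 - ε)
    (hx' : ((q.2 : ℤ) : ℝ) * x' q.1 = 1 - ε)
    (h : ∀ a : Facet, a.1 q.1 = q.2 → cubeCoord ε a x = cubeCoord ε a x') : x = x' := by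
  obtain ⟨b⟩ := Frame.exists_frame q
  rw [← b.chart_cubeCoord hε hx, ← b.chart_cubeCoord hε hx']
  congr 1
  ext k
  exact h _ (b.vec_apply k)

end CubicFacet

/-! ### The heights of the barycentres -/

/-- The larger of the coordinates in the directions of two adjacent facets of the same quartet, or
`0` if both are negative. -/
def pairCoord (ε : ℝ) (a : Facet) (x : Fin 5 → ℝ) : ℝ :=
  max 0 (max (cubeCoord ε a x) (cubeCoord ε (partner a) x))

lemma pairCoord_partner (ε : ℝ) (a : Facet) (x : Fin 5 → ℝ) :
    pairCoord ε (partner a) x = pairCoord ε a x := by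
  rw [pairCoord, pairCoord, partner_partner, max_comm (cubeCoord ε (partner a) x)]

/-- The height function of the copy `v` on the cubic facets, relative to their centres. The sum is
over the eight pairs of adjacent facets in a quartet, each represented by its facet with fifth sign
`+`. -/
def diagonalHeight (ε : ℝ) (s : State) (v : Fin 8 → ZMod 2) (x : Fin 5 → ℝ) : ℝ :=
  ∑ a with a.1 4 = 1, ((stateAt s v a : ℤ) : ℝ) * pairCoord ε a x

lemma partner_apply_four_eq_one_iff (a : Facet) : (partner a).1 4 = 1 ↔ ¬ a.1 4 = 1 := by
  rw [partner_apply_four]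
  rcases Int.units_eq_one_or (a.1 4) with h | h <;> rw [h] <;> decide

/-- Crossing successively facets that all contain a common point. Two crossings of facets of the
same quartet cancel each other, because the first one swaps the statuses of the quartet. -/
lemma pathHeight_eq {s : State} (hs : IsBalanced s) (v : Fin 8 → ZMod 2) (l : List Facet)
    (hl : ∀ a ∈ l, ∀ b ∈ l, moveOf (colour a) = moveOf (colour b) → b = a ∨ b = partner a) :
    pathHeight s v l = ∑ a with a.1 4 = 1,
      if Odd (l.countP fun b => b = a ∨ b = partner a) then ((stateAt s v a : ℤˣ) : ℤ) else 0 := by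
  induction l generalizing v with
  | nil => simp [pathHeight]
  | cons h l ih =>
    have h1 : ∑ a with a.1 4 = 1,
        (if a = h ∨ a = partner h then ((stateAt s v h : ℤˣ) : ℤ) else 0) = stateAt s v h := by
      rw [← Finset.sum_filter, Finset.filter_filter]
      by_cases h4 : h.1 4 = 1
      · rw [Finset.sum_eq_single_of_mem h (by simp [h4])]
        intro b hb hbh
        simp only [Finset.mem_filter, Finset.mem_univ, true_and] at hb
        rcases hb.2 with rfl | rfl
        · exact absurd rfl hbh
        · exact absurd h4 ((partner_apply_four_eq_one_iff h).mp hb.1)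
      · rw [Finset.sum_eq_single_of_mem (partner h)
          (by simp [partner_apply_four_eq_one_iff, h4])]
        intro b hb hbh
        simp only [Finset.mem_filter, Finset.mem_univ, true_and] at hb
        rcases hb.2 with rfl | rfl
        · exact absurd hb.1 h4
        · exact absurd rfl hbh
    rw [pathHeight, ih _ fun a ha b hb =>
      hl a (List.mem_cons_of_mem _ ha) b (List.mem_cons_of_mem _ hb), ← h1,
      ← Finset.sum_add_distrib]
    refine Finset.sum_congr rfl fun a _ => ?_
    rw [List.countP_cons, stateAt_add_single]
    have h2 : (h = a ∨ h = partner a) ↔ (a = h ∨ a = partner h) := by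
      constructor
      · rintro (rfl | rfl)
        · exact Or.inl rfl
        · exact Or.inr (partner_partner a).symm
      · rintro (rfl | rfl)
        · exact Or.inl rfl
        · exact Or.inr (partner_partner h).symm
    generalize hn : (l.countP fun b => b = a ∨ b = partner a) = n
    by_cases hm : moveOf (colour h) = moveOf (colour a)
    · by_cases ha : a = h ∨ a = partner h
      · have h3 : stateAt s v h = stateAt s v a := by
          rcases ha with rfl | rfl
          · rfl
          · rw [hs.stateAt_partner]
        by_cases ho : Odd n
        · have h4 : ¬ Odd (n + 1) := by rwa [Nat.odd_add_one, not_not]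
          simp only [hm, ha, h2, h3, h4, ho, decide_true, if_true, if_false]
          simp
        · have h4 : Odd (n + 1) := by rwa [Nat.odd_add_one]
          simp only [hm, ha, h2, h3, h4, ho, decide_true, if_true, if_false]
          simp
      · have h3 : n = 0 := by
          rw [← hn, List.countP_eq_zero]
          intro b hb hba
          have hba' : b = a ∨ b = partner a := by simpa using hba
          apply ha
          have h4 : moveOf (colour h) = moveOf (colour b) := by
            rcases hba' with rfl | rfl
            · exact hm
            · rw [move_partner, hm]
          have h5 := hl h List.mem_cons_self b (List.mem_cons_of_mem _ hb) h4
          rcases hba' with rfl | rfl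
          · exact h5
          · rcases h5 with h5 | h5
            · exact Or.inr (by rw [← h5, partner_partner])
            · exact Or.inl (by rw [← partner_partner a, h5, partner_partner])
        simp [ha, h2, h3]
    · have ha : ¬ (a = h ∨ a = partner h) := by
        rintro (rfl | rfl)
        · exact hm rfl
        · exact hm (move_partner h).symm
      simp [hm, ha, h2]

/-- Half of the subsets of a finite set contain an odd number of elements of a given nonempty
subset. -/
lemma sum_powerset_odd {α : Type*} [DecidableEq α] (F : Finset α) (P : α → Prop) [DecidablePred P] :
    ∑ T ∈ F.powerset, (if Odd (T.toList.countP fun b => P b) then (1 : ℝ) else 0) =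
      if ∃ b ∈ F, P b then 2 ^ F.card / 2 else 0 := by
  have h0 : ∀ T : Finset α, (T.toList.countP fun b => P b) = (T.filter P).card := by
    intro T
    rw [Finset.card_def, Finset.filter_val, ← Multiset.countP_eq_card_filter,
      ← Finset.coe_toList T, Multiset.coe_countP]
  simp only [h0]
  split_ifs with h
  · obtain ⟨b, hb, hP⟩ := h
    rw [← Finset.insert_erase hb, Finset.sum_powerset_insert (Finset.notMem_erase b F),
      ← Finset.sum_add_distrib, Finset.card_insert_of_notMem (Finset.notMem_erase b F)]
    rw [Finset.sum_congr rfl (g := fun _ => (1 : ℝ))]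
    · simp [Finset.card_powerset, pow_succ]
    · intro T hT
      have hbT : b ∉ T := fun hbT => Finset.notMem_erase b F (Finset.mem_powerset.mp hT hbT)
      rw [Finset.filter_insert, if_pos hP, Finset.card_insert_of_notMem (by simp [hbT])]
      by_cases ho : Odd (T.filter P).card <;> simp [ho, Nat.odd_add_one]
  · push Not at h
    refine Finset.sum_eq_zero fun T hT => ?_
    rw [Finset.filter_eq_empty_iff.mpr fun b hb => h b (Finset.mem_powerset.mp hT hb)]
    simp

lemma Cell.height_eq {s : State} (hs : IsBalanced s) (v : Fin 8 → ZMod 2) {c : Cell}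
    (hc : ∀ a ∈ c.facets, ∀ b ∈ c.facets, a = b ∨ Adjacent a b) :
    c.height s v = (∑ a with a.1 4 = 1, ((stateAt s v a : ℤ) : ℝ) *
        if a ∈ c.facets ∨ partner a ∈ c.facets then 1 / 2 else 0) +
      if c.cusp.isSome then 1 else 0 := by
  rw [Cell.height]
  congr 1
  have h1 : ∀ T ∈ c.facets.powerset, (pathHeight s v T.toList : ℝ) =
      ∑ a with a.1 4 = 1, ((stateAt s v a : ℤ) : ℝ) *
        if Odd (T.toList.countP fun b => b = a ∨ b = partner a) then 1 else 0 := by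
    intro T hT
    rw [pathHeight_eq hs]
    · push_cast
      refine Finset.sum_congr rfl fun a _ => ?_
      split <;> simp
    · intro a ha b hb hab
      rw [Finset.mem_toList] at ha hb
      rcases hc a (Finset.mem_powerset.mp hT ha) b (Finset.mem_powerset.mp hT hb) with h | h
      · exact Or.inl h.symm
      · exact Or.inr (eq_partner_of_adjacent a b hab h)
  rw [Finset.sum_congr rfl h1, Finset.sum_comm, Finset.sum_div]
  refine Finset.sum_congr rfl fun a _ => ?_
  rw [← Finset.mul_sum, sum_powerset_odd, mul_div_assoc]
  congr 1
  have h2 : (∃ b ∈ c.facets, b = a ∨ b = partner a) ↔ (a ∈ c.facets ∨ partner a ∈ c.facets) := by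
    constructor
    · rintro ⟨b, hb, rfl | rfl⟩
      · exact Or.inl hb
      · exact Or.inr hb
    · rintro (h | h)
      · exact ⟨_, h, Or.inl rfl⟩
      · exact ⟨_, h, Or.inr rfl⟩
  simp only [h2]
  split
  · have : (2 : ℝ) ^ c.facets.card ≠ 0 := by positivity
    field_simp
  · simp

/-! ### The faces of the truncated polytope at an ideal vertex -/

section Faces

variable {ε : ℝ} {q : IdealVertex}

lemma eq_or_adjacent_of_dot_eq_one (hε : 0 < ε) {x : Fin 5 → ℝ} (hx : x ∈ truncatedPolytope ε)
    {a b : Facet} (ha : dot a x = 1) (hb : dot b x = 1) : a = b ∨ Adjacent a b := by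
  by_contra! h
  have h1 := cubeCoord_add_nonpos hε h.1 h.2 hx
  rw [(cubeCoord_eq_half_iff hε).mpr ha, (cubeCoord_eq_half_iff hε).mpr hb] at h1
  norm_num at h1

lemma Cell.eq_or_adjacent (hε : 0 < ε) {c : Cell} (hc : (c.face ε).Nonempty) :
    ∀ a ∈ c.facets, ∀ b ∈ c.facets, a = b ∨ Adjacent a b := by
  obtain ⟨x, hx⟩ := hc
  exact fun a ha b hb => eq_or_adjacent_of_dot_eq_one hε hx.1 (hx.2.1 a ha) (hx.2.1 b hb)

lemma Cell.opp_notMem (hε : 0 < ε) {c : Cell} (hc : (c.face ε).Nonempty) {a : Facet}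
    (ha : a ∈ c.facets) (i : Fin 5) : opp i a ∉ c.facets := by
  intro h
  rcases Cell.eq_or_adjacent hε hc a ha _ h with h1 | h1
  · exact opp_ne_self i a h1.symm
  · exact not_adjacent_opp i a h1

lemma Cell.apply_eq (hε : 0 < ε) (hε' : ε < 1 / 2) {c : Cell} (hc : (c.face ε).Nonempty)
    (hq : c.cusp = some q) {a : Facet} (ha : a ∈ c.facets) : a.1 q.1 = q.2 := by
  obtain ⟨x, hx⟩ := hc
  exact apply_eq_of_dot_eq_one hε hε' (hx.2.2 q hq) (hx.2.1 a ha)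

lemma Cell.mul_barycentre_apply {c : Cell} (hq : c.cusp = some q) :
    ((q.2 : ℤ) : ℝ) * c.barycentre ε q.1 = 1 - ε := by
  simp [Cell.barycentre, hq, ← mul_assoc, coe_units_mul_self]

lemma Cell.cubeCoord_barycentre (hε : 0 < ε) {c : Cell} (hq : c.cusp = some q)
    (hF : ∀ a ∈ c.facets, a.1 q.1 = q.2) {a : Facet} (ha : a.1 q.1 = q.2) :
    cubeCoord ε a (c.barycentre ε) =
      ((if a ∈ c.facets then 1 else 0) - (if opp q.1 a ∈ c.facets then 1 else 0)) / 2 := by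
  have h1 : ∀ b ∈ c.facets, (faceInner q.1 a b : ℝ) =
      (if b = a then 4 else 0) - (if b = opp q.1 a then 4 else 0) := by
    intro b hb
    rcases faceInner_trichotomy q.1 a b (by rw [ha, hF b hb]) with h | h | h
    · rw [h.2, if_pos h.1, h.1, if_neg (opp_ne_self _ _).symm]; norm_num
    · rw [h.2, if_pos h.1, h.1, if_neg (opp_ne_self _ _)]; norm_num
    · rw [h.2.2, if_neg h.1, if_neg h.2.1]; norm_num
  have h2 : ∑ j, ((a.1 (q.1.succAbove j) : ℤ) : ℝ) * c.barycentre ε (q.1.succAbove j) =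
      ε / 4 * ∑ b ∈ c.facets, (faceInner q.1 a b : ℝ) := by
    simp only [Cell.barycentre, hq, Fin.succAbove_ne, if_false, faceInner, Int.cast_sum, Int.cast_mul,
      Finset.mul_sum]
    rw [Finset.sum_comm]
    refine Finset.sum_congr rfl fun k _ => Finset.sum_congr rfl fun j _ => ?_
    ring
  rw [cubeCoord, dot_eq_add_sum q.1, ha, Cell.mul_barycentre_apply hq, h2,
    Finset.sum_congr rfl h1, Finset.sum_sub_distrib, Finset.sum_ite_eq', Finset.sum_ite_eq']
  field_simp
  split_ifs <;> ring

lemma Cell.barycentre_mem_cubicFacet (hε : 0 < ε) (hε' : ε < 1 / 2) {c : Cell}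
    (hq : c.cusp = some q) (hF : ∀ a ∈ c.facets, a.1 q.1 = q.2) :
    c.barycentre ε ∈ cubicFacet ε q := by
  refine (mem_cubicFacet_iff hε hε').mpr ⟨Cell.mul_barycentre_apply hq, fun a ha => ?_⟩
  rw [Cell.cubeCoord_barycentre hε hq hF ha]
  split_ifs <;> norm_num

lemma Cell.barycentre_mem_face (hε : 0 < ε) (hε' : ε < 1 / 2) {c : Cell} (hq : c.cusp = some q)
    (hF : ∀ a ∈ c.facets, a.1 q.1 = q.2) (hF' : ∀ a ∈ c.facets, opp q.1 a ∉ c.facets) :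
    c.barycentre ε ∈ c.face ε := by
  have h := Cell.barycentre_mem_cubicFacet hε hε' hq hF
  refine ⟨h.1, fun a ha => ?_, fun q' hq' => ?_⟩
  · rw [← cubeCoord_eq_half_iff hε, Cell.cubeCoord_barycentre hε hq hF (hF a ha), if_pos ha,
      if_neg (hF' a ha)]
    norm_num
  · obtain rfl : q = q' := Option.some_injective _ (hq.symm.trans hq')
    exact h

lemma Cell.facets_subset (hε : 0 < ε) (hε' : ε < 1 / 2) {c d : Cell} (hc : (c.face ε).Nonempty)
    (hq : c.cusp = some q) (h : c.face ε ⊆ d.face ε) : d.facets ⊆ c.facets := by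
  have hF : ∀ a ∈ c.facets, a.1 q.1 = q.2 := fun a ha => Cell.apply_eq hε hε' hc hq ha
  intro a ha
  have h1 := (h (Cell.barycentre_mem_face hε hε' hq hF
    fun a ha => Cell.opp_notMem hε hc ha q.1)).2.1 a ha
  have h2 := Cell.barycentre_mem_cubicFacet hε hε' hq hF
  have h3 := (cubeCoord_eq_half_iff hε).mpr h1
  rw [Cell.cubeCoord_barycentre hε hq hF (apply_eq_of_dot_eq_one hε hε' h2 h1)] at h3
  by_contra h4
  rw [if_neg h4] at h3
  split_ifs at h3 <;> norm_num at h3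

/-- Among the barycentres, only those of the faces of a cubic facet lie in this cubic facet. -/
lemma Cell.mul_barycentre_lt (hε : 0 < ε) (hε' : ε < 1 / 2) {c : Cell} (hc : (c.face ε).Nonempty)
    (hq : c.cusp ≠ some q) : ((q.2 : ℤ) : ℝ) * c.barycentre ε q.1 < 1 - ε := by
  rcases hcusp : c.cusp with _ | q'
  · set N := c.facets.filter fun a => a.1 q.1 = q.2
    -- at most one facet of each of the four opposite pairs that meet the cubic facet belongs to `c`
    have h4 : N.card ≤ 4 := by
      have h1 : Disjoint N (N.image (opp q.1)) := by
        rw [Finset.disjoint_left]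
        intro a ha ha'
        obtain ⟨b, hb, rfl⟩ := Finset.mem_image.mp ha'
        exact Cell.opp_notMem hε hc (Finset.mem_filter.mp hb).1 q.1 (Finset.mem_filter.mp ha).1
      have h2 : N ∪ N.image (opp q.1) ⊆ Finset.univ.filter fun a => a.1 q.1 = q.2 := by
        intro a ha
        rcases Finset.mem_union.mp ha with ha | ha
        · exact Finset.mem_filter.mpr ⟨Finset.mem_univ _, (Finset.mem_filter.mp ha).2⟩
        · obtain ⟨b, hb, rfl⟩ := Finset.mem_image.mp ha
          simpa [opp_apply_self] using (Finset.mem_filter.mp hb).2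
      have h3 := Finset.card_le_card h2
      rw [Finset.card_union_of_disjoint h1, Finset.card_image_of_injective _ (opp_injective _),
        ← Fintype.card_subtype, card_meeting] at h3
      omega
    have hN : N.card ≤ c.facets.card := Finset.card_filter_le _ _
    have h5 : ∑ a ∈ c.facets, ((q.2 : ℤ) : ℝ) * ((a.1 q.1 : ℤ) : ℝ) ≤ N.card := by
      rw [Finset.card_filter, Nat.cast_sum]
      refine Finset.sum_le_sum fun a _ => ?_
      by_cases h : a.1 q.1 = q.2
      · simp [h, coe_units_mul_self]
      · rw [Int.units_ne_iff_eq_neg.mp h]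
        have := coe_units_mul_self q.2
        have h0 : -q.2 ≠ q.2 := (units_ne_neg_self _).symm
        rw [if_neg h0]
        push_cast
        linarith
    have h6 : (N.card : ℝ) ≤ 4 := by exact_mod_cast h4
    have h7 : (N.card : ℝ) ≤ c.facets.card := by exact_mod_cast hN
    simp only [Cell.barycentre, hcusp]
    rw [← mul_div_assoc, Finset.mul_sum, div_lt_iff₀ (by positivity)]
    nlinarith
  · have h1 := Cell.barycentre_mem_cubicFacet hε hε' hcusp
      fun a ha => Cell.apply_eq hε hε' hc hcusp ha
    by_cases hi : q.1 = q'.1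
    · have h2 : q.2 ≠ q'.2 := fun h => hq (by rw [hcusp, Prod.ext hi h])
      have h3 := h1.2
      rw [Int.units_ne_iff_eq_neg.mp h2, hi]
      push_cast
      linarith
    · have h2 := abs_le_of_mem_cubicFacet hε h1 hi
      calc ((q.2 : ℤ) : ℝ) * c.barycentre ε q.1 ≤ |((q.2 : ℤ) : ℝ) * c.barycentre ε q.1| :=
            le_abs_self _
        _ ≤ ε := by rwa [abs_mul, abs_coe_units, one_mul]
        _ < 1 - ε := by linarith

end Faces

/-! ### The diagonal map on the boundary -/

section Flags

/-- In a flag of sets with weights, the weights of the sets that meet `{a, b}` add up to the larger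
of the weights at `a` and at `b`, since one of the two conditions implies the other. -/
lemma sum_or_eq_max {ι α : Type*} [DecidableEq α] (t : Finset ι) (F : ι → Finset α) (w : ι → ℝ)
    (hF : ∀ c ∈ t, ∀ d ∈ t, F c ⊆ F d ∨ F d ⊆ F c) (hw : ∀ c ∈ t, 0 ≤ w c) (a b : α) :
    ∑ c ∈ t, (if a ∈ F c ∨ b ∈ F c then w c else 0) =
      max (∑ c ∈ t, if a ∈ F c then w c else 0) (∑ c ∈ t, if b ∈ F c then w c else 0) := by
  have key : ∀ a b : α, (∀ c ∈ t, a ∈ F c → b ∈ F c) →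
      ∑ c ∈ t, (if a ∈ F c ∨ b ∈ F c then w c else 0) = ∑ c ∈ t, (if b ∈ F c then w c else 0) ∧
      ∑ c ∈ t, (if a ∈ F c then w c else 0) ≤ ∑ c ∈ t, (if b ∈ F c then w c else 0) := by
    intro a b h
    refine ⟨Finset.sum_congr rfl fun c hc => ?_, Finset.sum_le_sum fun c hc => ?_⟩
    · have := h c hc
      simp only [or_iff_right_of_imp this]
    · have h1 := h c hc
      have h2 := hw c hc
      by_cases ha : a ∈ F c
      · simp [ha, h1 ha]
      · rw [if_neg ha]
        split <;> simp [h2]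
  by_cases h : ∀ c ∈ t, a ∈ F c → b ∈ F c
  · obtain ⟨h1, h2⟩ := key a b h
    rw [h1, max_eq_right h2]
  · push Not at h
    obtain ⟨c, hc, hca, hcb⟩ := h
    obtain ⟨h1, h2⟩ := key b a fun d hd hb => by
      rcases hF c hc d hd with h | h
      · exact h hca
      · exact absurd (h hb) hcb
    simp only [or_comm (a := b ∈ _)] at h1
    rw [h1, max_eq_left h2]

/-- Every bounded nonnegative function is a combination of indicator functions of a flag of
subsets, with nonnegative weights of prescribed sum: subtract successively its smallest positive
value from it on its support. -/
lemma exists_flag {α : Type*} [Fintype α] [DecidableEq α] (W : α → ℝ) (hW : ∀ a, 0 ≤ W a) (M : ℝ)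
    (hM : 0 ≤ M) (hWM : ∀ a, W a ≤ M) :
    ∃ (t : Finset (Finset α)) (w : Finset α → ℝ), (∀ F ∈ t, ∀ a ∈ F, 0 < W a) ∧
      (∀ F ∈ t, ∀ G ∈ t, F ⊆ G ∨ G ⊆ F) ∧ (∀ F ∈ t, 0 ≤ w F) ∧ ∑ F ∈ t, w F = M ∧
      ∀ a, ∑ F ∈ t, (if a ∈ F then w F else 0) = W a := by
  classical
  induction hn : (Finset.univ.filter fun a => 0 < W a).card using Nat.strong_induction_on
    generalizing W M with
  | _ n ih =>
  set S := Finset.univ.filter fun a => 0 < W a with hS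
  rcases S.eq_empty_or_nonempty with hS0 | hS0
  · have hW0 : ∀ a, W a = 0 := fun a => by
      refine le_antisymm (not_lt.mp fun h => ?_) (hW a)
      exact Finset.notMem_empty a (hS0 ▸ (by simp [hS, h]))
    exact ⟨{∅}, fun _ => M, by simp, by simp, by simpa using hM, by simp, by simp [hW0]⟩
  · obtain ⟨a₀, ha₀, hmin⟩ := S.exists_min_image W hS0
    have hm : 0 < W a₀ := (Finset.mem_filter.mp ha₀).2
    have hmS : ∀ a, a ∈ S ↔ 0 < W a := by simp [hS]
    have hW' : ∀ a, W a = (if a ∈ S then W a₀ else 0) + (W a - if a ∈ S then W a₀ else 0) :=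
      fun a => by ring
    set W' : α → ℝ := fun a => W a - if a ∈ S then W a₀ else 0 with hW'def
    have hW'0 : W' a₀ = 0 := by simp [hW'def, ha₀]
    have hW'nn : ∀ a, 0 ≤ W' a := by
      intro a
      by_cases ha : a ∈ S
      · simp only [hW'def, if_pos ha]; linarith [hmin a ha]
      · simp only [hW'def, if_neg ha]; linarith [hW a]
    have hW'le : ∀ a, W' a ≤ M - W a₀ := by
      intro a
      by_cases ha : a ∈ S
      · simp only [hW'def, if_pos ha]; linarith [hWM a]
      · have : W a ≤ 0 := not_lt.mp fun h => ha ((hmS a).mpr h)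
        simp only [hW'def, if_neg ha]; linarith [hWM a₀]
    have hsub : ∀ a, 0 < W' a → a ∈ S := by
      intro a ha
      by_contra h
      have h1 : W a ≤ 0 := not_lt.mp fun h' => h ((hmS a).mpr h')
      simp only [hW'def, if_neg h] at ha
      linarith
    have hcard : (Finset.univ.filter fun a => 0 < W' a).card < n := by
      rw [← hn]
      refine Finset.card_lt_card ⟨fun a ha => hsub a (by simpa using ha), fun h => ?_⟩
      have := h ha₀
      simp [hW'0] at this
    obtain ⟨t, w, h1, h2, h3, h4, h5⟩ := ih _ hcard W' hW'nn (M - W a₀)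
      (by linarith [hWM a₀]) hW'le rfl
    have hSt : S ∉ t := fun h => by
      have := h1 S h a₀ ha₀
      rw [hW'0] at this
      exact lt_irrefl _ this
    have hne : ∀ F ∈ t, F ≠ S := fun F hF h => hSt (h ▸ hF)
    have hFS : ∀ F ∈ t, F ⊆ S := fun F hF a ha => hsub a (h1 F hF a ha)
    refine ⟨insert S t, Function.update w S (W a₀), ?_, ?_, ?_, ?_, ?_⟩
    · intro F hF a ha
      rcases Finset.mem_insert.mp hF with rfl | hF
      · exact (hmS a).mp ha
      · exact (hmS a).mp (hFS F hF ha)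
    · intro F hF G hG
      rcases Finset.mem_insert.mp hF with rfl | hF <;> rcases Finset.mem_insert.mp hG with rfl | hG
      · exact Or.inl subset_rfl
      · exact Or.inr (hFS G hG)
      · exact Or.inl (hFS F hF)
      · exact h2 F hF G hG
    · intro F hF
      rcases Finset.mem_insert.mp hF with rfl | hF
      · simp [hm.le]
      · rw [Function.update_of_ne (hne F hF)]
        exact h3 F hF
    · rw [Finset.sum_insert hSt, Function.update_self, Finset.sum_congr rfl fun F hF =>
        Function.update_of_ne (hne F hF) _ _, h4]
      ring
    · intro a
      rw [Finset.sum_insert hSt, Function.update_self, Finset.sum_congr rfl fun F hF => by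
        rw [Function.update_of_ne (hne F hF)], h5, ← hW' a]

end Flags

section DiagonalMap

variable {ε : ℝ} {q : IdealVertex} {s : State} {v : Fin 8 → ZMod 2} {x : Fin 5 → ℝ}

/-- The barycentric coordinates of a point of a cubic facet determine its coordinates in the cube:
the weights of the faces contained in `a` add up to twice the coordinate in the direction of `a`. -/
lemma sum_weights_eq (hε : 0 < ε) (hε' : ε < 1 / 2) {t : Finset Cell} {w : Cell → ℝ}
    (hx : x ∈ cubicFacet ε q) (hface : ∀ c ∈ t, (c.face ε).Nonempty)
    (hq : ∀ c ∈ t, c.cusp = some q)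
    (hflag : ∀ c ∈ t, ∀ d ∈ t, c.facets ⊆ d.facets ∨ d.facets ⊆ c.facets)
    (hw : ∀ c ∈ t, 0 ≤ w c) (hsum : ∑ c ∈ t, w c = 1)
    (hxw : x = ∑ c ∈ t, w c • c.barycentre ε) (a : Facet) :
    ∑ c ∈ t, (if a ∈ c.facets then w c else 0) = max 0 (2 * cubeCoord ε a x) := by
  have hF : ∀ c ∈ t, ∀ a ∈ c.facets, a.1 q.1 = q.2 := fun c hc a ha =>
    Cell.apply_eq hε hε' (hface c hc) (hq c hc) ha
  by_cases ha : a.1 q.1 = q.2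
  · have h1 : cubeCoord ε a x = ∑ c ∈ t, w c * cubeCoord ε a (c.barycentre ε) := by
      rw [hxw, cubeCoord_sum hsum]
    have h3 : 2 * cubeCoord ε a x = ∑ c ∈ t, (if a ∈ c.facets then w c else 0) -
        ∑ c ∈ t, (if opp q.1 a ∈ c.facets then w c else 0) := by
      rw [h1, Finset.mul_sum, ← Finset.sum_sub_distrib]
      refine Finset.sum_congr rfl fun c hc => ?_
      rw [Cell.cubeCoord_barycentre hε (hq c hc) (hF c hc) ha]
      split_ifs <;> ring
    by_cases hex : ∃ c ∈ t, a ∈ c.facets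
    · obtain ⟨c, hc, hac⟩ := hex
      have h4 : ∑ c ∈ t, (if opp q.1 a ∈ c.facets then w c else 0) = 0 := by
        refine Finset.sum_eq_zero fun d hd => if_neg fun had => ?_
        rcases hflag c hc d hd with h | h
        · exact Cell.opp_notMem hε (hface d hd) (h hac) q.1 had
        · exact Cell.opp_notMem hε (hface c hc) hac q.1 (h had)
      rw [h4, sub_zero] at h3
      rw [h3, max_eq_right]
      exact Finset.sum_nonneg fun c hc => by split <;> simp [hw c hc]
    · push Not at hex
      have h4 : ∑ c ∈ t, (if a ∈ c.facets then w c else 0) = 0 :=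
        Finset.sum_eq_zero fun c hc => if_neg (hex c hc)
      have h5 : 0 ≤ ∑ c ∈ t, (if opp q.1 a ∈ c.facets then w c else 0) :=
        Finset.sum_nonneg fun c hc => by split <;> simp [hw c hc]
      rw [h4, max_eq_left (by linarith)]
  · have h1 := cubeCoord_neg hε hε' hx ha
    rw [max_eq_left (by linarith)]
    exact Finset.sum_eq_zero fun c hc => if_neg fun h => ha (hF c hc a h)

lemma sum_weights_height_of_cusp (hε : 0 < ε) (hε' : ε < 1 / 2) (hs : IsBalanced s)
    {t : Finset Cell} {w : Cell → ℝ}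
    (hx : x ∈ cubicFacet ε q) (hface : ∀ c ∈ t, (c.face ε).Nonempty)
    (hq : ∀ c ∈ t, c.cusp = some q)
    (hflag : ∀ c ∈ t, ∀ d ∈ t, c.facets ⊆ d.facets ∨ d.facets ⊆ c.facets)
    (hw : ∀ c ∈ t, 0 ≤ w c) (hsum : ∑ c ∈ t, w c = 1)
    (hxw : x = ∑ c ∈ t, w c • c.barycentre ε) :
    ∑ c ∈ t, w c * c.height s v = diagonalHeight ε s v x + 1 := by
  have h1 : ∀ c ∈ t, w c * c.height s v = (∑ a with a.1 4 = 1, ((stateAt s v a : ℤ) : ℝ) / 2 *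
      (if a ∈ c.facets ∨ partner a ∈ c.facets then w c else 0)) + w c := by
    intro c hc
    rw [Cell.height_eq hs v (Cell.eq_or_adjacent hε (hface c hc)), hq c hc, mul_add,
      Finset.mul_sum]
    simp only [Option.isSome_some, if_true, mul_one]
    congr 1
    refine Finset.sum_congr rfl fun a _ => ?_
    split <;> ring
  rw [Finset.sum_congr rfl h1, Finset.sum_add_distrib, hsum, Finset.sum_comm, diagonalHeight]
  congr 1
  refine Finset.sum_congr rfl fun a _ => ?_
  rw [← Finset.mul_sum, sum_or_eq_max t Cell.facets w hflag hw,
    sum_weights_eq hε hε' hx hface hq hflag hw hsum hxw,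
    sum_weights_eq hε hε' hx hface hq hflag hw hsum hxw, pairCoord]
  have h2 : ∀ r r' : ℝ, max (max 0 (2 * r)) (max 0 (2 * r')) = 2 * max 0 (max r r') := by
    intro r r'
    rw [mul_max_of_nonneg _ _ two_pos.le, mul_max_of_nonneg _ _ two_pos.le, mul_zero,
      max_max_max_comm, max_self]
  rw [h2]
  ring

lemma sum_weights_height (hε : 0 < ε) (hε' : ε < 1 / 2) (hs : IsBalanced s)
    {t : Finset Cell} {w : Cell → ℝ}
    (hx : x ∈ cubicFacet ε q) (hface : ∀ c ∈ t, (c.face ε).Nonempty)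
    (hflag : ∀ c ∈ t, ∀ d ∈ t, c.face ε ⊆ d.face ε ∨ d.face ε ⊆ c.face ε)
    (hw : ∀ c ∈ t, 0 ≤ w c) (hsum : ∑ c ∈ t, w c = 1)
    (hxw : x = ∑ c ∈ t, w c • c.barycentre ε) :
    ∑ c ∈ t, w c * c.height s v = diagonalHeight ε s v x + 1 := by
  -- A barycentre with positive weight lies in the cubic facet, because the cubic facet is an
  -- extreme subset of the truncated polytope.
  have hq : ∀ c ∈ t, w c ≠ 0 → c.cusp = some q := by
    have hle : ∀ c ∈ t, 0 ≤ w c * ((1 - ε) - ((q.2 : ℤ) : ℝ) * c.barycentre ε q.1) := by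
      intro c hc
      refine mul_nonneg (hw c hc) (sub_nonneg.mpr ?_)
      by_cases h : c.cusp = some q
      · exact (Cell.mul_barycentre_apply h).le
      · exact (Cell.mul_barycentre_lt hε hε' (hface c hc) h).le
    have h0 : ∑ c ∈ t, w c * ((1 - ε) - ((q.2 : ℤ) : ℝ) * c.barycentre ε q.1) = 0 := by
      have h1 := hx.2
      rw [hxw, Finset.sum_apply, Finset.mul_sum] at h1
      simp only [mul_sub _ (1 - ε), Finset.sum_sub_distrib]
      rw [← Finset.sum_mul, hsum, one_mul, sub_eq_zero, ← h1]
      refine Finset.sum_congr rfl fun c _ => ?_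
      simp only [Pi.smul_apply, smul_eq_mul]
      ring
    intro c hc hwc
    by_contra h
    have h1 := (Finset.sum_eq_zero_iff_of_nonneg hle).mp h0 c hc
    have h2 := Cell.mul_barycentre_lt hε hε' (hface c hc) h
    rcases mul_eq_zero.mp h1 with h3 | h3
    · exact hwc h3
    · linarith
  have hmem : ∀ {c}, c ∈ t.filter (fun c => w c ≠ 0) → c ∈ t ∧ w c ≠ 0 := Finset.mem_filter.mp
  have h1 : ∑ c ∈ t, w c * c.height s v = ∑ c ∈ t with w c ≠ 0, w c * c.height s v := by
    rw [Finset.sum_filter_of_ne]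
    exact fun c _ h => left_ne_zero_of_mul h
  rw [h1]
  refine sum_weights_height_of_cusp hε hε' hs hx (fun c hc => hface c (hmem hc).1)
    (fun c hc => hq c (hmem hc).1 (hmem hc).2) (fun c hc d hd => ?_)
    (fun c hc => hw c (hmem hc).1) ?_ ?_
  · rcases hflag c (hmem hc).1 d (hmem hd).1 with h | h
    · exact Or.inr (Cell.facets_subset hε hε' (hface c (hmem hc).1)
        (hq c (hmem hc).1 (hmem hc).2) h)
    · exact Or.inl (Cell.facets_subset hε hε' (hface d (hmem hd).1)
        (hq d (hmem hd).1 (hmem hd).2) h)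
  · rw [Finset.sum_filter_of_ne fun c _ h => h, hsum]
  · rw [Finset.sum_filter_of_ne, hxw]
    exact fun c _ h => left_ne_zero_of_smul h

lemma coe_sum_congr {ι : Type*} (S : Finset ι) {f g : ι → ℝ}
    (h : ∀ i ∈ S, (f i : AddCircle (1 : ℝ)) = (g i : AddCircle (1 : ℝ))) :
    ((∑ i ∈ S, f i : ℝ) : AddCircle (1 : ℝ)) = ((∑ i ∈ S, g i : ℝ) : AddCircle (1 : ℝ)) := by
  have h1 : ∀ f : ι → ℝ, ((∑ i ∈ S, f i : ℝ) : AddCircle (1 : ℝ)) =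
      ∑ i ∈ S, (f i : AddCircle (1 : ℝ)) :=
    fun f => map_sum (QuotientAddGroup.mk' (AddSubgroup.zmultiples (1 : ℝ))) f S
  rw [h1, h1, Finset.sum_congr rfl h]

lemma coe_eq_coe_of_sub_eq_intCast {x y : ℝ} (n : ℤ) (h : x - y = n) :
    (x : AddCircle (1 : ℝ)) = (y : AddCircle (1 : ℝ)) := by
  rw [← sub_eq_zero, ← AddCircle.coe_sub, AddCircle.coe_eq_zero_iff]
  exact ⟨n, by simp [h]⟩

lemma coe_neg_half_eq (u : ℤˣ) : ((((-u : ℤˣ) : ℤ) : ℝ) * (1 / 2) : ℝ) =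
    ((((u : ℤ) : ℝ) * (1 / 2) : ℝ) : AddCircle (1 : ℝ)) := by
  refine coe_eq_coe_of_sub_eq_intCast (-u) ?_
  push_cast
  ring

lemma pairCoord_le_half (hε : 0 < ε) (hx : x ∈ truncatedPolytope ε) (a : Facet) :
    pairCoord ε a x ≤ 1 / 2 :=
  max_le (by norm_num) (max_le ((cubeCoord_le_half_iff hε).mpr (hx.1 _))
    ((cubeCoord_le_half_iff hε).mpr (hx.1 _)))

lemma pairCoord_eq_half (hε : 0 < ε) (hx : x ∈ truncatedPolytope ε) {a b : Facet}
    (hb : dot b x = 1) (h : b = a ∨ b = partner a) : pairCoord ε a x = 1 / 2 := by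
  have hb' := (cubeCoord_eq_half_iff hε).mpr hb
  refine le_antisymm (pairCoord_le_half hε hx a) ?_
  rcases h with rfl | rfl
  · exact hb'.symm.le.trans ((le_max_left _ _).trans (le_max_right _ _))
  · exact hb'.symm.le.trans ((le_max_right _ _).trans (le_max_right _ _))

lemma pairCoord_eq_zero (hε : 0 < ε) (hx : x ∈ truncatedPolytope ε) {a b : Facet}
    (hb : dot b x = 1) (hab : moveOf (colour b) = moveOf (colour a))
    (h : ¬ (b = a ∨ b = partner a)) : pairCoord ε a x = 0 := by
  push Not at h
  have hb' := (cubeCoord_eq_half_iff hε).mpr hb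
  have key : ∀ c, moveOf (colour b) = moveOf (colour c) → b ≠ c → b ≠ partner c →
      cubeCoord ε c x ≤ 0 := by
    intro c hc h1 h2
    have h3 : ¬ Adjacent b c := fun h3 => h2 (by
      rw [eq_partner_of_adjacent b c hc h3, partner_partner])
    linarith [cubeCoord_add_nonpos hε h1 h3 hx]
  refine max_eq_left (max_le (key a hab h.1 h.2) (key _ ?_ h.2 ?_))
  · rw [move_partner, hab]
  · rw [partner_partner]
    exact h.1

/-- Crossing a facet changes the sign of the heights of its points, which are `± 1/2`, and leaves
the other summands unchanged. -/
lemma diagonalHeight_add_single (hε : 0 < ε) (hx : x ∈ truncatedPolytope ε) {b : Facet}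
    (hb : dot b x = 1) :
    (diagonalHeight ε s (v + Pi.single (colour b) 1) x : AddCircle (1 : ℝ)) =
      (diagonalHeight ε s v x : AddCircle (1 : ℝ)) := by
  refine coe_sum_congr _ fun a _ => ?_
  rw [stateAt_add_single]
  by_cases h : moveOf (colour b) = moveOf (colour a)
  · rw [if_pos h]
    by_cases h1 : b = a ∨ b = partner a
    · rw [pairCoord_eq_half hε hx hb h1, coe_neg_half_eq]
    · rw [pairCoord_eq_zero hε hx hb h h1, mul_zero, mul_zero]
  · rw [if_neg h]

lemma diagonalHeight_eq_of_mk_eq (hε : 0 < ε) {v' : Fin 8 → ZMod 2} {x x' : truncatedPolytope ε}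
    (h : Manifold.mk v x = Manifold.mk v' x') :
    (diagonalHeight ε s v x.1 : AddCircle (1 : ℝ)) =
      (diagonalHeight ε s v' x'.1 : AddCircle (1 : ℝ)) := by
  let g : Manifold ε → AddCircle (1 : ℝ) :=
    Quot.lift (fun p => (diagonalHeight ε s p.1 p.2.1 : AddCircle (1 : ℝ))) fun p r hpr => by
      obtain ⟨h1, a, ha, h2⟩ := hpr
      rw [h2, ← h1, diagonalHeight_add_single hε p.2.2 ha]
  exact congrArg g h

lemma exists_hasValue (hε : 0 < ε) (hε' : ε < 1 / 2) (s : State) (v : Fin 8 → ZMod 2)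
    {x : truncatedPolytope ε} (hx : x.1 ∈ cubicFacet ε q) :
    ∃ y, HasValue ε s (Manifold.mk v x) y := by
  obtain ⟨t, w, h1, h2, h3, h4, h5⟩ := exists_flag (fun a => max 0 (2 * cubeCoord ε a x.1))
    (fun a => le_max_left _ _) 1 zero_le_one fun a => max_le zero_le_one (by
      linarith [(cubeCoord_le_half_iff hε).mpr (hx.1.1 a)])
  let cell : Finset Facet ↪ Cell := ⟨fun F => ⟨F, some q⟩, fun F G h => congrArg Cell.facets h⟩
  have hpos : ∀ F ∈ t, ∀ a ∈ F, 0 < cubeCoord ε a x.1 := by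
    intro F hF a ha
    rcases lt_max_iff.mp (h1 F hF a ha) with h | h
    · exact absurd h (lt_irrefl _)
    · linarith
  have hmeet : ∀ F ∈ t, ∀ a ∈ F, a.1 q.1 = q.2 := by
    intro F hF a ha
    by_contra h
    exact lt_asymm (hpos F hF a ha) (cubeCoord_neg hε hε' hx h)
  have hopp : ∀ a : Facet, a.1 q.1 = q.2 → cubeCoord ε (opp q.1 a) x.1 = -cubeCoord ε a x.1 :=
    fun a ha => cubeCoord_opp hε (by rw [ha, hx.2])
  refine ⟨_, v, x, t.map cell, fun c => w c.facets, rfl, ?_, ?_, ?_, ?_, ?_, rfl⟩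
  · intro c hc
    obtain ⟨F, hF, rfl⟩ := Finset.mem_map.mp hc
    refine ⟨_, Cell.barycentre_mem_face (q := q) hε hε' rfl (hmeet F hF) fun a ha ha' => ?_⟩
    have := hpos F hF _ ha'
    rw [hopp a (hmeet F hF a ha)] at this
    linarith [hpos F hF a ha]
  · intro c hc d hd
    obtain ⟨F, hF, rfl⟩ := Finset.mem_map.mp hc
    obtain ⟨G, hG, rfl⟩ := Finset.mem_map.mp hd
    rcases h2 F hF G hG with h | h
    · exact Or.inr fun z hz => ⟨hz.1, fun a ha => hz.2.1 a (h ha), hz.2.2⟩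
    · exact Or.inl fun z hz => ⟨hz.1, fun a ha => hz.2.1 a (h ha), hz.2.2⟩
  · intro c hc
    obtain ⟨F, hF, rfl⟩ := Finset.mem_map.mp hc
    exact h3 F hF
  · rw [Finset.sum_map]
    exact h4
  · rw [Finset.sum_map]
    change x.1 = ∑ F ∈ t, w F • (cell F).barycentre ε
    have hsum1 : ((q.2 : ℤ) : ℝ) * (∑ F ∈ t, w F • (cell F).barycentre ε) q.1 = 1 - ε := by
      rw [Finset.sum_apply, Finset.mul_sum, ← one_mul (1 - ε), ← h4, Finset.sum_mul, h4]
      refine Finset.sum_congr rfl fun F _ => ?_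
      rw [Pi.smul_apply, smul_eq_mul, mul_left_comm,
        Cell.mul_barycentre_apply (c := cell F) rfl]
    refine eq_of_cubeCoord_eq hε hx.2 hsum1 fun a ha => ?_
    have h6 : cubeCoord ε a (∑ F ∈ t, w F • (cell F).barycentre ε) =
        ∑ F ∈ t, w F * cubeCoord ε a ((cell F).barycentre ε) := cubeCoord_sum h4 _ a
    have h7 : ∑ F ∈ t, w F * cubeCoord ε a ((cell F).barycentre ε) =
        (∑ F ∈ t, (if a ∈ F then w F else 0) -
          ∑ F ∈ t, (if opp q.1 a ∈ F then w F else 0)) / 2 := by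
      rw [← Finset.sum_sub_distrib, Finset.sum_div]
      refine Finset.sum_congr rfl fun F hF => ?_
      rw [Cell.cubeCoord_barycentre hε (c := cell F) rfl (hmeet F hF) ha]
      change w F * (((if a ∈ F then 1 else 0) - (if opp q.1 a ∈ F then 1 else 0)) / 2) = _
      split_ifs <;> ring
    rw [h6, h7, h5, h5, hopp a ha]
    rcases le_total 0 (cubeCoord ε a x.1) with h | h
    · rw [max_eq_right (by linarith), max_eq_left (by linarith)]; ring
    · rw [max_eq_left (by linarith), max_eq_right (by linarith)]; ring

theorem diagonalMap_mk (hε : 0 < ε) (hε' : ε < 1 / 2) (hs : IsBalanced s) (v : Fin 8 → ZMod 2)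
    {x : truncatedPolytope ε} (hx : x.1 ∈ cubicFacet ε q) :
    diagonalMap ε s (Manifold.mk v x) = (diagonalHeight ε s v x.1 : AddCircle (1 : ℝ)) := by
  obtain ⟨v', x', t, w, h1, h2, h3, h4, h5, h6, h7⟩ :=
    Classical.epsilon_spec (exists_hasValue hε hε' s v hx)
  have hx' : x = x' := Subtype.ext (congrArg Manifold.pos h1)
  rw [diagonalMap, h7, diagonalHeight_eq_of_mk_eq hε h1,
    sum_weights_height hε hε' hs (hx' ▸ hx) h2 h3 h4 h5 h6]
  exact coe_eq_coe_of_sub_eq_intCast 1 (by simp)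

end DiagonalMap

/-! ### The developing map of a boundary torus -/

/-- The side length of the boundary tori above an ideal vertex, in terms of the number of cubes. -/
def IsPeriod (q : IdealVertex) (L : ℕ) : Prop :=
  (q.1 ≠ 4 ∧ L = 4) ∨ (q.1 = 4 ∧ L = 2)

lemma sub_round_mem (p : Fin 4 → ℝ) :
    (fun k => p k - round (p k)) ∈ unitCube := fun k => abs_sub_round (p k)

lemma locallyFinite_cubes :
    LocallyFinite fun z : Fin 4 → ℤ => {p : Fin 4 → ℝ | (fun k => p k - z k) ∈ unitCube} := by
  intro p
  refine ⟨Metric.ball p 1, Metric.ball_mem_nhds p one_pos, ?_⟩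
  refine (Set.finite_Icc (fun k => round (p k) - 3) (fun k => round (p k) + 3)).subset ?_
  rintro z ⟨r, hr, hrp⟩
  have key : ∀ k, |(z k : ℝ) - round (p k)| < 3 := by
    intro k
    have h1 := abs_lt.mp ((dist_le_pi_dist r p k).trans_lt hrp)
    have h2 := abs_le.mp (hr k)
    have h3 := abs_le.mp (abs_sub_round (p k))
    exact abs_lt.mpr ⟨by linarith, by linarith⟩
  have key' : ∀ k, |z k - round (p k)| < 3 := fun k => by exact_mod_cast key k
  exact ⟨fun k => by have := abs_lt.mp (key' k); simp only; linarith,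
    fun k => by have := abs_lt.mp (key' k); simp only; linarith⟩

namespace Frame

variable {q : IdealVertex} (b : Frame q)

/-- The frame of the cube with centre `z`, which is obtained from the frame `b` of the cube with
centre `0` by successive reflections in the faces that separate the two cubes. -/
def frameAt (z : Fin 4 → ℤ) : Frame q where
  vec k := if Even (z k) then b.vec k else opp q.1 (b.vec k)
  vec_apply k := by
    split
    · exact b.vec_apply k
    · exact b.opp_apply k
  independent k l hkl := by
    have h1 := b.independent k l hkl
    have h3 : ∀ a a' : Facet, opp q.1 a = a' ↔ a = opp q.1 a' := fun a a' =>
      ⟨fun h => by rw [← h, opp_opp], fun h => by rw [h, opp_opp]⟩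
    split_ifs <;> simp [h3, opp_opp, h1]

lemma frameAt_vec (z : Fin 4 → ℤ) (k : Fin 4) :
    (b.frameAt z).vec k = if Even (z k) then b.vec k else opp q.1 (b.vec k) := rfl

lemma frameAt_add_single_self (z : Fin 4 → ℤ) (k : Fin 4) :
    (b.frameAt (z + Pi.single k 1)).vec k = opp q.1 ((b.frameAt z).vec k) := by
  rw [frameAt_vec, frameAt_vec]
  by_cases h : Even (z k) <;> simp [h, opp_opp]

lemma frameAt_add_single_of_ne (z : Fin 4 → ℤ) {k l : Fin 4} (hkl : l ≠ k) :
    (b.frameAt (z + Pi.single k 1)).vec l = (b.frameAt z).vec l := by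
  rw [frameAt_vec, frameAt_vec]
  simp [hkl]

lemma chart_frameAt (ε : ℝ) (z : Fin 4 → ℤ) (y : Fin 4 → ℝ) :
    (b.frameAt z).chart ε y = b.chart ε (fun k => if Even (z k) then y k else -y k) := by
  ext j
  by_cases hj : j = q.1
  · subst hj
    rw [chart_apply_self, chart_apply_self]
  · rw [chart_apply_ne _ _ _ hj, chart_apply_ne _ _ _ hj]
    congr 1
    refine Finset.sum_congr rfl fun k _ => ?_
    rw [frameAt_vec]
    split
    · rfl
    · rw [opp_apply_ne hj]
      push_cast
      ring

/-- The change of the index of the copy of the polytope along `n` steps on the `k`-th axis: facets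
of the colours of the two ends of the axis are crossed alternately. -/
def walk (k : Fin 4) (n : ℤ) : Fin 8 → ZMod 2 :=
  (((n + 1) / 2 : ℤ) : ZMod 2) • Pi.single (colour (b.vec k)) 1 +
    ((n / 2 : ℤ) : ZMod 2) • Pi.single (colour (opp q.1 (b.vec k))) 1

/-- The index of the copy of the polytope in which the cube with centre `z` lies, when the cube with
centre `0` lies in the copy `v`. -/
def copyAt (v : Fin 8 → ZMod 2) (z : Fin 4 → ℤ) : Fin 8 → ZMod 2 := v + ∑ k, b.walk k (z k)

lemma walk_zero (k : Fin 4) : b.walk k 0 = 0 := by simp [walk]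

lemma walk_add_one (k : Fin 4) (n : ℤ) : b.walk k (n + 1) = b.walk k n +
    Pi.single (colour (if Even n then b.vec k else opp q.1 (b.vec k))) 1 := by
  unfold walk
  by_cases h : Even n
  · have h1 : (n + 1 + 1) / 2 = (n + 1) / 2 + 1 := by obtain ⟨m, rfl⟩ := h; omega
    have h2 : (n + 1) / 2 = n / 2 := by obtain ⟨m, rfl⟩ := h; omega
    rw [if_pos h, h1, h2]
    push_cast
    rw [add_smul, one_smul]
    abel
  · have h1 : (n + 1 + 1) / 2 = (n + 1) / 2 := by
      obtain ⟨m, rfl⟩ := Int.not_even_iff_odd.mp h; omega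
    have h2 : (n + 1) / 2 = n / 2 + 1 := by
      obtain ⟨m, rfl⟩ := Int.not_even_iff_odd.mp h; omega
    rw [if_neg h, h1]
    nth_rewrite 2 [h2]
    push_cast
    rw [add_smul, one_smul]
    abel

lemma copyAt_zero (v : Fin 8 → ZMod 2) : b.copyAt v 0 = v := by simp [copyAt, walk_zero]

lemma copyAt_add_single (v : Fin 8 → ZMod 2) (z : Fin 4 → ℤ) (k : Fin 4) :
    b.copyAt v (z + Pi.single k 1) =
      b.copyAt v z + Pi.single (colour ((b.frameAt z).vec k)) 1 := by
  have h1 : ∀ l, b.walk l ((z + Pi.single k 1 : Fin 4 → ℤ) l) = b.walk l (z l) +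
      if l = k then Pi.single (colour ((b.frameAt z).vec k)) 1 else 0 := by
    intro l
    by_cases h : l = k
    · subst h
      rw [if_pos rfl, frameAt_vec, ← walk_add_one]
      simp
    · simp [h]
  simp only [copyAt, h1, Finset.sum_add_distrib, Finset.sum_ite_eq', Finset.mem_univ, if_true,
    add_assoc]

lemma walk_add_two (k : Fin 4) (n : ℤ) : b.walk k (n + 2) = b.walk k n +
    (Pi.single (colour (b.vec k)) 1 + Pi.single (colour (opp q.1 (b.vec k))) 1) := by
  rw [show n + 2 = n + 1 + 1 by ring, walk_add_one, walk_add_one]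
  by_cases h : Even n
  · have h1 : ¬ Even (n + 1) := by simpa [Int.even_add_one] using h
    rw [if_pos h, if_neg h1]
    abel
  · have h1 : Even (n + 1) := by simpa [Int.even_add_one] using h
    rw [if_neg h, if_pos h1]
    abel

lemma walk_add_period {L : ℕ} (hL : IsPeriod q L) (k : Fin 4) (n : ℤ) :
    b.walk k (n + L) = b.walk k n := by
  have h2 : ∀ f : Fin 8 → ZMod 2, f + f = 0 := fun f => CharTwo.add_self_eq_zero f
  rcases hL with ⟨_, rfl⟩ | ⟨h, rfl⟩
  · rw [show n + ((4 : ℕ) : ℤ) = n + 2 + 2 by push_cast; ring, walk_add_two, walk_add_two, add_assoc,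
      h2, add_zero]
  · rw [show n + ((2 : ℕ) : ℤ) = n + 2 by push_cast; ring, walk_add_two, h, colour_opp_four, h2,
      add_zero]

lemma walk_add_mul_period {L : ℕ} (hL : IsPeriod q L) (k : Fin 4) (n m : ℤ) :
    b.walk k (n + L * m) = b.walk k n := by
  have h : Function.Periodic (b.walk k) (L : ℤ) := b.walk_add_period hL k
  rw [mul_comm]
  exact h.int_mul m n

section DevMap

variable {ε : ℝ} (hε : 0 < ε) (hε' : ε < 1 / 2) (v : Fin 8 → ZMod 2)

/-- The point with coordinates `y` of the unit cube with centre `z`, in the manifold. -/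
def cubePoint (z : Fin 4 → ℤ) (y : unitCube) : Manifold ε :=
  Manifold.mk (b.copyAt v z)
    ⟨(b.frameAt z).chart ε y.1, ((b.frameAt z).chart_mem_cubicFacet hε hε' y.2).1⟩

lemma continuous_cubePoint (z : Fin 4 → ℤ) : Continuous (b.cubePoint hε hε' v z) :=
  (Manifold.continuous_mk _).comp
    (((b.frameAt z).continuous_chart ε).comp continuous_subtype_val |>.subtype_mk _)

lemma exists_walk_ne {w w' : Fin 4 → ℤ} {c : Fin 8} (h : b.copyAt v w c ≠ b.copyAt v w' c) :
    ∃ k, b.walk k (w k) c ≠ b.walk k (w' k) c := by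
  by_contra! hcon
  apply h
  simp only [copyAt, Pi.add_apply, Finset.sum_apply, hcon]

/-- The parametrizations of adjacent cubes agree on their common faces. -/
lemma cubePoint_eq {z z' : Fin 4 → ℤ} {y y' : unitCube}
    (h : ∀ k, (z' k = z k ∧ y'.1 k = y.1 k) ∨
      (z' k = z k + 1 ∧ y.1 k = 1 / 2 ∧ y'.1 k = -(1 / 2))) :
    b.cubePoint hε hε' v z y = b.cubePoint hε hε' v z' y' := by
  refine Manifold.mk_eq_mk_iff.mpr ⟨Subtype.ext ?_, fun c hc => ?_⟩
  · change (b.frameAt z).chart ε y.1 = (b.frameAt z').chart ε y'.1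
    rw [chart_frameAt, chart_frameAt]
    congr 1
    ext k
    rcases h k with ⟨h1, h2⟩ | ⟨h1, h2, h3⟩
    · rw [h1, h2]
    · rw [h1, h2, h3]
      by_cases he : Even (z k) <;> simp [he]
  · obtain ⟨k, hk⟩ := b.exists_walk_ne v hc
    rcases h k with ⟨h1, h2⟩ | ⟨h1, h2, h3⟩
    · exact absurd (by rw [h1]) hk
    · rw [h1, walk_add_one, ← frameAt_vec, Pi.add_apply, ne_eq, left_eq_add, Pi.single_apply] at hk
      refine ⟨(b.frameAt z).vec k, (cubeCoord_eq_half_iff hε).mp ?_, ?_⟩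
      · rw [← h2]
        exact (b.frameAt z).cubeCoord_chart hε _ k
      · by_contra hcon
        exact hk (if_neg (Ne.symm hcon))

/-- The covering map from `ℝ⁴` to a boundary torus that extends the parametrization of a cube in the
copy `v` of the polytope by the frame `b`. -/
def devMap (p : Fin 4 → ℝ) : Manifold ε :=
  b.cubePoint hε hε' v (fun k => round (p k)) ⟨_, sub_round_mem p⟩

lemma devMap_add (z : Fin 4 → ℤ) (y : unitCube) :
    b.devMap hε hε' v (fun k => z k + y.1 k) = b.cubePoint hε hε' v z y := by
  refine (b.cubePoint_eq hε hε' v fun k => ?_).symm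
  have hy := abs_le.mp (y.2 k)
  have h1 : round ((z k : ℝ) + y.1 k) = z k + round (y.1 k) := by
    rw [add_comm, round_add_intCast, add_comm]
  rcases hy.2.lt_or_eq with h2 | h2
  · have h3 : round (y.1 k) = 0 := by
      rw [round_eq, Int.floor_eq_zero_iff]
      exact ⟨by linarith, by linarith⟩
    left
    simp [h1, h3]
  · have h3 : round (y.1 k) = 1 := by
      rw [h2, round_eq]; norm_num
    right
    rw [h3] at h1
    refine ⟨h1, h2, ?_⟩
    change ((z k : ℝ) + y.1 k) - round ((z k : ℝ) + y.1 k) = _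
    rw [h1, h2]
    push_cast
    ring

lemma continuous_devMap : Continuous (b.devMap hε hε' v) := by
  refine locallyFinite_cubes.continuous ?_ ?_ ?_
  · exact Set.eq_univ_of_forall fun p => Set.mem_iUnion.mpr ⟨_, sub_round_mem p⟩
  · intro z
    have h1 : IsClosed unitCube := by
      have : unitCube = ⋂ k, {y : Fin 4 → ℝ | |y k| ≤ 1 / 2} := by
        ext; simp [unitCube]
      rw [this]
      exact isClosed_iInter fun k => isClosed_le (by fun_prop) (by fun_prop)
    exact h1.preimage (by fun_prop)
  · intro z
    rw [continuousOn_iff_continuous_domRestrict]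
    have h1 : ({p : Fin 4 → ℝ | (fun k => p k - z k) ∈ unitCube}.domRestrict (b.devMap hε hε' v)) =
        fun p => b.cubePoint hε hε' v z ⟨_, p.2⟩ := by
      ext p
      rw [← devMap_add]
      simp
    rw [h1]
    exact (b.continuous_cubePoint hε hε' v z).comp (Continuous.subtype_mk
      (continuous_pi fun k => ((continuous_apply k).comp continuous_subtype_val).sub
        continuous_const) _)

lemma devMap_add_period {L : ℕ} (hL : IsPeriod q L) (p : Fin 4 → ℝ) (m : Fin 4 → ℤ) :
    b.devMap hε hε' v (fun k => p k + L * m k) = b.devMap hε hε' v p := by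
  have heven : Even (L : ℤ) := by
    rcases hL with ⟨_, rfl⟩ | ⟨_, rfl⟩ <;> decide
  have h1 : (fun k => p k + L * m k) =
      fun k => (((fun k => round (p k) + L * m k) : Fin 4 → ℤ) k : ℝ) +
        (⟨_, sub_round_mem p⟩ : unitCube).1 k := by
    ext k
    push_cast
    ring
  have h2 : b.copyAt v (fun k => round (p k) + L * m k) = b.copyAt v fun k => round (p k) := by
    simp only [copyAt, b.walk_add_mul_period hL]
  have h3 : b.frameAt (fun k => round (p k) + L * m k) = b.frameAt fun k => round (p k) := by
    simp only [frameAt, Int.even_add, heven.mul_right, iff_true]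
  rw [h1, devMap_add, devMap, cubePoint]
  simp only [h2, h3]
  rfl

end DevMap

end Frame

/-! ### The boundary components -/

lemma eq_or_eq_opp_of_colour_eq {i : Fin 5} {a a' : Facet} (h : a.1 i = a'.1 i)
    (hc : colour a = colour a') : a' = a ∨ a' = opp i a := by
  by_cases hi : i = 4
  · exact eq_or_eq_opp_of_move_eq_four i hi a a' h (by rw [hc])
  · exact Or.inl (eq_of_colour_eq i hi a a' h hc).symm

namespace Frame

variable {q : IdealVertex} (b : Frame q)

lemma colour_ne {k l : Fin 4} (hkl : l ≠ k) {a a' : Facet}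
    (ha : a = b.vec k ∨ a = opp q.1 (b.vec k)) (ha' : a' = b.vec l ∨ a' = opp q.1 (b.vec l)) :
    colour a ≠ colour a' := by
  intro hc
  have h1 : ∀ {k : Fin 4} {a : Facet}, a = b.vec k ∨ a = opp q.1 (b.vec k) → a.1 q.1 = q.2 := by
    rintro k a (rfl | rfl)
    · exact b.vec_apply k
    · exact b.opp_apply k
  have h2 := b.independent k l hkl.symm
  have h3 : ∀ a a' : Facet, opp q.1 a = a' ↔ a = opp q.1 a' := fun a a' =>
    ⟨fun h => by rw [← h, opp_opp], fun h => by rw [h, opp_opp]⟩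
  rcases eq_or_eq_opp_of_colour_eq ((h1 ha).trans (h1 ha').symm) hc with h | h <;>
    rcases ha with rfl | rfl <;> rcases ha' with rfl | rfl <;>
    simp [h3, opp_opp, h2] at h

lemma walk_apply_of_ne {k l : Fin 4} (hkl : l ≠ k) {a : Facet}
    (ha : a = b.vec k ∨ a = opp q.1 (b.vec k)) (n : ℤ) : b.walk l n (colour a) = 0 := by
  simp [walk, b.colour_ne hkl ha (Or.inl rfl), b.colour_ne hkl ha (Or.inr rfl)]

lemma copyAt_apply (v : Fin 8 → ZMod 2) (z : Fin 4 → ℤ) {k : Fin 4} {a : Facet}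
    (ha : a = b.vec k ∨ a = opp q.1 (b.vec k)) :
    b.copyAt v z (colour a) = v (colour a) + b.walk k (z k) (colour a) := by
  rw [copyAt, Pi.add_apply, Finset.sum_apply, Finset.sum_eq_single k]
  · exact fun l _ hl => b.walk_apply_of_ne hl ha _
  · simp

/-- The index of the copy and the coordinate in the cube determine the position on an axis up to
the period. -/
lemma exists_sub_eq_of_walk_eq {L : ℕ} (hL : IsPeriod q L) (k : Fin 4) {z z' : ℤ} {y y' u : ℝ}
    (hu : u = if Even z then y else -y) (hu' : u = if Even z' then y' else -y')
    (h : ∀ a, (a = b.vec k ∨ a = opp q.1 (b.vec k)) →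
      b.walk k z (colour a) ≠ b.walk k z' (colour a) →
      ∃ a', colour a' = colour a ∧ ((a' = b.vec k ∧ u = 1 / 2) ∨
        (a' = opp q.1 (b.vec k) ∧ u = -(1 / 2)))) :
    ∃ m : ℤ, (z + y) - (z' + y') = L * m := by
  have hy : y = if Even z then u else -u := by split_ifs at hu ⊢ <;> linarith
  have hy' : y' = if Even z' then u else -u := by split_ifs at hu' ⊢ <;> linarith
  -- on either side of a face the position is determined by the number of preceding crossings
  have hpos : u = 1 / 2 → ∀ n : ℤ, (n : ℝ) + (if Even n then u else -u) =
      2 * ((n / 2 : ℤ) : ℝ) + 1 / 2 := by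
    rintro rfl n
    rcases Int.even_or_odd' n with ⟨m, rfl | rfl⟩
    · rw [if_pos (by simp), Int.mul_ediv_cancel_left _ two_ne_zero]
      push_cast; ring
    · rw [if_neg (by simp), show (2 * m + 1) / 2 = m by omega]
      push_cast; ring
  have hneg : u = -(1 / 2) → ∀ n : ℤ, (n : ℝ) + (if Even n then u else -u) =
      2 * (((n + 1) / 2 : ℤ) : ℝ) - 1 / 2 := by
    rintro rfl n
    rcases Int.even_or_odd' n with ⟨m, rfl | rfl⟩
    · rw [if_pos (by simp), show (2 * m + 1) / 2 = m by omega]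
      push_cast; ring
    · rw [if_neg (by simp), show (2 * m + 1 + 1) / 2 = m + 1 by omega]
      push_cast; ring
  have hsame : Even z = Even z' → (z + y) - (z' + y') = ((z - z' : ℤ) : ℝ) := by
    intro he
    rw [hy, hy']
    simp only [he]
    push_cast
    ring
  rcases hL with ⟨hq, rfl⟩ | ⟨hq, rfl⟩
  · have hne : colour (opp q.1 (b.vec k)) ≠ colour (b.vec k) := fun hc =>
      opp_ne_self q.1 (b.vec k) (eq_of_colour_eq q.1 hq _ _ (opp_apply_self _ _) hc)
    have hw1 : ∀ n : ℤ, b.walk k n (colour (b.vec k)) = (((n + 1) / 2 : ℤ) : ZMod 2) := by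
      intro n; simp [walk, hne.symm]
    have hw2 : ∀ n : ℤ, b.walk k n (colour (opp q.1 (b.vec k))) = ((n / 2 : ℤ) : ZMod 2) := by
      intro n; simp [walk, hne]
    have h1 : (z + 1) / 2 % 2 = (z' + 1) / 2 % 2 ∨ u = 1 / 2 := by
      by_contra! hcon
      obtain ⟨a', ha', ⟨rfl, h2⟩ | ⟨rfl, h2⟩⟩ := h _ (Or.inl rfl) (by
        rw [hw1, hw1, Ne, ZMod.intCast_eq_intCast_iff']
        exact_mod_cast hcon.1)
      · exact hcon.2 h2
      · exact hne ha'
    have h2 : z / 2 % 2 = z' / 2 % 2 ∨ u = -(1 / 2) := by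
      by_contra! hcon
      obtain ⟨a', ha', ⟨rfl, h2⟩ | ⟨rfl, h2⟩⟩ := h _ (Or.inr rfl) (by
        rw [hw2, hw2, Ne, ZMod.intCast_eq_intCast_iff']
        exact_mod_cast hcon.1)
      · exact hne ha'.symm
      · exact hcon.2 h2
    rcases h1 with h1 | h1 <;> rcases h2 with h2 | h2
    · rw [hsame (by rw [Int.even_iff, Int.even_iff]; apply propext; omega)]
      exact ⟨(z - z') / 4, by exact_mod_cast (by omega : z - z' = 4 * ((z - z') / 4))⟩
    · rw [hy, hy', hneg h2, hneg h2]
      refine ⟨((z + 1) / 2 - (z' + 1) / 2) / 2, ?_⟩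
      have : (z + 1) / 2 - (z' + 1) / 2 = 2 * (((z + 1) / 2 - (z' + 1) / 2) / 2) := by omega
      have h3 : (((z + 1) / 2 : ℤ) : ℝ) - (((z' + 1) / 2 : ℤ) : ℝ) =
        2 * (((((z + 1) / 2 - (z' + 1) / 2) / 2) : ℤ) : ℝ) := by exact_mod_cast this
      push_cast [] at h3 ⊢
      linarith
    · rw [hy, hy', hpos h1, hpos h1]
      refine ⟨(z / 2 - z' / 2) / 2, ?_⟩
      have : z / 2 - z' / 2 = 2 * ((z / 2 - z' / 2) / 2) := by omega
      have h3 : ((z / 2 : ℤ) : ℝ) - ((z' / 2 : ℤ) : ℝ) =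
        2 * (((z / 2 - z' / 2) / 2 : ℤ) : ℝ) := by exact_mod_cast this
      push_cast [] at h3 ⊢
      linarith
    · rw [h1] at h2; norm_num at h2
  · have hw : ∀ n : ℤ, b.walk k n (colour (b.vec k)) = (n : ZMod 2) := by
      intro n
      have : n = (n + 1) / 2 + n / 2 := by omega
      conv_rhs => rw [this]
      simp [walk, hq, colour_opp_four]
    by_cases hz : z % 2 = z' % 2
    · rw [hsame (by rw [Int.even_iff, Int.even_iff, hz])]
      exact ⟨(z - z') / 2, by exact_mod_cast (by omega : z - z' = 2 * ((z - z') / 2))⟩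
    · obtain ⟨a', -, h2 | h2⟩ := h _ (Or.inl rfl) (by
        rw [hw, hw, Ne, ZMod.intCast_eq_intCast_iff']
        exact_mod_cast hz)
      · rw [hy, hy', hpos h2.2, hpos h2.2]
        exact ⟨z / 2 - z' / 2, by push_cast; ring⟩
      · rw [hy, hy', hneg h2.2, hneg h2.2]
        exact ⟨(z + 1) / 2 - (z' + 1) / 2, by push_cast; ring⟩

variable {ε : ℝ} (hε : 0 < ε) (hε' : ε < 1 / 2) (v : Fin 8 → ZMod 2)

lemma exists_sub_eq_of_devMap_eq {L : ℕ} (hL : IsPeriod q L) {p p' : Fin 4 → ℝ}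
    (h : b.devMap hε hε' v p = b.devMap hε hε' v p') (k : Fin 4) :
    ∃ m : ℤ, p k - p' k = L * m := by
  obtain ⟨h1, h2⟩ := Manifold.mk_eq_mk_iff.mp h
  have h3 := Subtype.ext_iff.mp h1
  simp only [chart_frameAt] at h3
  have h4 := congrFun (b.chart_injective hε h3) k
  obtain ⟨m, hm⟩ := b.exists_sub_eq_of_walk_eq hL k rfl h4 (by
    intro a ha hne
    obtain ⟨a', ha', hc⟩ := h2 (colour a) (by
      rw [b.copyAt_apply v _ ha, b.copyAt_apply v _ ha]
      exact fun h => hne (add_left_cancel h))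
    refine ⟨a', hc, ?_⟩
    have hmem := (b.frameAt fun k => round (p k)).chart_mem_cubicFacet hε hε' (sub_round_mem p)
    have hq := apply_eq_of_dot_eq_one hε hε' hmem ha'
    obtain ⟨l, hl⟩ := b.exists_eq_or_eq_opp hq
    have hlk : l = k := by
      by_contra hlk
      exact b.colour_ne hlk ha hl hc.symm
    subst hlk
    have hcoord := (cubeCoord_eq_half_iff hε).mpr ha'
    simp only [chart_frameAt] at hcoord
    rcases hl with rfl | rfl
    · left
      rw [b.cubeCoord_chart hε] at hcoord
      exact ⟨rfl, hcoord⟩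
    · right
      rw [cubeCoord_opp hε (by rw [b.vec_apply, mul_chart_apply_self]),
        b.cubeCoord_chart hε] at hcoord
      exact ⟨rfl, by linarith⟩)
  refine ⟨m, ?_⟩
  rw [← hm]
  ring

/-- Every copy of the cubic facet that can be reached by crossing facets that meet it is one of the
cubes of the boundary torus. -/
lemma exists_copyAt_eq (v : Fin 8 → ZMod 2) (S : Finset (Fin 8))
    (hS : ∀ c ∈ S, ∃ a : Facet, a.1 q.1 = q.2 ∧ colour a = c) :
    ∃ z, b.copyAt v z = v + ∑ c ∈ S, Pi.single c 1 := by
  induction S using Finset.induction_on with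
  | empty => exact ⟨0, by simp [copyAt_zero]⟩
  | insert c S hc ih =>
    obtain ⟨z, hz⟩ := ih fun d hd => hS d (Finset.mem_insert_of_mem hd)
    obtain ⟨a, ha, rfl⟩ := hS c (Finset.mem_insert_self _ _)
    obtain ⟨k, hk⟩ := (b.frameAt z).exists_eq_or_eq_opp ha
    rw [Finset.sum_insert hc, add_comm (Pi.single _ _), ← add_assoc, ← hz]
    rcases hk with rfl | rfl
    · exact ⟨_, b.copyAt_add_single v z k⟩
    · refine ⟨z - Pi.single k 1, ?_⟩
      have h1 := b.copyAt_add_single v (z - Pi.single k 1) k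
      have h2 := b.frameAt_add_single_self (z - Pi.single k 1) k
      rw [sub_add_cancel] at h1 h2
      rw [h1, h2, opp_opp, add_assoc, CharTwo.add_self_eq_zero, add_zero]

lemma cubePoint_mem_boundary (z : Fin 4 → ℤ) (y : unitCube) :
    b.cubePoint hε hε' v z y ∈ boundary ε :=
  ⟨q, _, _, (b.frameAt z).chart_mem_cubicFacet hε hε' y.2, rfl⟩

end Frame

lemma pos_of_isPreconnected {X : Type*} [TopologicalSpace X] {K : Set X} (hK : IsPreconnected K)
    {g : X → ℝ} (hg : Continuous g) (h0 : ∀ x ∈ K, g x ≠ 0) {x y : X} (hx : x ∈ K) (hy : y ∈ K)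
    (hgx : 0 < g x) : 0 < g y := by
  by_contra! h
  obtain ⟨z, hz, hz0⟩ := hK.intermediate_value hy hx hg.continuousOn ⟨h, hgx.le⟩
  exact h0 z hz hz0

section Component

variable {ε : ℝ} {q : IdealVertex}

lemma mul_apply_lt_half (hε : 0 < ε) (hε' : ε < 1 / 2) {q' : IdealVertex} (hq : q' ≠ q)
    {x : Fin 5 → ℝ} (hx : x ∈ cubicFacet ε q') : ((q.2 : ℤ) : ℝ) * x q.1 < 1 / 2 := by
  by_cases hi : q.1 = q'.1
  · have h2 : q.2 ≠ q'.2 := fun h => hq (Prod.ext hi h).symm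
    have h3 := hx.2
    rw [Int.units_ne_iff_eq_neg.mp h2, hi]
    push_cast
    linarith
  · have h2 := abs_le_of_mem_cubicFacet hε hx hi
    calc ((q.2 : ℤ) : ℝ) * x q.1 ≤ |((q.2 : ℤ) : ℝ) * x q.1| := le_abs_self _
      _ ≤ ε := by rwa [abs_mul, abs_coe_units, one_mul]
      _ < 1 / 2 := hε'

/-- A boundary component consists of copies of a single cubic facet, and the copies that occur
differ only in the colours of the facets that meet it. The latter holds because a sheet function
of another colour does not vanish on the component. -/
lemma exists_of_mem_component (hε : 0 < ε) (hε' : ε < 1 / 2) {v : Fin 8 → ZMod 2}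
    {x : truncatedPolytope ε} (hx : x.1 ∈ cubicFacet ε q) {p : Manifold ε}
    (hp : p ∈ connectedComponentIn (boundary ε) (Manifold.mk v x)) :
    ∃ (v' : Fin 8 → ZMod 2) (x' : truncatedPolytope ε), x'.1 ∈ cubicFacet ε q ∧
      p = Manifold.mk v' x' ∧ ∀ c, v c ≠ v' c → ∃ a : Facet, a.1 q.1 = q.2 ∧ colour a = c := by
  set K := connectedComponentIn (boundary ε) (Manifold.mk v x)
  have hK : IsPreconnected K := isPreconnected_connectedComponentIn
  have hxb : Manifold.mk v x ∈ boundary ε := ⟨q, v, x, hx, rfl⟩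
  have hxK : Manifold.mk v x ∈ K := mem_connectedComponentIn hxb
  have hKb : K ⊆ boundary ε := connectedComponentIn_subset _ _
  have key : ∀ p ∈ K, ∃ (v' : Fin 8 → ZMod 2) (x' : truncatedPolytope ε),
      x'.1 ∈ cubicFacet ε q ∧ p = Manifold.mk v' x' := by
    intro p hp
    have h1 : 0 < ((q.2 : ℤ) : ℝ) * p.pos q.1 - 1 / 2 := by
      refine pos_of_isPreconnected hK (g := fun p => ((q.2 : ℤ) : ℝ) * p.pos q.1 - 1 / 2) ?_ ?_
        hxK hp ?_
      · exact (continuous_const.mul ((continuous_apply _).comp Manifold.continuous_pos)).sub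
          continuous_const
      · intro p hp
        obtain ⟨q', v', x', hx', rfl⟩ := hKb hp
        rw [Manifold.pos_mk]
        by_cases hq : q' = q
        · subst hq
          rw [hx'.2]
          linarith
        · linarith [mul_apply_lt_half hε hε' hq hx']
      · rw [Manifold.pos_mk, hx.2]
        linarith
    obtain ⟨q', v', x', hx', rfl⟩ := hKb hp
    rw [Manifold.pos_mk] at h1
    by_cases hq : q' = q
    · subst hq
      exact ⟨v', x', hx', rfl⟩
    · linarith [mul_apply_lt_half hε hε' hq hx']
  obtain ⟨v', x', hx', rfl⟩ := key p hp
  refine ⟨v', x', hx', rfl, fun c hc => ?_⟩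
  by_contra! hcon
  have hprod : ∀ x : Fin 5 → ℝ, x ∈ cubicFacet ε q →
      0 < ∏ a with colour a = c, (1 - dot a x) := by
    intro x hx
    refine Finset.prod_pos fun a ha => sub_pos.mpr ((hx.1.1 a).lt_of_ne fun h => ?_)
    exact hcon a (apply_eq_of_dot_eq_one hε hε' hx h) (by simpa using ha)
  have h1 : 0 < paritySign (v c) * (Manifold.mk v' x').sheet c := by
    refine pos_of_isPreconnected hK (g := fun p => paritySign (v c) * p.sheet c)
      (continuous_const.mul (Manifold.continuous_sheet c)) ?_ hxK hp ?_
    · intro p hp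
      obtain ⟨w, z, hz, rfl⟩ := key p hp
      rw [Manifold.sheet_mk]
      exact mul_ne_zero (paritySign_ne_zero _)
        (mul_ne_zero (paritySign_ne_zero _) (hprod _ hz).ne')
    · rw [Manifold.sheet_mk, ← mul_assoc]
      exact mul_pos (paritySign_mul_pos_iff.mpr rfl) (hprod _ hx)
  rw [Manifold.sheet_mk, ← mul_assoc, mul_pos_iff_of_pos_right (hprod _ hx')] at h1
  exact hc (paritySign_mul_pos_iff.mp h1)

lemma range_devMap (hε : 0 < ε) (hε' : ε < 1 / 2) (b : Frame q) {v : Fin 8 → ZMod 2}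
    {x : truncatedPolytope ε} (hx : x.1 ∈ cubicFacet ε q) :
    Set.range (b.devMap hε hε' v) = connectedComponentIn (boundary ε) (Manifold.mk v x) := by
  have hmem : ∀ (v' : Fin 8 → ZMod 2) (x' : truncatedPolytope ε), x'.1 ∈ cubicFacet ε q →
      (∀ c, v c ≠ v' c → ∃ a : Facet, a.1 q.1 = q.2 ∧ colour a = c) →
      Manifold.mk v' x' ∈ Set.range (b.devMap hε hε' v) := by
    intro v' x' hx' h
    obtain ⟨z, hz⟩ := b.exists_copyAt_eq v (Finset.univ.filter fun c => v c ≠ v' c)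
      (by simpa using h)
    have hv' : v + ∑ c with v c ≠ v' c, Pi.single c 1 = v' := by
      ext c
      have h2 : ∀ m n : ZMod 2, m + (if m ≠ n then 1 else 0) = n := by decide
      conv_rhs => rw [← h2 (v c) (v' c)]
      simp [Finset.sum_apply, Pi.single_apply]
    obtain ⟨y, hy, hyx⟩ := (b.frameAt z).exists_chart_eq hε hx'
    refine ⟨fun k => z k + y k, ?_⟩
    rw [b.devMap_add hε hε' v z ⟨y, hy⟩, Frame.cubePoint]
    congr 1
    · rw [hz, hv']
    · exact Subtype.ext hyx
  refine Set.Subset.antisymm ?_ ?_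
  · refine (isPreconnected_range (b.continuous_devMap hε hε' v)).subset_connectedComponentIn
      (hmem v x hx fun c hc => absurd rfl hc) ?_
    rintro _ ⟨p, rfl⟩
    exact b.cubePoint_mem_boundary hε hε' v _ _
  · intro p hp
    obtain ⟨v', x', hx', rfl, h⟩ := exists_of_mem_component hε hε' hx hp
    exact hmem v' x' hx' h

end Component

/-! ### Cubical identifications -/

/-- The covering map `ℝ⁴ → ℝ⁴ / Lℤ⁴`. -/
def torusProj (L : ℕ) (p : Fin 4 → ℝ) : Torus L := fun k => (p k : AddCircle (L : ℝ))

lemma torusProj_surjective (L : ℕ) : Function.Surjective (torusProj L) := fun x =>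
  ⟨fun k => (x k).out, funext fun k => Quotient.out_eq (x k)⟩

lemma isQuotientMap_torusProj (L : ℕ) : Topology.IsQuotientMap (torusProj L) :=
  (IsOpenQuotientMap.piMap fun _ : Fin 4 =>
    (QuotientAddGroup.isOpenQuotientMap_mk (N := AddSubgroup.zmultiples (L : ℝ)))).isQuotientMap

lemma torusProj_eq_iff {L : ℕ} {p p' : Fin 4 → ℝ} :
    torusProj L p = torusProj L p' ↔ ∃ m : Fin 4 → ℤ, p = fun k => p' k + L * m k := by
  have h : ∀ k, ((p k : AddCircle (L : ℝ)) = p' k) ↔ ∃ m : ℤ, p k = p' k + L * m := by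
    intro k
    rw [← sub_eq_zero, ← AddCircle.coe_sub, AddCircle.coe_eq_zero_iff]
    refine exists_congr fun m => ?_
    rw [zsmul_eq_mul, mul_comm]
    constructor <;> intro h <;> linarith
  constructor
  · intro hp
    choose m hm using fun k => (h k).mp (congrFun hp k)
    exact ⟨m, funext hm⟩
  · rintro ⟨m, rfl⟩
    exact funext fun k => (h k).mpr ⟨m k, rfl⟩

namespace Frame

variable {q : IdealVertex} (b : Frame q) {ε : ℝ} (hε : 0 < ε) (hε' : ε < 1 / 2)
  (v : Fin 8 → ZMod 2)

lemma exists_torusMap {L : ℕ} (hL : IsPeriod q L) :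
    ∃ ψ : Torus L → Manifold ε, ∀ p, ψ (torusProj L p) = b.devMap hε hε' v p := by
  refine ⟨fun x => b.devMap hε hε' v (torusProj_surjective L x).choose, fun p => ?_⟩
  obtain ⟨m, hm⟩ := torusProj_eq_iff.mp (torusProj_surjective L (torusProj L p)).choose_spec
  simp only [hm]
  exact b.devMap_add_period hε hε' v hL p m

/-- The chart of a frame as an affine map. -/
def affineChart (ε : ℝ) : (Fin 4 → ℝ) →ᵃ[ℝ] (Fin 5 → ℝ) where
  toFun := b.chart ε
  linear :=
    { toFun := fun y j => if j = q.1 then 0 else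
        ε / 2 * ∑ k, y k * (((b.vec k).1 j : ℤ) : ℝ)
      map_add' := fun y y' => by
        ext j
        by_cases hj : j = q.1
        · simp [hj]
        · simp [hj, add_mul, Finset.sum_add_distrib, mul_add]
      map_smul' := fun r y => by
        ext j
        by_cases hj : j = q.1
        · simp [hj]
        · simp only [hj, if_false, Pi.smul_apply, smul_eq_mul, RingHom.id_apply, Finset.mul_sum]
          exact Finset.sum_congr rfl fun k _ => by ring }
  map_vadd' := fun y y' => by
    ext j
    by_cases hj : j = q.1
    · simp [chart, hj]
    · simp [chart, hj, add_mul, Finset.sum_add_distrib, mul_add]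

lemma isCubicalIdentification {L : ℕ} (hL : IsPeriod q L) {ψ : Torus L → Manifold ε}
    (hψ : ∀ p, ψ (torusProj L p) = b.devMap hε hε' v p) {C : Set (Manifold ε)}
    (hC : Set.range (b.devMap hε hε' v) = C) : IsCubicalIdentification ε q C L ψ where
  isEmbedding := by
    have hL0 : Fact (0 < (L : ℝ)) := ⟨by rcases hL with ⟨_, rfl⟩ | ⟨_, rfl⟩ <;> norm_num⟩
    refine (Continuous.isClosedEmbedding ?_ ?_).isEmbedding
    · rw [(isQuotientMap_torusProj L).continuous_iff]
      exact (b.continuous_devMap hε hε' v).congr fun p => (hψ p).symm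
    · intro x x' h
      obtain ⟨p, rfl⟩ := torusProj_surjective L x
      obtain ⟨p', rfl⟩ := torusProj_surjective L x'
      rw [hψ, hψ] at h
      choose m hm using b.exists_sub_eq_of_devMap_eq hε hε' v hL h
      exact torusProj_eq_iff.mpr ⟨m, funext fun k => by linarith [hm k]⟩
  range_eq := by
    rw [← hC, ← (torusProj_surjective L).range_comp ψ]
    exact congrArg Set.range (funext hψ)
  cubes z := by
    refine ⟨b.copyAt v z, (b.frameAt z).affineChart ε,
      (b.frameAt z).chart_image_unitCube hε hε', fun y hy x hx => ?_⟩
    refine (hψ (fun k => z k + y k)).trans ((b.devMap_add hε hε' v z ⟨y, hy⟩).trans ?_)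
    rw [cubePoint]
    congr 1
    exact Subtype.ext hx.symm

end Frame

/-! ### Rigidity of cubical identifications -/

lemma exists_sum_mul_eq (r : Fin 4 → ℝ) :
    ∃ y ∈ unitCube, ∑ j, r j * y j = (∑ j, |r j|) / 2 := by
  refine ⟨fun j => if 0 ≤ r j then 1 / 2 else -(1 / 2), fun j => ?_, ?_⟩
  · dsimp only
    split <;> norm_num [abs_of_pos, abs_neg]
  · rw [Finset.sum_div]
    refine Finset.sum_congr rfl fun j _ => ?_
    dsimp only
    split_ifs with h
    · rw [abs_of_nonneg h]; ring
    · rw [abs_of_neg (not_le.mp h)]; ring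

lemma abs_sum_mul_le (r : Fin 4 → ℝ) {y : Fin 4 → ℝ} (hy : y ∈ unitCube) :
    |∑ j, r j * y j| ≤ (∑ j, |r j|) / 2 := by
  refine (Finset.abs_sum_le_sum_abs _ _).trans ?_
  rw [Finset.sum_div]
  refine Finset.sum_le_sum fun j _ => ?_
  rw [abs_mul, div_eq_mul_one_div]
  exact mul_le_mul_of_nonneg_left (hy j) (abs_nonneg _)

lemma neg_mem_unitCube {y : Fin 4 → ℝ} (hy : y ∈ unitCube) : -y ∈ unitCube := fun j => by
  simpa using hy j

/-- Affine automorphisms of the cube permute the axes and reverse some of them. The rows of the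
linear part and those of its inverse have `ℓ¹`-norm at most `1`, which forces each row to be a
multiple of a unit vector. -/
lemma exists_signedPerm_of_image_unitCube (β : Fin 4 → ℝ) (M : Matrix (Fin 4) (Fin 4) ℝ)
    (h : (fun y => β + M.mulVec y) '' unitCube = unitCube) :
    ∃ (π : Equiv.Perm (Fin 4)) (η : Fin 4 → ℤˣ),
      ∀ y k, (β + M.mulVec y) k = ((η k : ℤ) : ℝ) * y (π k) := by
  have happ : ∀ y k, (β + M.mulVec y) k = β k + ∑ j, M k j * y j := fun y k => rfl
  have hmaps : ∀ y ∈ unitCube, ∀ k, |β k + ∑ j, M k j * y j| ≤ 1 / 2 := by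
    intro y hy k
    have h1 : β + M.mulVec y ∈ unitCube := h ▸ Set.mem_image_of_mem _ hy
    exact h1 k
  have hrow : ∀ k, β k = 0 ∧ ∑ j, |M k j| = 1 := by
    intro k
    obtain ⟨y, hy, hy'⟩ := exists_sum_mul_eq (M k)
    have h1 := (abs_le.mp (hmaps y hy k)).2
    have h2 := (abs_le.mp (hmaps (-y) (neg_mem_unitCube hy) k)).1
    simp only [Pi.neg_apply, mul_neg, Finset.sum_neg_distrib] at h2
    have hc : (fun _ => 1 / 2 : Fin 4 → ℝ) ∈ unitCube := fun j => by norm_num [abs_of_pos]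
    obtain ⟨u, hu, hu'⟩ : (fun _ => 1 / 2 : Fin 4 → ℝ) ∈ (fun y => β + M.mulVec y) '' unitCube :=
      h.symm ▸ hc
    obtain ⟨u', hu2, hu2'⟩ : -(fun _ => 1 / 2 : Fin 4 → ℝ) ∈
        (fun y => β + M.mulVec y) '' unitCube := h.symm ▸ neg_mem_unitCube hc
    have h3 := congrFun hu' k
    have h4 := congrFun hu2' k
    simp only [happ, Pi.neg_apply] at h3 h4
    have h5 := (abs_le.mp (abs_sum_mul_le (M k) hu)).2
    have h6 := (abs_le.mp (abs_sum_mul_le (M k) hu2)).1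
    rw [hy'] at h1 h2
    constructor <;> linarith
  have hβ : β = 0 := funext fun k => (hrow k).1
  subst hβ
  simp only [zero_add] at h ⊢
  have hsurj : Function.Surjective M.mulVec := by
    intro w
    obtain ⟨r, hr, hrw⟩ : ∃ r : ℝ, 0 < r ∧ ∀ k, |w k| ≤ r := by
      refine ⟨1 + ∑ k, |w k|, by positivity, fun k => ?_⟩
      have := Finset.single_le_sum (f := fun k => |w k|) (fun k _ => abs_nonneg _)
        (Finset.mem_univ k)
      linarith
    have h1 : (1 / (2 * r)) • w ∈ unitCube := by
      intro k
      rw [Pi.smul_apply, smul_eq_mul, abs_mul, abs_of_pos (by positivity)]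
      calc 1 / (2 * r) * |w k| ≤ 1 / (2 * r) * r :=
            mul_le_mul_of_nonneg_left (hrw k) (by positivity)
        _ = 1 / 2 := by field_simp
    rw [← h] at h1
    obtain ⟨y, -, hy⟩ := h1
    refine ⟨(2 * r) • y, ?_⟩
    simp only at hy
    rw [Matrix.mulVec_smul, hy, smul_smul]
    have : 2 * r * (1 / (2 * r)) = 1 := by field_simp
    rw [this, one_smul]
  have hunit : IsUnit M := Matrix.mulVec_surjective_iff_isUnit.mp hsurj
  obtain ⟨N, hMN, hNM⟩ := isUnit_iff_exists.mp hunit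
  have hN : ∀ j, ∑ k, |N j k| ≤ 1 := by
    intro j
    obtain ⟨w, hw, hw'⟩ := exists_sum_mul_eq (N j)
    rw [← h] at hw
    obtain ⟨y, hy, rfl⟩ := hw
    have h1 : N.mulVec (M.mulVec y) j = y j := by rw [Matrix.mulVec_mulVec, hNM, Matrix.one_mulVec]
    have h2 : N.mulVec (M.mulVec y) j = ∑ k, N j k * M.mulVec y k := rfl
    have h3 := (abs_le.mp (hy j)).2
    simp only at hw'
    linarith
  -- a nonzero entry of `M` at `(k, j)` forces the `j`-th row of `N` to be `±` the `k`-th unit vector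
  have hNabs : ∀ j k, |N j k| ≤ 1 := fun j k =>
    (Finset.single_le_sum (f := fun k => |N j k|) (fun k _ => abs_nonneg _)
      (Finset.mem_univ k)).trans (hN j)
  have hone : ∀ k j, M k j ≠ 0 → |N j k| = 1 := by
    intro k j hkj
    have h1 : ∑ j, M k j * N j k = 1 := by
      have := congrFun (congrFun hMN k) k
      rwa [Matrix.mul_apply, Matrix.one_apply_eq] at this
    have h2 : ∑ j, (|M k j| - M k j * N j k) = 0 := by
      rw [Finset.sum_sub_distrib, (hrow k).2, h1, sub_self]
    have h3 : ∀ j ∈ Finset.univ, 0 ≤ |M k j| - M k j * N j k := by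
      intro j _
      have : M k j * N j k ≤ |M k j| * 1 := (le_abs_self _).trans (by
        rw [abs_mul]; exact mul_le_mul_of_nonneg_left (hNabs j k) (abs_nonneg _))
      linarith
    have h4 := (Finset.sum_eq_zero_iff_of_nonneg h3).mp h2 j (Finset.mem_univ j)
    have h5 : |M k j| * 1 ≤ |M k j| * |N j k| := by
      rw [← abs_mul]
      linarith [le_abs_self (M k j * N j k)]
    exact le_antisymm (hNabs j k) (le_of_mul_le_mul_left h5 (abs_pos.mpr hkj))
  have hzero : ∀ k j, M k j ≠ 0 → ∀ l, l ≠ k → N j l = 0 := by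
    intro k j hkj l hl
    have h1 := hN j
    have h2 : |N j k| + |N j l| ≤ ∑ k, |N j k| := by
      rw [← Finset.sum_pair (f := fun m => |N j m|) hl.symm]
      exact Finset.sum_le_sum_of_subset_of_nonneg (Finset.subset_univ _)
        fun _ _ _ => abs_nonneg _
    rw [hone k j hkj] at h2
    exact abs_eq_zero.mp (le_antisymm (by linarith) (abs_nonneg _))
  have hex : ∀ k, ∃ j, M k j ≠ 0 := by
    intro k
    by_contra! hcon
    have := (hrow k).2
    simp [hcon] at this
  choose τ hτ using hex
  have hinj : Function.Injective τ := by
    intro k l hkl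
    by_contra hne
    have h1 := hzero k (τ k) (hτ k) l (Ne.symm hne)
    have h2 := hone l (τ l) (hτ l)
    rw [hkl] at h1
    rw [h1] at h2
    norm_num at h2
  have hentry : ∀ k l, N (τ k) k * M k l = if τ k = l then 1 else 0 := by
    intro k l
    have h1 := congrFun (congrFun hNM (τ k)) l
    rw [Matrix.mul_apply, Matrix.one_apply, Finset.sum_eq_single k] at h1
    · exact h1
    · intro j _ hj
      rw [hzero k _ (hτ k) j hj, zero_mul]
    · simp
  have hunits : ∀ k, ∃ η : ℤˣ, ((η : ℤ) : ℝ) = N (τ k) k := by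
    intro k
    rcases (abs_eq zero_le_one).mp (hone k _ (hτ k)) with h1 | h1
    · exact ⟨1, by simp [h1]⟩
    · exact ⟨-1, by simp [h1]⟩
  choose η hη using hunits
  refine ⟨Equiv.ofBijective τ (Finite.injective_iff_bijective.mp hinj), η, fun y k => ?_⟩
  have h1 : ∀ l, M k l = ((η k : ℤ) : ℝ) * if τ k = l then 1 else 0 := by
    intro l
    rw [← hentry k l, ← hη, ← mul_assoc, coe_units_mul_self, one_mul]
  change ∑ l, M k l * y l = _
  simp [h1]

lemma int_lattice_induction {P : (Fin 4 → ℤ) → Prop} (h0 : P 0)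
    (hstep : ∀ z k, P z ↔ P (z + Pi.single k 1)) (z : Fin 4 → ℤ) : P z := by
  have h1 : ∀ z k (n : ℤ), P z ↔ P (z + Pi.single k n) := by
    intro z k n
    induction n using Int.induction_on with
    | zero => simp
    | succ n ih => rw [ih, hstep _ k, add_assoc, ← Pi.single_add]
    | pred n ih =>
      have h := hstep (z + Pi.single k (-(n : ℤ) - 1) : Fin 4 → ℤ) k
      rw [add_assoc, ← Pi.single_add, sub_add_cancel] at h
      rw [ih, h]
  have h2 : ∀ S : Finset (Fin 4), P (∑ k ∈ S, Pi.single k (z k)) := by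
    intro S
    induction S using Finset.induction_on with
    | empty => simpa using h0
    | insert k S hk ih =>
      rw [Finset.sum_insert hk, add_comm]
      exact (h1 _ k (z k)).mp ih
  have h3 := h2 Finset.univ
  rwa [Finset.univ_sum_single] at h3

section Rigidity

variable {ε : ℝ} {q : IdealVertex}

lemma exists_frame_of_image (hε : 0 < ε) (A : (Fin 4 → ℝ) →ᵃ[ℝ] (Fin 5 → ℝ))
    (hε' : ε < 1 / 2) (hA : A '' unitCube = cubicFacet ε q) :
    ∃ b : Frame q, ∀ y ∈ unitCube, A y = b.chart ε y := by
  obtain ⟨b⟩ := Frame.exists_frame q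
  set β : Fin 4 → ℝ := fun k => cubeCoord ε (b.vec k) (A 0)
  set M : Matrix (Fin 4) (Fin 4) ℝ := fun k j =>
    dot (b.vec k) (A.linear (Pi.single j 1)) / (2 * ε)
  have hB : ∀ y, (fun k => cubeCoord ε (b.vec k) (A y)) = β + M.mulVec y := by
    intro y
    ext k
    have h1 : A y = ∑ j, y j • A.linear (Pi.single j 1) + A 0 := by
      have h2 := A.map_vadd 0 y
      simp only [vadd_eq_add, add_zero] at h2
      rw [h2]
      congr 1
      rw [LinearMap.pi_apply_eq_sum_univ A.linear y]
      refine Finset.sum_congr rfl fun j _ => ?_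
      congr 2
      ext l
      simp [Pi.single_apply, eq_comm]
    have h2 : ∀ x x' : Fin 5 → ℝ, dot (b.vec k) (x + x') = dot (b.vec k) x + dot (b.vec k) x' := by
      intro x x'
      simp [dot, mul_add, Finset.sum_add_distrib]
    change _ = cubeCoord ε (b.vec k) (A 0) +
      ∑ j, dot (b.vec k) (A.linear (Pi.single j 1)) / (2 * ε) * y j
    rw [h1, cubeCoord, cubeCoord, h2, dot_sum]
    have h3 : ∑ j, dot (b.vec k) (A.linear (Pi.single j 1)) / (2 * ε) * y j =
        (∑ j, y j * dot (b.vec k) (A.linear (Pi.single j 1))) / (2 * ε) := by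
      rw [Finset.sum_div]
      exact Finset.sum_congr rfl fun j _ => by ring
    rw [h3]
    ring
  have himage : (fun y => β + M.mulVec y) '' unitCube = unitCube := by
    ext w
    constructor
    · rintro ⟨y, hy, rfl⟩
      have h1 : A y ∈ cubicFacet ε q := hA ▸ Set.mem_image_of_mem _ hy
      obtain ⟨u, hu, hu'⟩ := b.exists_chart_eq hε h1
      simp only [← hB, ← hu', b.cubeCoord_chart hε]
      exact hu
    · intro hw
      have h1 : b.chart ε w ∈ A '' unitCube := hA ▸ b.chart_mem_cubicFacet hε hε' hw
      obtain ⟨y, hy, hy'⟩ := h1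
      refine ⟨y, hy, ?_⟩
      simp only [← hB, hy', b.cubeCoord_chart hε]
  obtain ⟨π, η, hπ⟩ := exists_signedPerm_of_image_unitCube β M himage
  have hopp : ∀ a a' : Facet, opp q.1 a = a' ↔ a = opp q.1 a' := fun a a' =>
    ⟨fun h => by rw [← h, opp_opp], fun h => by rw [h, opp_opp]⟩
  refine ⟨⟨fun l => if η (π.symm l) = 1 then b.vec (π.symm l) else opp q.1 (b.vec (π.symm l)),
    fun l => ?_, fun k l hkl => ?_⟩, fun y hy => ?_⟩
  · split
    · exact b.vec_apply _
    · exact b.opp_apply _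
  · have h1 := b.independent (π.symm k) (π.symm l) (π.symm.injective.ne hkl)
    split_ifs <;> simp [hopp, opp_opp, h1]
  · have h1 : A y ∈ cubicFacet ε q := hA ▸ Set.mem_image_of_mem _ hy
    rw [← b.chart_cubeCoord hε h1.2, hB]
    ext j
    by_cases hj : j = q.1
    · subst hj
      rw [Frame.chart_apply_self, Frame.chart_apply_self]
    · rw [Frame.chart_apply_ne _ _ _ hj, Frame.chart_apply_ne _ _ _ hj]
      congr 1
      refine Eq.trans ?_ (Equiv.sum_comp π _)
      refine Finset.sum_congr rfl fun k _ => ?_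
      rw [hπ]
      simp only [Equiv.symm_apply_apply]
      rcases Int.units_eq_one_or (η k) with h2 | h2
      · simp [h2]
      · rw [if_neg (by rw [h2]; decide), opp_apply_ne hj, h2]
        push_cast
        ring

/-- Facets that contain the centre of a face of codimension one of the cube. -/
lemma Frame.eq_vec_of_dot_eq_one (hε : 0 < ε) (hε' : ε < 1 / 2) (b : Frame q) {k : Fin 4}
    {a : Facet} (hmem : Pi.single k (1 / 2) ∈ unitCube)
    (ha : dot a (b.chart ε (Pi.single k (1 / 2))) = 1) : a = b.vec k := by
  have h1 := apply_eq_of_dot_eq_one hε hε' (b.chart_mem_cubicFacet hε hε' hmem) ha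
  have h2 := (cubeCoord_eq_half_iff hε).mpr ha
  obtain ⟨l, rfl | rfl⟩ := b.exists_eq_or_eq_opp h1
  · rw [b.cubeCoord_chart hε] at h2
    by_cases hlk : l = k
    · rw [hlk]
    · norm_num [hlk] at h2
  · rw [cubeCoord_opp hε (by rw [b.vec_apply, mul_chart_apply_self]), b.cubeCoord_chart hε] at h2
    by_cases hlk : l = k
    · subst hlk
      norm_num at h2
    · norm_num [hlk] at h2

/-- A cubical identification is the developing map of its restriction to a single cube: the
parametrizations of adjacent cubes agree on their common face, so that they differ by a reflection,
and they lie in different copies of the polytope by injectivity. -/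
theorem IsCubicalIdentification.exists_devMap_eq (hε : 0 < ε) (hε' : ε < 1 / 2)
    {C : Set (Manifold ε)} {L : ℕ} (hL : IsPeriod q L) {ψ : Torus L → Manifold ε}
    (h : IsCubicalIdentification ε q C L ψ) :
    ∃ (b : Frame q) (v : Fin 8 → ZMod 2), ∀ p, ψ (torusProj L p) = b.devMap hε hε' v p := by
  choose v A hA hψA using h.cubes
  choose b hb using fun z => exists_frame_of_image hε (A z) hε' (hA z)
  have hψ : ∀ (z : Fin 4 → ℤ) (y : Fin 4 → ℝ) (hy : y ∈ unitCube),
      ψ (torusProj L fun k => z k + y k) =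
        Manifold.mk (v z) ⟨(b z).chart ε y, ((b z).chart_mem_cubicFacet hε hε' hy).1⟩ :=
    fun z y hy => hψA z y hy _ (hb z y hy).symm
  have hshift : ∀ (z : Fin 4 → ℤ) (k : Fin 4) (y : Fin 4 → ℝ), y k = 1 / 2 →
      (fun l => (((z + Pi.single k 1 : Fin 4 → ℤ) l : ℤ) : ℝ) +
        Function.update y k (-(1 / 2)) l) = fun l => (z l : ℝ) + y l := by
    intro z k y hy
    ext l
    by_cases hl : l = k
    · subst hl
      simp only [Pi.add_apply, Pi.single_eq_same, Function.update_self, hy]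
      push_cast
      ring
    · simp [hl]
  have hupd : ∀ (k : Fin 4) (y : Fin 4 → ℝ), y ∈ unitCube →
      Function.update y k (-(1 / 2)) ∈ unitCube := by
    intro k y hy l
    by_cases hl : l = k
    · subst hl; norm_num [abs_of_pos, abs_neg]
    · simpa [hl] using hy l
  have hface : ∀ (z : Fin 4 → ℤ) (k : Fin 4) (y : Fin 4 → ℝ) (hy : y ∈ unitCube), y k = 1 / 2 →
      (b z).chart ε y = (b (z + Pi.single k 1)).chart ε (Function.update y k (-(1 / 2))) ∧
      ∀ c, v z c ≠ v (z + Pi.single k 1) c →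
        ∃ a, dot a ((b z).chart ε y) = 1 ∧ colour a = c := by
    intro z k y hy hyk
    have h1 := hψ z y hy
    have h2 := hψ (z + Pi.single k 1) _ (hupd k y hy)
    rw [hshift z k y hyk, h1] at h2
    obtain ⟨h3, h4⟩ := Manifold.mk_eq_mk_iff.mp h2
    exact ⟨Subtype.ext_iff.mp h3, h4⟩
  have hmem1 : ∀ k : Fin 4, (Pi.single k (1 / 2) : Fin 4 → ℝ) ∈ unitCube := by
    intro k l
    by_cases hl : l = k
    · subst hl; norm_num [abs_of_pos]
    · norm_num [hl]
  have hmem2 : ∀ k l : Fin 4, l ≠ k →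
      (Pi.single k (1 / 2) + Pi.single l (1 / 2) : Fin 4 → ℝ) ∈ unitCube := by
    intro k l hkl m
    by_cases hm : m = k
    · subst hm; norm_num [hkl.symm, abs_of_pos]
    · by_cases hm' : m = l
      · subst hm'; norm_num [hkl, abs_of_pos]
      · norm_num [hm, hm']
  have hupd1 : ∀ k : Fin 4, Function.update (Pi.single k (1 / 2) : Fin 4 → ℝ) k (-(1 / 2)) =
      Pi.single k (-(1 / 2)) := fun k => by simp [Pi.single]
  have hsum1 : ∀ (f : Frame q) (k : Fin 4) (r : ℝ) (j : Fin 5),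
      ∑ l, (Pi.single k r : Fin 4 → ℝ) l * (((f.vec l).1 j : ℤ) : ℝ) =
        r * (((f.vec k).1 j : ℤ) : ℝ) := by
    intro f k r j
    simp [Pi.single_apply]
  have hvec1 : ∀ z k, (b (z + Pi.single k 1)).vec k = opp q.1 ((b z).vec k) := by
    intro z k
    refine Subtype.ext (funext fun j => ?_)
    by_cases hj : j = q.1
    · subst hj
      rw [Frame.vec_apply, Frame.opp_apply]
    · have h1 := congrFun (hface z k _ (hmem1 k) (by simp)).1 j
      rw [hupd1, Frame.chart_apply_ne _ _ _ hj, Frame.chart_apply_ne _ _ _ hj, hsum1, hsum1] at h1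
      have h2 := mul_left_cancel₀ (by positivity) h1
      rw [opp_apply_ne hj]
      have h3 : ((((b (z + Pi.single k 1)).vec k).1 j : ℤ) : ℝ) =
          ((-((b z).vec k).1 j : ℤˣ) : ℤ) := by
        push_cast
        linarith
      exact Units.ext (by exact_mod_cast h3)
  have hvec2 : ∀ z k l, l ≠ k → (b (z + Pi.single k 1)).vec l = (b z).vec l := by
    intro z k l hkl
    refine Subtype.ext (funext fun j => ?_)
    by_cases hj : j = q.1
    · subst hj
      rw [Frame.vec_apply, Frame.vec_apply]
    · have h1 := congrFun (hface z k _ (hmem1 k) (by simp)).1 j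
      have h2 := congrFun (hface z k _ (hmem2 k l hkl) (by simp [hkl.symm])).1 j
      have hupd2 : Function.update (Pi.single k (1 / 2) + Pi.single l (1 / 2) : Fin 4 → ℝ) k
          (-(1 / 2)) = Pi.single k (-(1 / 2)) + Pi.single l (1 / 2) := by
        ext m
        by_cases hm : m = k
        · subst hm; simp [hkl.symm]
        · simp [hm]
      rw [hupd1, Frame.chart_apply_ne _ _ _ hj, Frame.chart_apply_ne _ _ _ hj, hsum1, hsum1] at h1
      rw [hupd2, Frame.chart_apply_ne _ _ _ hj, Frame.chart_apply_ne _ _ _ hj] at h2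
      simp only [Pi.add_apply, add_mul, Finset.sum_add_distrib, hsum1] at h2
      have h3 := mul_left_cancel₀ (by positivity) h1
      have h4 := mul_left_cancel₀ (by positivity) h2
      have h5 : ((((b (z + Pi.single k 1)).vec l).1 j : ℤ) : ℝ) = (((b z).vec l).1 j : ℤ) := by
        linarith
      exact Units.ext (by exact_mod_cast h5)
  have hcopy : ∀ z k, v (z + Pi.single k 1) = v z + Pi.single (colour ((b z).vec k)) 1 := by
    intro z k
    have h1 := (hface z k _ (hmem1 k) (by simp)).2
    have h2 : ∀ c, c ≠ colour ((b z).vec k) → v z c = v (z + Pi.single k 1) c := by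
      intro c hc
      by_contra hne
      obtain ⟨a, ha, rfl⟩ := h1 c hne
      exact hc (by rw [(b z).eq_vec_of_dot_eq_one hε hε' (hmem1 k) ha])
    have h3 : v z (colour ((b z).vec k)) ≠ v (z + Pi.single k 1) (colour ((b z).vec k)) := by
      intro heq
      have hv : v z = v (z + Pi.single k 1) := by
        ext c
        by_cases hc : c = colour ((b z).vec k)
        · rw [hc, heq]
        · rw [h2 c hc]
      have h0 : (0 : Fin 4 → ℝ) ∈ unitCube := fun l => by norm_num
      have hcentre : ∀ f f' : Frame q, f.chart ε 0 = f'.chart ε 0 := by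
        intro f f'
        ext j
        by_cases hj : j = q.1
        · subst hj; rw [Frame.chart_apply_self, Frame.chart_apply_self]
        · rw [Frame.chart_apply_ne _ _ _ hj, Frame.chart_apply_ne _ _ _ hj]; simp
      have h4 : ψ (torusProj L fun l => z l + (0 : Fin 4 → ℝ) l) =
          ψ (torusProj L fun l => (z + Pi.single k 1 : Fin 4 → ℤ) l + (0 : Fin 4 → ℝ) l) := by
        rw [hψ z 0 h0, hψ _ 0 h0]
        exact Manifold.mk_eq_mk_iff.mpr
          ⟨Subtype.ext (hcentre _ _), fun c hc => absurd (by rw [hv]) hc⟩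
      obtain ⟨m, hm⟩ := torusProj_eq_iff.mp (h.isEmbedding.injective h4)
      have h5 := congrFun hm k
      simp only [Pi.zero_apply, Pi.add_apply, Pi.single_eq_same] at h5
      push_cast at h5
      have h6 : (L : ℤ) * m k = -1 := by
        have : (L : ℝ) * m k = -1 := by linarith
        exact_mod_cast this
      have h7 : (L : ℤ) ∣ 1 := ⟨-m k, by linarith⟩
      rcases hL with ⟨_, rfl⟩ | ⟨_, rfl⟩ <;> norm_num at h7
    ext c
    have hz : ∀ m n : ZMod 2, m ≠ n → n = m + 1 := by decide
    by_cases hc : c = colour ((b z).vec k)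
    · subst hc
      simpa using hz _ _ h3
    · simp [hc, h2 c hc]
  have hall : ∀ z, v z = (b 0).copyAt (v 0) z ∧ b z = (b 0).frameAt z := by
    refine int_lattice_induction ⟨((b 0).copyAt_zero _).symm, ?_⟩ fun z k => ⟨?_, ?_⟩
    · ext k
      simp [Frame.frameAt_vec]
    · rintro ⟨h1, h2⟩
      refine ⟨?_, ?_⟩
      · rw [hcopy, Frame.copyAt_add_single, h1, h2]
      · ext1
        ext1 l
        by_cases hl : l = k
        · subst hl
          rw [hvec1, Frame.frameAt_add_single_self, h2]
        · rw [hvec2 z k l hl, Frame.frameAt_add_single_of_ne _ _ hl, h2]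
    · rintro ⟨h1, h2⟩
      have h3 : b z = (b 0).frameAt z := by
        ext1
        ext1 l
        by_cases hl : l = k
        · subst hl
          apply opp_injective q.1
          rw [← hvec1, h2, Frame.frameAt_add_single_self]
        · rw [← hvec2 z k l hl, h2, Frame.frameAt_add_single_of_ne _ _ hl]
      refine ⟨?_, h3⟩
      rw [hcopy, Frame.copyAt_add_single, h3] at h1
      exact add_right_cancel h1
  refine ⟨b 0, v 0, fun p => ?_⟩
  have hp : p = fun k => (((fun k => round (p k)) : Fin 4 → ℤ) k : ℝ) + (p k - round (p k)) := by
    ext k; simp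
  obtain ⟨h1, h2⟩ := hall fun k => round (p k)
  conv_lhs => rw [hp]
  rw [hψ _ _ (sub_round_mem p), Frame.devMap, Frame.cubePoint, h1]
  congr 1
  exact Subtype.ext (by rw [h2])

end Rigidity

/-! ### The heights in a frame -/

/-- A sum over pairs of partners does not depend on the choice of the representatives. -/
lemma two_mul_sum_filter {g : Facet → ℝ} (hg : ∀ a, g (partner a) = g a) (r : Facet → Prop)
    [DecidablePred r] (hr : ∀ a, g a ≠ 0 → (r (partner a) ↔ ¬ r a)) :
    2 * ∑ a with r a, g a = ∑ a, g a := by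
  have h1 : ∑ a with ¬ r a, g a = ∑ a with r a, g a := by
    rw [Finset.sum_filter, Finset.sum_filter,
      ← Equiv.sum_comp (Function.Involutive.toPerm partner partner_partner)]
    refine Finset.sum_congr rfl fun a _ => ?_
    change (if ¬ r (partner a) then g (partner a) else 0) = if r a then g a else 0
    rw [hg]
    by_cases h0 : g a = 0
    · simp [h0]
    · simp only [hr a h0, not_not]
  rw [two_mul]
  nth_rewrite 2 [← h1]
  exact Finset.sum_filter_add_sum_filter_not _ _ _

lemma sum_filter_eq_sum_filter {g : Facet → ℝ} (hg : ∀ a, g (partner a) = g a)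
    (r r' : Facet → Prop) [DecidablePred r] [DecidablePred r']
    (hr : ∀ a, g a ≠ 0 → (r (partner a) ↔ ¬ r a))
    (hr' : ∀ a, g a ≠ 0 → (r' (partner a) ↔ ¬ r' a)) :
    ∑ a with r a, g a = ∑ a with r' a, g a := by
  linarith [two_mul_sum_filter hg r hr, two_mul_sum_filter hg r' hr']

lemma neg_eq_iff_ne (u w : ℤˣ) : -u = w ↔ ¬ u = w := by
  rw [← ne_eq, Int.units_ne_iff_eq_neg, neg_eq_iff_eq_neg]

lemma partner_apply_eq_iff_ne {i : Fin 5} {a : Facet} (h : (partner a).1 i ≠ a.1 i) (w : ℤˣ) :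
    (partner a).1 i = w ↔ ¬ a.1 i = w := by
  rw [Int.units_ne_iff_eq_neg.mp h, neg_eq_iff_ne]

section Heights

variable {ε : ℝ} {q : IdealVertex} {s : State}

lemma pairCoord_of_partner_ne (hε : 0 < ε) (hε' : ε < 1 / 2) {x : Fin 5 → ℝ}
    (hx : x ∈ cubicFacet ε q) {a : Facet} (h : (partner a).1 q.1 ≠ q.2) :
    pairCoord ε a x = max 0 (cubeCoord ε a x) := by
  have h1 := cubeCoord_neg hε hε' hx h
  rw [pairCoord, ← max_assoc, max_eq_left (h1.le.trans (le_max_left _ _))]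

lemma pairCoord_eq_zero_of_ne (hε : 0 < ε) (hε' : ε < 1 / 2) {x : Fin 5 → ℝ}
    (hx : x ∈ cubicFacet ε q) {a : Facet} (h : a.1 q.1 ≠ q.2) (h' : (partner a).1 q.1 ≠ q.2) :
    pairCoord ε a x = 0 :=
  max_eq_left (max_le (cubeCoord_neg hε hε' hx h).le (cubeCoord_neg hε hε' hx h').le)

/-- The contributions of the two ends of an axis add up to a linear function when the ends belong
to the same quartet, since then they have opposite statuses. -/
lemma pairCoord_add_opp (hε : 0 < ε) (hε' : ε < 1 / 2) (hs : IsBalanced s) (v : Fin 8 → ZMod 2)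
    (b : Frame q) {y : Fin 4 → ℝ} (hy : y ∈ unitCube) (k : Fin 4)
    (hmove : moveOf (colour (opp q.1 (b.vec k))) = moveOf (colour (b.vec k)))
    (hp : (partner (b.vec k)).1 q.1 ≠ q.2) (hp' : (partner (opp q.1 (b.vec k))).1 q.1 ≠ q.2) :
    ((stateAt s v (b.vec k) : ℤ) : ℝ) * pairCoord ε (b.vec k) (b.chart ε y) +
      ((stateAt s v (opp q.1 (b.vec k)) : ℤ) : ℝ) *
        pairCoord ε (opp q.1 (b.vec k)) (b.chart ε y) =
      ((stateAt s v (b.vec k) : ℤ) : ℝ) * y k := by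
  have hx := b.chart_mem_cubicFacet hε hε' hy
  rw [pairCoord_of_partner_ne hε hε' hx hp, pairCoord_of_partner_ne hε hε' hx hp',
    hs.stateAt_opp v hmove, cubeCoord_opp hε (by rw [b.vec_apply, b.mul_chart_apply_self]),
    b.cubeCoord_chart hε]
  push_cast
  rcases le_total 0 (y k) with h | h
  · rw [max_eq_right h, max_eq_left (by linarith)]; ring
  · rw [max_eq_left h, max_eq_right (by linarith)]; ring

lemma diagonalHeight_small (hε : 0 < ε) (hε' : ε < 1 / 2) (hs : IsBalanced s)
    (v : Fin 8 → ZMod 2) (hq : q.1 = 4) (b : Frame q) {y : Fin 4 → ℝ} (hy : y ∈ unitCube) :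
    diagonalHeight ε s v (b.chart ε y) = ∑ k, ((stateAt s v (b.vec k) : ℤ) : ℝ) * y k := by
  have hflip : ∀ a, (partner a).1 q.1 ≠ a.1 q.1 := by
    intro a
    rw [hq, partner_apply_four]
    exact (units_ne_neg_self _).symm
  rw [diagonalHeight, sum_filter_eq_sum_filter
    (fun a => by rw [hs.stateAt_partner, pairCoord_partner]) (fun a => a.1 4 = 1)
    (fun a => a.1 q.1 = q.2) (fun a _ => partner_apply_four_eq_one_iff a)
    (fun a _ => partner_apply_eq_iff_ne (hflip a) _), b.sum_meeting]
  refine Finset.sum_congr rfl fun k _ => ?_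
  refine pairCoord_add_opp hε hε' hs v b hy k (by rw [hq, colour_opp_four]) ?_ ?_
  · rw [← b.vec_apply k]; exact hflip _
  · rw [← b.opp_apply k]; exact hflip _

/-- Representatives of the pairs of partners that meet the cubic facet at `q` in adjacent faces. -/
def sidePairs (q : IdealVertex) : Finset Facet :=
  Finset.univ.filter fun a => (a.1 4 = 1 ∧ moveOf (colour a) ≠ (q.1 : ℕ)) ∧ a.1 q.1 = q.2

lemma diagonalHeight_large (hε : 0 < ε) (hε' : ε < 1 / 2) (hs : IsBalanced s)
    (v : Fin 8 → ZMod 2) (hq : q.1 ≠ 4) (b : Frame q) {k : Fin 4}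
    (hk : moveOf (colour (b.vec k)) = (q.1 : ℕ)) {y : Fin 4 → ℝ} (hy : y ∈ unitCube) :
    diagonalHeight ε s v (b.chart ε y) = ((stateAt s v (b.vec k) : ℤ) : ℝ) * y k +
      ∑ a ∈ sidePairs q, ((stateAt s v a : ℤ) : ℝ) * pairCoord ε a (b.chart ε y) := by
  set g : Facet → ℝ := fun a => ((stateAt s v a : ℤ) : ℝ) * pairCoord ε a (b.chart ε y) with hg
  have hgp : ∀ a, g (partner a) = g a := fun a => by
    simp only [hg, hs.stateAt_partner, pairCoord_partner]
  have hx := b.chart_mem_cubicFacet hε hε' hy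
  have hflip : ∀ a, moveOf (colour a) = (q.1 : ℕ) → (partner a).1 q.1 ≠ a.1 q.1 := fun a ha h =>
    (partner_apply_eq_iff hq a).mp h ha
  have hside : ∑ a with a.1 4 = 1 ∧ moveOf (colour a) ≠ (q.1 : ℕ), g a =
      ∑ a ∈ sidePairs q, g a := by
    have h : sidePairs q = (Finset.univ.filter fun a : Facet =>
        a.1 4 = 1 ∧ moveOf (colour a) ≠ (q.1 : ℕ)).filter fun a => a.1 q.1 = q.2 :=
      (Finset.filter_filter _ _ _).symm
    rw [h]
    refine (Finset.sum_filter_of_ne fun a ha hga => ?_).symm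
    by_contra hne
    have h1 := (Finset.mem_filter.mp ha).2.2
    refine hga ?_
    simp only [hg]
    rw [pairCoord_eq_zero_of_ne hε hε' hx hne, mul_zero]
    rwa [(partner_apply_eq_iff hq a).mpr h1]
  have haxis : ∑ a with a.1 4 = 1, (if moveOf (colour a) = (q.1 : ℕ) then g a else 0) =
      ((stateAt s v (b.vec k) : ℤ) : ℝ) * y k := by
    have hne : ∀ {a : Facet}, (if moveOf (colour a) = (q.1 : ℕ) then g a else 0) ≠ 0 →
        moveOf (colour a) = (q.1 : ℕ) := fun h => by
      by_contra hcon
      exact h (if_neg hcon)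
    rw [sum_filter_eq_sum_filter (fun a => by rw [move_partner, hgp]) (fun a => a.1 4 = 1)
      (fun a => a.1 q.1 = q.2) (fun a _ => partner_apply_four_eq_one_iff a)
      (fun a ha => partner_apply_eq_iff_ne (hflip a (hne ha)) _), b.sum_meeting,
      Finset.sum_eq_single k]
    · have hk' := move_opp q.1 _ hk
      rw [if_pos hk, if_pos hk']
      refine pairCoord_add_opp hε hε' hs v b hy k (by rw [hk, hk']) ?_ ?_
      · have := hflip _ hk; rwa [b.vec_apply] at this
      · have := hflip _ hk'; rwa [b.opp_apply] at this
    · intro l _ hl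
      have h1 := b.independent k l hl.symm
      have h2 : moveOf (colour (b.vec l)) ≠ (q.1 : ℕ) := fun h => by
        rcases eq_or_eq_opp_of_move_eq q.1 _ _ (by rw [b.vec_apply, b.vec_apply]) hk h with h | h
        · exact h1.1 h
        · exact h1.2 h
      have h3 : moveOf (colour (opp q.1 (b.vec l))) ≠ (q.1 : ℕ) := fun h => h2 (by
        simpa only [opp_opp] using move_opp q.1 _ h)
      rw [if_neg h2, if_neg h3, add_zero]
    · simp
  rw [diagonalHeight, ← haxis, ← hside, ← Finset.sum_filter, Finset.filter_filter,
    ← Finset.filter_filter, ← Finset.filter_filter, Finset.sum_filter_add_sum_filter_not]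

lemma mem_quartet : ∀ i : Fin 5, i = 4 → ∀ a b, moveOf (colour b) = moveOf (colour a) →
    (b = a ∨ b = partner a) ∨ (b = opp i a ∨ b = partner (opp i a)) := by
  decide +kernel

lemma quartetCoord_eq_half (hε : 0 < ε) {x : Fin 5 → ℝ} (hx : x ∈ truncatedPolytope ε)
    {a b : Facet} (hb : dot b x = 1) (h : moveOf (colour b) = moveOf (colour a)) :
    max (pairCoord ε a x) (pairCoord ε (opp 4 a) x) = 1 / 2 := by
  refine le_antisymm (max_le (pairCoord_le_half hε hx a) (pairCoord_le_half hε hx _)) ?_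
  rcases mem_quartet 4 rfl a b h with h | h
  · exact (pairCoord_eq_half hε hx hb h).symm.le.trans (le_max_left _ _)
  · exact (pairCoord_eq_half hε hx hb h).symm.le.trans (le_max_right _ _)

/-- A real-valued function on the whole manifold which, above `q`, is up to sign and a constant the
contribution of the quartets other than that of the move of `q` to the diagonal map. It is compatible
with the gluing because a summand vanishes on the facets of its quartet. -/
def sideHeight (hε : 0 < ε) (s : State) (q : IdealVertex) : Manifold ε → ℝ :=
  Quot.lift (fun p => ∑ a ∈ sidePairs q, ((stateAt s p.1 a : ℤ) : ℝ) *
    (1 / 2 - max (pairCoord ε a p.2.1) (pairCoord ε (opp 4 a) p.2.1))) fun p r h => by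
      obtain ⟨h1, b, hb, h2⟩ := h
      rw [← h1, h2]
      refine Finset.sum_congr rfl fun a _ => ?_
      rw [stateAt_add_single]
      by_cases hab : moveOf (colour b) = moveOf (colour a)
      · rw [quartetCoord_eq_half hε p.2.2 hb hab, sub_self, mul_zero, mul_zero]
      · rw [if_neg hab]

lemma continuous_sideHeight (hε : 0 < ε) (s : State) (q : IdealVertex) :
    Continuous (sideHeight hε s q) :=
  continuous_manifold_lift (g := fun v x => ∑ a ∈ sidePairs q, ((stateAt s v a : ℤ) : ℝ) *
    (1 / 2 - max (pairCoord ε a x.1) (pairCoord ε (opp 4 a) x.1)))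
    (fun v => by unfold pairCoord; fun_prop) _

lemma partner_mem_of_mem_sidePairs (hq : q.1 ≠ 4) {a : Facet} (ha : a ∈ sidePairs q) :
    (partner a).1 q.1 = q.2 := by
  obtain ⟨-, ⟨-, h1⟩, h2⟩ := Finset.mem_filter.mp ha
  rw [(partner_apply_eq_iff hq a).mpr h1, h2]

lemma sideHeight_mk (hε : 0 < ε) (hε' : ε < 1 / 2) (s : State) (hq : q.1 ≠ 4)
    (v : Fin 8 → ZMod 2) {x : truncatedPolytope ε} (hx : x.1 ∈ cubicFacet ε q) :
    sideHeight hε s q (Manifold.mk v x) = ∑ a ∈ sidePairs q,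
      ((stateAt s v a : ℤ) : ℝ) * (1 / 2 - pairCoord ε a x.1) := by
  refine Finset.sum_congr rfl fun a ha => ?_
  obtain ⟨-, ⟨-, h1⟩, h2⟩ := Finset.mem_filter.mp ha
  have h3 : (opp 4 a).1 q.1 ≠ q.2 := by
    rw [opp_apply_ne hq, h2]
    exact (units_ne_neg_self _).symm
  have h4 : moveOf (colour (opp 4 a)) ≠ (q.1 : ℕ) := by rwa [colour_opp_four]
  have h5 : (partner (opp 4 a)).1 q.1 ≠ q.2 := by
    rwa [(partner_apply_eq_iff hq _).mpr h4]
  congr 2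
  change max (pairCoord ε a x.1) (pairCoord ε (opp 4 a) x.1) = _
  rw [pairCoord_eq_zero_of_ne hε hε' hx h3 h5]
  exact max_eq_left (le_max_left _ _)

lemma coe_sum_sidePairs_half (v : Fin 8 → ZMod 2) :
    ((∑ a ∈ sidePairs q, ((stateAt s v a : ℤ) : ℝ) * (1 / 2) : ℝ) : AddCircle (1 : ℝ)) =
      ((∑ _a ∈ sidePairs q, (1 / 2 : ℝ) : ℝ) : AddCircle (1 : ℝ)) := by
  refine coe_sum_congr _ fun a _ => ?_
  rcases Int.units_eq_one_or (stateAt s v a) with h | h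
  · simp [h]
  · rw [h, coe_neg_half_eq]; simp

lemma stateAt_congr {v v' : Fin 8 → ZMod 2} {a : Facet}
    (h : ∀ c, moveOf c = moveOf (colour a) → v c = v' c) : stateAt s v a = stateAt s v' a := by
  have h1 : ∑ i with moveOf i = moveOf (colour a), v i =
      ∑ i with moveOf i = moveOf (colour a), v' i :=
    Finset.sum_congr rfl fun c hc => h c (Finset.mem_filter.mp hc).2
  simp only [stateAt, h1]

namespace Frame

variable (b : Frame q)

/-- Along an axis whose two ends belong to the same quartet, all edges are oriented coherently. -/
lemma stateAt_copyAt (hs : IsBalanced s) (v : Fin 8 → ZMod 2) {k : Fin 4}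
    (h1 : ∀ z, moveOf (colour (opp q.1 ((b.frameAt z).vec k))) =
      moveOf (colour ((b.frameAt z).vec k)))
    (h2 : ∀ z l, l ≠ k → moveOf (colour ((b.frameAt z).vec l)) ≠
      moveOf (colour ((b.frameAt z).vec k))) (z : Fin 4 → ℤ) :
    stateAt s (b.copyAt v z) ((b.frameAt z).vec k) = stateAt s v (b.vec k) := by
  induction z using int_lattice_induction with
  | h0 => simp [copyAt_zero, frameAt_vec]
  | hstep z l =>
    rw [copyAt_add_single, stateAt_add_single]
    by_cases hl : l = k
    · subst hl
      rw [frameAt_add_single_self, if_pos (h1 z).symm, hs.stateAt_opp _ (h1 z), neg_neg]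
    · rw [frameAt_add_single_of_ne _ _ (Ne.symm hl), if_neg (h2 z l hl)]

lemma exists_axis (hq : q.1 ≠ 4) : ∃ k, moveOf (colour (b.vec k)) = (q.1 : ℕ) := by
  obtain ⟨a, ha, hm⟩ := exists_move_eq q.1 hq q.2
  obtain ⟨k, rfl | rfl⟩ := b.exists_eq_or_eq_opp ha
  · exact ⟨k, hm⟩
  · exact ⟨k, by simpa only [opp_opp] using move_opp q.1 _ hm⟩

lemma diagonalMap_devMap_small (hε : 0 < ε) (hε' : ε < 1 / 2) (hs : IsBalanced s)
    (v : Fin 8 → ZMod 2) (hq : q.1 = 4) (p : Fin 4 → ℝ) :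
    diagonalMap ε s (b.devMap hε hε' v p) =
      ((∑ k, ((stateAt s v (b.vec k) : ℤ) : ℝ) * p k : ℝ) : AddCircle (1 : ℝ)) := by
  have hmem := (b.frameAt fun k => round (p k)).chart_mem_cubicFacet hε hε' (sub_round_mem p)
  rw [devMap, cubePoint, diagonalMap_mk hε hε' hs _ hmem,
    diagonalHeight_small hε hε' hs _ hq _ (sub_round_mem p)]
  refine coe_sum_congr _ fun k _ => ?_
  rw [b.stateAt_copyAt hs v (fun z => by rw [hq, colour_opp_four]) (fun z l hl h => ?_)]
  · refine coe_eq_coe_of_sub_eq_intCast (-(stateAt s v (b.vec k) * round (p k))) ?_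
    push_cast
    ring
  · have h1 := (b.frameAt z).independent k l hl.symm
    rcases eq_or_eq_opp_of_move_eq_four q.1 hq _ _ (by rw [vec_apply, vec_apply]) h.symm with h | h
    · exact h1.1 h
    · exact h1.2 h

lemma diagonalMap_devMap_large (hε : 0 < ε) (hε' : ε < 1 / 2) (hs : IsBalanced s)
    (v : Fin 8 → ZMod 2) (hq : q.1 ≠ 4) {k : Fin 4}
    (hk : moveOf (colour (b.vec k)) = (q.1 : ℕ)) (p : Fin 4 → ℝ) :
    diagonalMap ε s (b.devMap hε hε' v p) =
      ((((stateAt s v (b.vec k) : ℤ) : ℝ) * p k : ℝ) : AddCircle (1 : ℝ)) +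
      (((∑ _a ∈ sidePairs q, (1 / 2 : ℝ)) - sideHeight hε s q (b.devMap hε hε' v p) : ℝ) :
        AddCircle (1 : ℝ)) := by
  have hkz : ∀ z, moveOf (colour ((b.frameAt z).vec k)) = (q.1 : ℕ) := by
    intro z
    rw [frameAt_vec]
    split
    · exact hk
    · exact move_opp q.1 _ hk
  have hmem := (b.frameAt fun k => round (p k)).chart_mem_cubicFacet hε hε' (sub_round_mem p)
  rw [devMap, cubePoint, diagonalMap_mk hε hε' hs _ hmem,
    diagonalHeight_large hε hε' hs _ hq _ (hkz _) (sub_round_mem p),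
    sideHeight_mk hε hε' s hq _ hmem, AddCircle.coe_add]
  congr 1
  · rw [b.stateAt_copyAt hs v (fun z => by rw [move_opp q.1 _ (hkz z), hkz]) (fun z l hl h => ?_)]
    · refine coe_eq_coe_of_sub_eq_intCast (-(stateAt s v (b.vec k) * round (p k))) ?_
      push_cast
      ring
    · have h1 := (b.frameAt z).independent k l hl.symm
      rcases eq_or_eq_opp_of_move_eq q.1 _ _ (by rw [vec_apply, vec_apply]) (hkz z)
        (h.trans (hkz z)) with h | h
      · exact h1.1 h
      · exact h1.2 h
  · rw [AddCircle.coe_sub, ← coe_sum_sidePairs_half (s := s) (b.copyAt v fun k => round (p k)),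
      ← AddCircle.coe_sub, ← Finset.sum_sub_distrib]
    congr 1
    refine Finset.sum_congr rfl fun a _ => ?_
    ring

lemma sideHeight_devMap_congr (hε : 0 < ε) (hε' : ε < 1 / 2) (s : State)
    (v : Fin 8 → ZMod 2) (hq : q.1 ≠ 4) {k : Fin 4}
    (hk : moveOf (colour (b.vec k)) = (q.1 : ℕ)) {p p' : Fin 4 → ℝ}
    (hp : ∀ l, l ≠ k → p l = p' l) :
    sideHeight hε s q (b.devMap hε hε' v p) = sideHeight hε s q (b.devMap hε hε' v p') := by
  have hmem := fun p : Fin 4 → ℝ =>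
    (b.frameAt fun k => round (p k)).chart_mem_cubicFacet hε hε' (sub_round_mem p)
  rw [devMap, devMap, cubePoint, cubePoint, sideHeight_mk hε hε' s hq _ (hmem p),
    sideHeight_mk hε hε' s hq _ (hmem p')]
  have hcoord : ∀ a : Facet, a.1 q.1 = q.2 → moveOf (colour a) ≠ (q.1 : ℕ) →
      cubeCoord ε a ((b.frameAt fun k => round (p k)).chart ε fun k => p k - round (p k)) =
      cubeCoord ε a ((b.frameAt fun k => round (p' k)).chart ε fun k => p' k - round (p' k)) := by
    intro a ha hm
    rw [chart_frameAt, chart_frameAt]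
    obtain ⟨l, hl⟩ := b.exists_eq_or_eq_opp ha
    have hlk : l ≠ k := by
      rintro rfl
      rcases hl with rfl | rfl
      · exact hm hk
      · exact hm (move_opp q.1 _ hk)
    rcases hl with rfl | rfl
    · rw [b.cubeCoord_chart hε, b.cubeCoord_chart hε, hp l hlk]
    · rw [cubeCoord_opp hε (by rw [vec_apply, mul_chart_apply_self]),
        cubeCoord_opp hε (by rw [vec_apply, mul_chart_apply_self]),
        b.cubeCoord_chart hε, b.cubeCoord_chart hε, hp l hlk]
  refine Finset.sum_congr rfl fun a ha => ?_
  obtain ⟨-, ⟨-, h1⟩, h2⟩ := Finset.mem_filter.mp ha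
  rw [pairCoord, pairCoord, hcoord a h2 h1, hcoord (partner a)
    (partner_mem_of_mem_sidePairs hq ha) (by rwa [move_partner])]
  congr 3
  refine stateAt_congr fun c hc => ?_
  by_contra hne
  obtain ⟨l, hl⟩ := b.exists_walk_ne v hne
  by_cases hlk : l = k
  · subst hlk
    have hc1 : colour (b.vec l) ≠ c := fun h => h1 (by rw [← hc, ← h, hk])
    have hc2 : colour (opp q.1 (b.vec l)) ≠ c := fun h => h1 (by
      rw [← hc, ← h, move_opp q.1 _ hk])
    apply hl
    simp [walk, hc1.symm, hc2.symm]
  · exact hl (by simp only [hp l hlk])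

end Frame

end Heights

/-! ### Isotopies of tori -/

lemma modOne_coe (L : ℕ) (r : ℝ) : modOne L (r : AddCircle (L : ℝ)) = (r : AddCircle (1 : ℝ)) := rfl

/-- If the difference of a circle-valued map and the first coordinate has a real-valued lift that
does not depend on the first coordinate, it can be sheared away. -/
lemma isIsotopic_of_eq_add {L : ℕ} {f : Torus L → AddCircle (1 : ℝ)} {e : Torus L → ℝ}
    (he : Continuous e) (he' : ∀ x x' : Torus L, (∀ k, k ≠ 0 → x k = x' k) → e x = e x')
    (hf : ∀ x, f x = modOne L (x 0) + (e x : AddCircle (1 : ℝ))) :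
    IsIsotopic f fun x => modOne L (x 0) := by
  have hupd : ∀ x r, e (Function.update x 0 r) = e x := fun x r =>
    he' _ _ fun k hk => Function.update_of_ne hk _ _
  have hcoe : Continuous fun r : ℝ => (r : AddCircle (L : ℝ)) := AddCircle.continuous_mk' _
  refine ⟨fun t =>
    { toFun := fun x => Function.update x 0 (x 0 - ((t * e x : ℝ) : AddCircle (L : ℝ)))
      invFun := fun x => Function.update x 0 (x 0 + ((t * e x : ℝ) : AddCircle (L : ℝ)))
      left_inv := fun x => by simp [hupd]
      right_inv := fun x => by simp [hupd]
      continuous_toFun := continuous_id.update 0 ((continuous_apply 0).sub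
        (hcoe.comp (continuous_const.mul he)))
      continuous_invFun := continuous_id.update 0 ((continuous_apply 0).add
        (hcoe.comp (continuous_const.mul he))) }, ?_, fun x => ?_, fun x => ?_⟩
  · exact continuous_snd.update 0 (((continuous_apply 0).comp continuous_snd).sub
      (hcoe.comp ((continuous_subtype_val.comp continuous_fst).mul (he.comp continuous_snd))))
  · simp
  · simp [hf, hupd, modOne_coe]

lemma continuous_signedPerm {L : ℕ} (τ : Equiv.Perm (Fin 4)) (η : Fin 4 → ℤˣ) :
    Continuous (signedPerm τ η : Torus L → Torus L) :=
  continuous_pi fun _ => (continuous_apply _).zsmul _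

lemma exists_isCubicalIdentification {ε : ℝ} (hε : 0 < ε) (hε' : ε < 1 / 2) {q : IdealVertex}
    {C : Set (Manifold ε)} (hC : IsBoundaryComponentOver ε q C) {L : ℕ} (hL : IsPeriod q L) :
    ∃ ψ, IsCubicalIdentification ε q C L ψ := by
  obtain ⟨v, x, hx, rfl⟩ := hC
  obtain ⟨b⟩ := Frame.exists_frame q
  obtain ⟨ψ, hψ⟩ := b.exists_torusMap hε hε' v hL
  exact ⟨ψ, b.isCubicalIdentification hε hε' v hL hψ (range_devMap hε hε' b hx)⟩

/-- The large boundary tori: the axis of the fibration is the one whose ends belong to the move of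
the ideal vertex. -/
theorem exists_and_isIsotopic {ε : ℝ} (hε : 0 < ε) (hε' : ε < 1 / 2) {s : State}
    (hs : IsBalanced s) {q : IdealVertex} {C : Set (Manifold ε)}
    (hC : IsBoundaryComponentOver ε q C) (hq : q.1 ≠ 4) :
    (∃ ψ, IsCubicalIdentification ε q C 4 ψ) ∧
      ∀ ψ, IsCubicalIdentification ε q C 4 ψ →
        ∃ (τ : Equiv.Perm (Fin 4)) (η : Fin 4 → ℤˣ),
          IsIsotopic (fun x => diagonalMap ε s (ψ (signedPerm τ η x)))
            (fun x => modOne 4 (x 0)) := by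
  refine ⟨exists_isCubicalIdentification hε hε' hC (Or.inl ⟨hq, rfl⟩), fun ψ hψ => ?_⟩
  obtain ⟨b, v, hb⟩ := hψ.exists_devMap_eq hε hε' (Or.inl ⟨hq, rfl⟩)
  obtain ⟨k, hk⟩ := b.exists_axis hq
  set η := stateAt s v (b.vec k)
  refine ⟨Equiv.swap 0 k, fun _ => η, isIsotopic_of_eq_add
    (e := fun x => (∑ _a ∈ sidePairs q, (1 / 2 : ℝ)) -
      sideHeight hε s q (ψ (signedPerm (Equiv.swap 0 k) (fun _ => η) x))) ?_ ?_ ?_⟩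
  · exact continuous_const.sub ((continuous_sideHeight hε s q).comp
      (hψ.isEmbedding.continuous.comp (continuous_signedPerm _ _)))
  · intro x x' hx
    have h1 : ∀ l, l ≠ k → signedPerm (Equiv.swap 0 k) (fun _ => η) x l =
        signedPerm (Equiv.swap 0 k) (fun _ => η) x' l := by
      intro l hl
      have h2 : Equiv.swap 0 k l ≠ 0 := fun h => hl
        ((Equiv.swap_apply_eq_iff.mp h).trans (Equiv.swap_apply_left 0 k))
      simp only [signedPerm, hx _ h2]
    obtain ⟨p, hp⟩ := torusProj_surjective 4 (signedPerm (Equiv.swap 0 k) (fun _ => η) x)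
    obtain ⟨p', hp'⟩ := torusProj_surjective 4 (signedPerm (Equiv.swap 0 k) (fun _ => η) x')
    have h3 : torusProj 4 p' = torusProj 4 (Function.update p k (p' k)) := by
      ext l
      by_cases hl : l = k
      · subst hl; simp [torusProj]
      · rw [hp', ← h1 l hl, ← hp]; simp [torusProj, hl]
    rw [← hp, ← hp', h3, hb, hb, b.sideHeight_devMap_congr hε hε' s v hq hk]
    intro l hl
    rw [Function.update_of_ne hl]
  · intro x
    obtain ⟨p, hp⟩ := torusProj_surjective 4 (signedPerm (Equiv.swap 0 k) (fun _ => η) x)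
    rw [← hp, hb, b.diagonalMap_devMap_large hε hε' hs v hq hk]
    congr 1
    have h1 : ((p k : ℝ) : AddCircle ((4 : ℕ) : ℝ)) = ((η : ℤˣ) : ℤ) • x 0 := by
      have := congrFun hp k
      simpa [torusProj, signedPerm] using this
    have h2 : x 0 = ((η : ℤˣ) : ℤ) • ((p k : ℝ) : AddCircle ((4 : ℕ) : ℝ)) := by
      rw [h1, smul_smul]
      rcases Int.units_eq_one_or η with h | h <;> simp [h]
    rw [h2, ← AddCircle.coe_zsmul, modOne_coe, zsmul_eq_mul]

/-- The small boundary tori: each of the four axes carries coherently oriented edges. -/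
theorem exists_and_eq_sum {ε : ℝ} (hε : 0 < ε) (hε' : ε < 1 / 2) {s : State}
    (hs : IsBalanced s) {q : IdealVertex} {C : Set (Manifold ε)}
    (hC : IsBoundaryComponentOver ε q C) (hq : q.1 = 4) :
    (∃ ψ, IsCubicalIdentification ε q C 2 ψ) ∧
      ∀ ψ, IsCubicalIdentification ε q C 2 ψ →
        ∃ (τ : Equiv.Perm (Fin 4)) (η : Fin 4 → ℤˣ), ∀ x,
          diagonalMap ε s (ψ (signedPerm τ η x)) = modOne 2 (x 0 + x 1 + x 2 + x 3) := by
  refine ⟨exists_isCubicalIdentification hε hε' hC (Or.inr ⟨hq, rfl⟩), fun ψ hψ => ?_⟩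
  obtain ⟨b, v, hb⟩ := hψ.exists_devMap_eq hε hε' (Or.inr ⟨hq, rfl⟩)
  refine ⟨1, fun k => stateAt s v (b.vec k), fun x => ?_⟩
  obtain ⟨p, rfl⟩ := torusProj_surjective 2 x
  have h1 : signedPerm 1 (fun k => stateAt s v (b.vec k)) (torusProj 2 p) =
      torusProj 2 fun k => ((stateAt s v (b.vec k) : ℤ) : ℝ) * p k := by
    ext k
    simp only [signedPerm, torusProj, Equiv.Perm.coe_one, id_eq]
    rw [← AddCircle.coe_zsmul, zsmul_eq_mul]
  rw [h1, hb, b.diagonalMap_devMap_small hε hε' hs v hq]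
  simp only [← mul_assoc, coe_units_mul_self, one_mul]
  rw [Fin.sum_univ_four]
  rfl

end GluedPolytope

end

theorem mainTheorem8 (ε : ℝ) (hε : 0 < ε) (hε' : ε < 1 / 2)
    (s : GluedPolytope.State) (hs : GluedPolytope.IsBalanced s)
    (q : GluedPolytope.IdealVertex) (C : Set (GluedPolytope.Manifold ε))
    (hC : GluedPolytope.IsBoundaryComponentOver ε q C) :
    (q.1 ≠ 4 →
      (∃ ψ, GluedPolytope.IsCubicalIdentification ε q C 4 ψ) ∧
      ∀ ψ, GluedPolytope.IsCubicalIdentification ε q C 4 ψ →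
        ∃ (τ : Equiv.Perm (Fin 4)) (η : Fin 4 → ℤˣ),
          GluedPolytope.IsIsotopic
            (fun x => GluedPolytope.diagonalMap ε s (ψ (GluedPolytope.signedPerm τ η x)))
            (fun x => GluedPolytope.modOne 4 (x 0))) ∧
    (q.1 = 4 →
      (∃ ψ, GluedPolytope.IsCubicalIdentification ε q C 2 ψ) ∧
      ∀ ψ, GluedPolytope.IsCubicalIdentification ε q C 2 ψ →
        ∃ (τ : Equiv.Perm (Fin 4)) (η : Fin 4 → ℤˣ),
          ∀ x, GluedPolytope.diagonalMap ε s (ψ (GluedPolytope.signedPerm τ η x)) =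
            GluedPolytope.modOne 2 (x 0 + x 1 + x 2 + x 3)) :=
  ⟨GluedPolytope.exists_and_isIsotopic hε hε' hs hC, GluedPolytope.exists_and_eq_sum hε hε' hs hC⟩
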